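/- Let $\mathbf U$ be a finite vector space over a finite field $GF(q)$ with a nondegenerate form of one of the following types, where $D\ge 1$: $B_D$ (quadratic, $\dim\mathbf U=2D+1$, $e=0$); $C_D$ (symplectic, $\dim\mathbf U=2D$, $e=0$); $D_D$ (quadratic of Witt index $D$, $\dim\mathbf U=2D$, $e=-1$); ${}^2D_{D+1}$ (quadratic of Witt index $D$, $\dim\mathbf U=2D+2$, $e=1$); ${}^2A_{2D}$ (Hermitean, $\dim\mathbf U=2D+1$, $e=1/2$); ${}^2A_{2D-1}$ (Hermitean, $\dim\mathbf U=2D$, $e=-1/2$); in the Hermitean cases $q$ is a square and the form is Hermitean with respect to the automorphism of $GF(q)$ of order two. Let $\Gamma$ be the corresponding dual polar graph: its vertex set $X$ consists of the maximal isotropic subspaces of $\mathbf U$ (all of dimension $D$), and $y,z\in X$ are adjacent whenever $\dim(y\cap z)=D-1$. Let $\partial$ be the path-length distance of $\Gamma$; the diameter of $\Gamma$ is $D$. Assume that $\Gamma$ is not bipartite, and fix $x\in X$. Let $V=\mathbb C^X$ with the standard Hermitean inner product. For $0\le i\le D$ let $\Gamma_i(x)=\{y\in X:\partial(x,y)=i\}$,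 let $A_i$ be the $i$th distance matrix of $\Gamma$ and $A=A_1$, let $E_i^*$ be the diagonal matrix with $(y,y)$-entry $1$ if $y\in\Gamma_i(x)$ and $0$ otherwise, and let $E_i$ be the orthogonal projection of $V$ onto the eigenspace of $A$ for the eigenvalue $$\theta_i=q^{e+1}\frac{q^D-1}{q-1}-\frac{(q^i-1)(q^{D+e+1-i}+1)}{q-1}$$ (the ordering $E_0,\dots,E_D$ is the standard $Q$-polynomial structure of $\Gamma$). Let $T$ be the subalgebra of $\mathrm{Mat}_X(\mathbb C)$ generated by $A_0,\dots,A_D,E_0^*,\dots,E_D^*$. A $T$-module is a $T$-submodule of $V$. For an irreducible $T$-module $W$ put $r=\min\{i:E_i^*W\ne0\}$, $t=\min\{i:E_iW\ne 0\}$, $d=|\{i:E_i^*W\neq 0\}|-1$ (where $0\le i\le D$); the displacement of $W$ is $r+t-D+d$. The nucleus $\mathcal N=\mathcal N(x)$ is the span of the irreducible $T$-modules of displacement $0$. For $y,z\in X$ write $y\sim z$ whenever $\partial(x,y)=\partial(x,z)=i$ for some $i$ and $y,z$ lie in the same connected component of the subgraph of $\Gamma$ induced on $\Gamma_i(x)$;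 this is an equivalence relation. Then $\mathcal N$ has an orthogonal basis consisting of the characteristic vectors of the $\sim$ equivalence classes. Moreover, for $0\le i\le D$ the $\sim$ classes contained in $\Gamma_i(x)$ are exactly the connected components of the subgraph induced on $\Gamma_i(x)$, and every $\sim$ class arises in this way for some $i$ with $0\le i\le D$. -/

import Mathlib

/-! ### The nucleus of a graph with respect to a vertex and an ordering of eigenvalues -/

namespace Nucleus

noncomputable section

open scoped Classical in
/-- The `i`-th distance matrix `A_i` of `Γ`. -/
def distMatrix {X : Type*} (Γ : SimpleGraph X) (i : ℕ) : Matrix X X ℂ :=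
  Matrix.of fun y z => if Γ.dist y z = i then 1 else 0

open scoped Classical in
/-- The `i`-th dual primitive idempotent `E*_i = E*_i(x)` of `Γ` with respect to `x`. -/
def dualIdem {X : Type*} (Γ : SimpleGraph X) (x : X) (i : ℕ) : Matrix X X ℂ :=
  Matrix.diagonal fun y => if Γ.dist x y = i then 1 else 0

variable {X : Type*} [Fintype X] [DecidableEq X]

/-- The subconstituent (Terwilliger) algebra `T = T(x)` of a graph of diameter `D`: it is generated
by the Bose-Mesner algebra (spanned by the `A_i`) and the dual Bose-Mesner algebra
(spanned by the `E*_i`), where `0 ≤ i ≤ D`. -/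
def subconstituentAlgebra (Γ : SimpleGraph X) (D : ℕ) (x : X) : Subalgebra ℂ (Matrix X X ℂ) :=
  Algebra.adjoin ℂ
    ({B | ∃ i ≤ D, B = distMatrix Γ i} ∪ {B | ∃ i ≤ D, B = dualIdem Γ x i})

/-- `W` is a `T`-module, i.e. a `T`-submodule of the standard module `V = ℂ^X`. -/
def IsTModule (Γ : SimpleGraph X) (D : ℕ) (x : X) (W : Submodule ℂ (EuclideanSpace ℂ X)) : Prop :=
  ∀ B ∈ subconstituentAlgebra Γ D x, ∀ w ∈ W, Matrix.toEuclideanLin B w ∈ W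

/-- `W` is an irreducible `T`-module. -/
def IsIrredTModule (Γ : SimpleGraph X) (D : ℕ) (x : X)
    (W : Submodule ℂ (EuclideanSpace ℂ X)) : Prop :=
  IsTModule Γ D x W ∧ W ≠ ⊥ ∧
    ∀ W' : Submodule ℂ (EuclideanSpace ℂ X), IsTModule Γ D x W' → W' ≤ W → W' = ⊥ ∨ W' = W

/-- The primitive idempotent of `Γ` for the eigenvalue `θ`: the orthogonal projection of
`V = ℂ^X` onto the `θ`-eigenspace of the adjacency matrix (which acts as the identity on this
eigenspace and as zero on every other eigenspace). -/
def primIdem (Γ : SimpleGraph X) (θ : ℝ) :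
    EuclideanSpace ℂ X →ₗ[ℂ] EuclideanSpace ℂ X :=
  ((Module.End.eigenspace (Matrix.toEuclideanLin (distMatrix Γ 1)) (θ : ℂ)).starProjection :
    EuclideanSpace ℂ X →L[ℂ] EuclideanSpace ℂ X)

/-- The set of `i` with `0 ≤ i ≤ D` and `E*_i W ≠ 0`. -/
def support (Γ : SimpleGraph X) (D : ℕ) (x : X) (W : Submodule ℂ (EuclideanSpace ℂ X)) : Set ℕ :=
  {i | i ≤ D ∧ W.map (Matrix.toEuclideanLin (dualIdem Γ x i)) ≠ ⊥}

/-- The set of `i` with `0 ≤ i ≤ D` and `E_i W ≠ 0`, where `E_i` is the primitive idempotent for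
the eigenvalue `θ i`. -/
def dualSupport (Γ : SimpleGraph X) (D : ℕ) (θ : ℕ → ℝ)
    (W : Submodule ℂ (EuclideanSpace ℂ X)) : Set ℕ :=
  {i | i ≤ D ∧ W.map (primIdem Γ (θ i)) ≠ ⊥}

/-- The endpoint of `W`. -/
def endpoint (Γ : SimpleGraph X) (D : ℕ) (x : X) (W : Submodule ℂ (EuclideanSpace ℂ X)) : ℕ :=
  sInf (support Γ D x W)

/-- The dual endpoint of `W`. -/
def dualEndpoint (Γ : SimpleGraph X) (D : ℕ) (θ : ℕ → ℝ)
    (W : Submodule ℂ (EuclideanSpace ℂ X)) : ℕ :=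
  sInf (dualSupport Γ D θ W)

/-- The diameter of `W`. -/
def diameter (Γ : SimpleGraph X) (D : ℕ) (x : X) (W : Submodule ℂ (EuclideanSpace ℂ X)) : ℤ :=
  ((support Γ D x W).ncard : ℤ) - 1

/-- The displacement `r + t - D + d` of `W`. -/
def displacement (Γ : SimpleGraph X) (D : ℕ) (θ : ℕ → ℝ) (x : X)
    (W : Submodule ℂ (EuclideanSpace ℂ X)) : ℤ :=
  (endpoint Γ D x W : ℤ) + (dualEndpoint Γ D θ W : ℤ) - (D : ℤ) + diameter Γ D x W

/-- The nucleus `𝒩(x)` of a graph `Γ` of diameter `D`, for the ordering `θ 0, …, θ D` of its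
eigenvalues: the span of the irreducible `T(x)`-modules of displacement `0`. -/
def nucleus (Γ : SimpleGraph X) (D : ℕ) (θ : ℕ → ℝ) (x : X) :
    Submodule ℂ (EuclideanSpace ℂ X) :=
  sSup {W | IsIrredTModule Γ D x W ∧ displacement Γ D θ x W = 0}

/-- The characteristic vector of a set of vertices. -/
def charVec {Y : Type*} (C : Set Y) : EuclideanSpace ℂ Y :=
  WithLp.toLp 2 (C.indicator 1)

end

/-- The `i`-th subconstituent `Γ_i(x)`. -/
def subconstituent {Y : Type*} (Γ : SimpleGraph Y) (x : Y) (i : ℕ) : Set Y :=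
  {y | Γ.dist x y = i}

/-- The equivalence relation `∼` on the vertices: `y ∼ z` whenever `y` and `z` have the same
distance `i` from `x` and are in the same connected component of the subgraph induced
on `Γ_i(x)`. -/
def sim {Y : Type*} (Γ : SimpleGraph Y) (x : Y) : Setoid Y where
  r y z := ∃ (i : ℕ) (hy : y ∈ subconstituent Γ x i) (hz : z ∈ subconstituent Γ x i),
    (Γ.induce (subconstituent Γ x i)).Reachable ⟨y, hy⟩ ⟨z, hz⟩
  iseqv :=
    { refl := fun y => ⟨Γ.dist x y, rfl, rfl, SimpleGraph.Reachable.refl _⟩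
      symm := fun ⟨i, hy, hz, h⟩ => ⟨i, hz, hy, h.symm⟩
      trans := by
        rintro y z w ⟨i, hy, hz, h⟩ ⟨j, hz', hw, h'⟩
        obtain rfl : i = j := hz.symm.trans hz'
        exact ⟨i, hy, hw, h.trans h'⟩ }

/-- The vertex sets of the connected components of (the subgraph induced on) `Γ_i(x)`. -/
def components {Y : Type*} (Γ : SimpleGraph Y) (x : Y) (i : ℕ) : Set (Set Y) :=
  {C | ∃ c : (Γ.induce (subconstituent Γ x i)).ConnectedComponent, C = Subtype.val '' c.supp}

end Nucleus

/-! ### Dual polar graphs -/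

/-- A quadratic, bilinear or sesquilinear form on `U`. -/
inductive PolarForm (F U : Type*) [Field F] [AddCommGroup U] [Module F U] where
  | quadratic (Q : QuadraticForm F U)
  | symplectic (B : LinearMap.BilinForm F U)
  | hermitian (σ : F →+* F) (B : U →ₛₗ[σ] U →ₗ[F] F)

/-- The six families of dual polar graphs: `B_D(q)`, `C_D(q)`, `D_D(q)`, `²D_{D+1}(q)`,
`²A_{2D}(√q)`, `²A_{2D-1}(√q)`, where `q` is the order of the field. -/
inductive DualPolarType where
  | B
  | C
  | D
  | twistedD
  | twistedAEven
  | twistedAOdd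

namespace DualPolarType

noncomputable section

/-- The parameter `e`. -/
def e : DualPolarType → ℝ
  | B => 0
  | C => 0
  | D => -1
  | twistedD => 1
  | twistedAEven => 1 / 2
  | twistedAOdd => -1 / 2

/-- The eigenvalues `θ_0 > θ_1 > ⋯ > θ_D` of a dual polar graph, in their standard
`Q`-polynomial ordering. -/
def eigenvalue (τ : DualPolarType) (q D i : ℕ) : ℝ :=
  (q : ℝ) ^ (τ.e + 1) * (((q : ℝ) ^ D - 1) / ((q : ℝ) - 1)) -
    ((q : ℝ) ^ i - 1) * ((q : ℝ) ^ ((D : ℝ) + τ.e + 1 - (i : ℝ)) + 1) / ((q : ℝ) - 1)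

end

end DualPolarType

namespace PolarForm

variable {F U : Type*} [Field F] [AddCommGroup U] [Module F U]

/-- A subspace is isotropic if the form vanishes completely on it. -/
def IsIsotropic : PolarForm F U → Submodule F U → Prop
  | quadratic Q, W => ∀ u ∈ W, Q u = 0
  | symplectic B, W => ∀ u ∈ W, ∀ v ∈ W, B u v = 0
  | hermitian _ B, W => ∀ u ∈ W, ∀ v ∈ W, B u v = 0

/-- The Witt index is `D`: the largest dimension of an isotropic subspace is `D`. -/
def HasWittIndex (Φ : PolarForm F U) (D : ℕ) : Prop :=
  IsGreatest {d | ∃ W : Submodule F U, Φ.IsIsotropic W ∧ Module.finrank F W = d} D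

/-- The form is nondegenerate: it is a nondegenerate quadratic form, or a nondegenerate
alternating bilinear form, or a nondegenerate Hermitean form with respect to a field
automorphism of order two. -/
def IsNondegenerate : PolarForm F U → Prop
  | quadratic Q => Q.Nondegenerate
  | symplectic B => B.IsAlt ∧ B.Nondegenerate
  | hermitian σ B => (∀ a, σ (σ a) = a) ∧ (∃ a, σ a ≠ a) ∧ B.IsSymm ∧ B.Nondegenerate

/-- The form is of the given type, with parameter `D`. -/
def IsOfType (Φ : PolarForm F U) (τ : DualPolarType) (D : ℕ) : Prop :=
  Φ.IsNondegenerate ∧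
  match τ, Φ with
  | .B, quadratic _ => Module.finrank F U = 2 * D + 1
  | .C, symplectic _ => Module.finrank F U = 2 * D
  | .D, quadratic _ => Module.finrank F U = 2 * D ∧ Φ.HasWittIndex D
  | .twistedD, quadratic _ => Module.finrank F U = 2 * D + 2 ∧ Φ.HasWittIndex D
  | .twistedAEven, hermitian _ _ => Module.finrank F U = 2 * D + 1
  | .twistedAOdd, hermitian _ _ => Module.finrank F U = 2 * D
  | _, _ => False

/-- The vertices of the dual polar graph: the maximal isotropic subspaces. -/
abbrev Vertex (Φ : PolarForm F U) : Type _ :=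
  {W : Submodule F U // Maximal Φ.IsIsotropic W}

noncomputable instance instFintypeVertex [Finite U] (Φ : PolarForm F U) : Fintype Φ.Vertex :=
  have : Finite (Submodule F U) := Finite.of_injective _ SetLike.coe_injective
  Fintype.ofFinite _

noncomputable instance instDecidableEqVertex (Φ : PolarForm F U) : DecidableEq Φ.Vertex :=
  Classical.decEq _

/-- The dual polar graph: two vertices are adjacent if they meet in dimension `D - 1`. -/
def dualPolarGraph (Φ : PolarForm F U) (D : ℕ) : SimpleGraph Φ.Vertex where
  Adj y z := y ≠ z ∧ Module.finrank F (y.1 ⊓ z.1 : Submodule F U) + 1 = D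
  symm := ⟨fun _ _ h => ⟨h.1.symm, by rw [inf_comm]; exact h.2⟩⟩
  loopless := ⟨fun _ h => h.1 rfl⟩

/-- The nucleus `𝒩(x)` of the dual polar graph with respect to the vertex `x`, for the standard
`Q`-polynomial structure. -/
noncomputable def nucleus [Finite U] (Φ : PolarForm F U) (τ : DualPolarType) (D : ℕ)
    (x : Φ.Vertex) : Submodule ℂ (EuclideanSpace ℂ Φ.Vertex) :=
  Nucleus.nucleus (Φ.dualPolarGraph D) D (τ.eigenvalue (Nat.card F) D) x

end PolarForm

/-! Write q for the order of the field, [n] for the q-integer `qInt q n`, and call an isotropic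
subspace of dimension D - 1 a line, its points being the s + 1 vertices that contain it. All six
families are polar spaces of this kind with s = q^(e+1), and the argument uses only D, q and s. If s
= 1 there are no edges inside the subconstituents and the graph is bipartite, so s ≥ 2.

The central object is the operator L = `laplacianOp` equal to q^(-i) (a_i - F) on Γ_i(x), where F is
the adjacency operator of the edges inside the subconstituents and a_i = (s - 1)[i] is its valency
there. Being a scaled graph Laplacian, L has as kernel the vectors constant on the ∼ classes, and
its eigenvalues have nonnegative real part. It remains to show that the nucleus is ker L. Counting
common neighbours (`HasOrder.card_common_level`) gives FR = qRF + (s - 1)R for the raising operator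
R; together with a_(i+1) = q a_i + (s - 1) this makes L commute with A. Hence L is a scalar μ on
each irreducible module W.

Displacement zero forces μ = 0 (`IsFlag.laplacianOp_eq_zero`). Let r and m be the first and last
level of W and t its dual endpoint; the displacement is m + t - D. Besides the flag `low` of vectors
supported near x there is a flag G, where G_j is spanned by the characteristic vectors of {y : K ≤
y} with dim K < j. On G the operator A is triangular with diagonal θ_j = s[D-j] - [j], and
multiplication by q^(D-∂(x,y)) = |x ∩ y| climbs one step. If m + t = D, irreducibility makes the two
flags opposite in W. Take v ≠ 0 of level r in W and k maximal with R^k v ≠ 0. The product of the k +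
1 factors A - θ_(D-r-i) then kills v, and its coefficient at R^k v gives μ Σ q^(r+i) = Σ ([D-r-i] -
[r+i]). A monic polynomial of degree k + 1 in A that kills v forces 2r + k + 1 > D, so the right
side is at most 0 and μ = 0.

Conversely (`IsSubflag.displacement_eq_zero`), the ∼ classes are the sets of y with a given
intersection y ∩ x (`HasOrder.sim_iff`), so ker L is spanned by the characteristic vectors above
with K ≤ x. These form a second triangular flag, in general position with respect to `low`, which
gives m + t ≥ D for W inside ker L. Orthogonality of W to G_t gives m + t ≤ D. -/

open Module Submodule

/-! ### Polar spaces: orthogonality, maximal isotropic subspaces and projections. -/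

/-- A vector space with a reflexive pairing that is linear in the second variable and a set of
singular vectors that is closed under the operations that stay inside a totally isotropic subspace. -/
structure PolarSpace (F U : Type*) [Field F] [AddCommGroup U] [Module F U] where
  form : U → U →ₗ[F] F
  sing : U → Prop
  refl : ∀ u v, form u v = 0 → form v u = 0
  sing_zero : sing 0
  sing_smul : ∀ (a : F) u, sing u → sing (a • u)
  sing_add : ∀ u v, sing u → sing v → form u v = 0 → sing (u + v)
  form_self : ∀ u, sing u → form u u = 0

namespace PolarSpace

variable {F U : Type*} [Field F] [AddCommGroup U] [Module F U] (P : PolarSpace F U)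

/-- The subspace orthogonal to all vectors of `L`. -/
def perp (L : Submodule F U) : Submodule F U := ⨅ u ∈ L, LinearMap.ker (P.form u)

/-- Totally isotropic (totally singular) subspaces. -/
def Iso (W : Submodule F U) : Prop := ∀ u ∈ W, P.sing u ∧ ∀ v ∈ W, P.form u v = 0

variable {P}

theorem mem_perp {L : Submodule F U} {v : U} : v ∈ P.perp L ↔ ∀ u ∈ L, P.form u v = 0 := by
  simp [perp, Submodule.mem_iInf]

theorem mem_perp' {L : Submodule F U} {v : U} : v ∈ P.perp L ↔ ∀ u ∈ L, P.form v u = 0 := by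
  rw [mem_perp]
  exact forall₂_congr fun u _ => ⟨P.refl _ _, P.refl _ _⟩

theorem le_perp_comm {L M : Submodule F U} : L ≤ P.perp M ↔ M ≤ P.perp L :=
  ⟨fun h _ hv => mem_perp.2 fun _ hu => mem_perp'.1 (h hu) _ hv,
   fun h _ hv => mem_perp.2 fun _ hu => mem_perp'.1 (h hu) _ hv⟩

theorem perp_anti {L M : Submodule F U} (h : L ≤ M) : P.perp M ≤ P.perp L :=
  fun _ hv => mem_perp.2 fun u hu => mem_perp.1 hv u (h hu)

theorem perp_bot : P.perp ⊥ = ⊤ := by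
  ext v; simp only [mem_perp', mem_bot, forall_eq, map_zero, mem_top]

theorem perp_sup (L M : Submodule F U) : P.perp (L ⊔ M) = P.perp L ⊓ P.perp M := by
  apply le_antisymm (le_inf (perp_anti le_sup_left) (perp_anti le_sup_right))
  rw [le_perp_comm]
  exact sup_le (le_perp_comm.1 inf_le_left) (le_perp_comm.1 inf_le_right)

theorem Iso.mono {W W' : Submodule F U} (h : P.Iso W) (hle : W' ≤ W) : P.Iso W' :=
  fun u hu => ⟨(h u (hle hu)).1, fun v hv => (h u (hle hu)).2 v (hle hv)⟩

theorem Iso.le_perp {W : Submodule F U} (h : P.Iso W) : W ≤ P.perp W :=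
  fun _ hv => mem_perp'.2 fun u hu => (h _ hv).2 u hu

theorem Iso.le_perp_of_le {W L M : Submodule F U} (h : P.Iso W) (hL : L ≤ W) (hM : M ≤ W) :
    L ≤ P.perp M := (hL.trans h.le_perp).trans (perp_anti hM)

theorem Iso.sup {L M : Submodule F U} (hL : P.Iso L) (hM : P.Iso M) (h : L ≤ P.perp M) :
    P.Iso (L ⊔ M) := by
  have h' := le_perp_comm.1 h
  have hp : L ⊔ M ≤ P.perp (L ⊔ M) := by
    rw [perp_sup]
    exact sup_le (le_inf hL.le_perp h) (le_inf h' hM.le_perp)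
  intro u hu
  refine ⟨?_, fun v hv => mem_perp'.1 (hp hu) v hv⟩
  obtain ⟨a, ha, b, hb, rfl⟩ := mem_sup.1 hu
  exact P.sing_add _ _ (hL a ha).1 (hM b hb).1 (mem_perp'.1 (h ha) b hb)

theorem iso_span_singleton {u : U} (hu : P.sing u) : P.Iso (span F {u}) := by
  intro v hv
  obtain ⟨a, rfl⟩ := mem_span_singleton.1 hv
  refine ⟨P.sing_smul a u hu, fun w hw => ?_⟩
  obtain ⟨b, rfl⟩ := mem_span_singleton.1 hw
  rw [map_smul, P.refl _ _ (by rw [map_smul, P.form_self u hu, smul_zero]), smul_zero]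

theorem perp_span_singleton (u : U) : P.perp (span F {u}) = LinearMap.ker (P.form u) := by
  ext v
  rw [mem_perp', LinearMap.mem_ker]
  refine ⟨fun h => P.refl _ _ (h u (mem_span_singleton_self u)), fun h w hw => ?_⟩
  obtain ⟨b, rfl⟩ := mem_span_singleton.1 hw
  rw [map_smul, P.refl _ _ h, smul_zero]

theorem exists_sup_eq_inf_eq_bot {A B : Submodule F U} (h : A ≤ B) :
    ∃ C : Submodule F U, A ⊔ C = B ∧ A ⊓ C = ⊥ := by
  obtain ⟨M, hM⟩ := ComplementedLattice.exists_isCompl (A.comap B.subtype)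
  have hA : (A.comap B.subtype).map B.subtype = A := by
    rw [Submodule.map_comap_subtype, inf_eq_right.2 h]
  refine ⟨M.map B.subtype, ?_, ?_⟩
  · have := congrArg (Submodule.map B.subtype) hM.sup_eq_top
    rwa [Submodule.map_sup, hA, Submodule.map_top, Submodule.range_subtype] at this
  · have := congrArg (Submodule.map B.subtype) hM.inf_eq_bot
    rwa [Submodule.map_inf _ B.injective_subtype, hA, Submodule.map_bot] at this

section dimension

variable [FiniteDimensional F U]

theorem finrank_le_finrank_inf_ker_add_one (x : Submodule F U) (f : U →ₗ[F] F) :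
    finrank F x ≤ finrank F (x ⊓ LinearMap.ker f : Submodule F U) + 1 := by
  have h1 := LinearMap.finrank_range_add_finrank_ker (f.domRestrict x)
  have h2 : finrank F (LinearMap.range (f.domRestrict x)) ≤ 1 := by
    simpa using Submodule.finrank_le (LinearMap.range (f.domRestrict x))
  have h3 : finrank F (LinearMap.ker (f.domRestrict x)) =
      finrank F (x ⊓ LinearMap.ker f : Submodule F U) := by
    rw [LinearMap.domRestrict, LinearMap.ker_comp, ← finrank_map_subtype_eq,
      Submodule.map_comap_subtype]
  omega

/-- Each vector of a basis of `L` imposes at most one linear condition on `x`. -/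
theorem finrank_le_finrank_inf_perp_add (x L : Submodule F U) :
    finrank F x ≤ finrank F (x ⊓ P.perp L : Submodule F U) + finrank F L := by
  induction hn : finrank F L generalizing L with
  | zero =>
    rw [Submodule.finrank_eq_zero] at hn
    subst hn
    rw [perp_bot, inf_top_eq, add_zero]
  | succ n ih =>
    obtain ⟨u, hu, hu0⟩ : ∃ u ∈ L, u ≠ 0 := by
      apply Submodule.exists_mem_ne_zero_of_ne_bot
      rintro rfl
      simp at hn
    obtain ⟨M, hM, hML⟩ := exists_sup_eq_inf_eq_bot ((span_singleton_le_iff_mem _ _).2 hu)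
    have hd := Submodule.finrank_sup_add_finrank_inf_eq (span F {u}) M
    rw [hM, hML, finrank_bot, finrank_span_singleton hu0] at hd
    have h1 := ih M (by omega)
    have h2 := finrank_le_finrank_inf_ker_add_one (x ⊓ P.perp M) (P.form u)
    rw [← hM, perp_sup, perp_span_singleton, inf_comm (LinearMap.ker _), ← inf_assoc]
    omega

/-- Only a complement of `L ⊓ P.perp x` in `L` imposes conditions on `x`. -/
theorem finrank_inf_perp_add_le (x L : Submodule F U) :
    finrank F x + finrank F (L ⊓ P.perp x : Submodule F U) ≤
      finrank F (x ⊓ P.perp L : Submodule F U) + finrank F L := by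
  obtain ⟨M, hM, hML⟩ := exists_sup_eq_inf_eq_bot (inf_le_left : L ⊓ P.perp x ≤ L)
  have hd := Submodule.finrank_sup_add_finrank_inf_eq (L ⊓ P.perp x) M
  rw [hM, hML, finrank_bot] at hd
  have h1 := finrank_le_finrank_inf_perp_add (P := P) x M
  have h2 : x ⊓ P.perp L = x ⊓ P.perp M := by
    conv_lhs => rw [← hM, perp_sup, ← inf_assoc,
      inf_eq_left.2 (le_perp_comm.1 (inf_le_right : L ⊓ P.perp x ≤ P.perp x))]
  rw [h2]
  omega

/-- The two radicals of the pairing between two subspaces have the same codimension. -/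
theorem finrank_inf_perp (x L : Submodule F U) :
    finrank F (x ⊓ P.perp L : Submodule F U) + finrank F L =
      finrank F x + finrank F (L ⊓ P.perp x : Submodule F U) :=
  le_antisymm (by have := finrank_inf_perp_add_le (P := P) L x; omega)
    (finrank_inf_perp_add_le x L)

end dimension

/-- An isotropic subspace orthogonal to a maximal one is contained in it. -/
theorem le_of_le_perp {L x : Submodule F U} (hL : P.Iso L) (hx : Maximal P.Iso x)
    (h : L ≤ P.perp x) : L ≤ x :=
  le_sup_left.trans (hx.2 (hL.sup hx.1 h) le_sup_right)

theorem inf_perp_of_maximal {L x : Submodule F U} (hL : P.Iso L) (hx : Maximal P.Iso x) :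
    L ⊓ P.perp x = L ⊓ x :=
  le_antisymm (le_inf inf_le_left (le_of_le_perp (hL.mono inf_le_left) hx inf_le_right))
    (inf_le_inf_left _ hx.1.le_perp)

theorem finrank_maximal_eq [FiniteDimensional F U] {x y : Submodule F U} (hx : Maximal P.Iso x)
    (hy : Maximal P.Iso y) :
    finrank F x = finrank F y := by
  have := finrank_inf_perp (P := P) x y
  rw [inf_perp_of_maximal hx.1 hy, inf_perp_of_maximal hy.1 hx, inf_comm y x] at this
  omega

/-- No isotropic `z` exceeds a maximal `x` in dimension: in the pairing of `z` with `x` the radical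
on the side of `z` is just `z ⊓ x`, which also lies in the radical on the side of `x`. -/
theorem maximal_of_finrank [FiniteDimensional F U] {x y : Submodule F U} (hx : Maximal P.Iso x)
    (hy : P.Iso y)
    (h : finrank F x ≤ finrank F y) : Maximal P.Iso y := by
  refine ⟨hy, fun z hz hyz => ?_⟩
  have h1 := finrank_inf_perp (P := P) z x
  rw [inf_perp_of_maximal hz hx] at h1
  have h2 : finrank F (z ⊓ x : Submodule F U) ≤ finrank F (x ⊓ P.perp z : Submodule F U) :=
    Submodule.finrank_mono (le_inf inf_le_right (inf_le_left.trans hz.le_perp))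
  exact (Submodule.eq_of_le_of_finrank_le hyz (by omega)).ge

/-- The maximal isotropic subspace through `L` nearest to `x`. -/
def proj (P : PolarSpace F U) (L x : Submodule F U) : Submodule F U := L ⊔ (P.perp L ⊓ x)

theorem le_proj (L x : Submodule F U) : L ≤ P.proj L x := le_sup_left

theorem proj_iso {L x : Submodule F U} (hL : P.Iso L) (hx : Maximal P.Iso x) :
    P.Iso (P.proj L x) :=
  hL.sup (hx.1.mono inf_le_right) (le_perp_comm.1 inf_le_left)

theorem proj_inf {L x : Submodule F U} (hL : P.Iso L) : P.proj L x ⊓ x = P.perp L ⊓ x :=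
  le_antisymm (inf_le_inf_right _ (sup_le hL.le_perp inf_le_left))
    (le_inf le_sup_right inf_le_right)

theorem finrank_perp_inf [FiniteDimensional F U] {L x : Submodule F U} (hL : P.Iso L)
    (hx : Maximal P.Iso x) :
    finrank F (P.perp L ⊓ x : Submodule F U) + finrank F L =
      finrank F x + finrank F (L ⊓ x : Submodule F U) := by
  rw [inf_comm (P.perp L), finrank_inf_perp, inf_perp_of_maximal hL hx]

theorem proj_maximal [FiniteDimensional F U] {L x : Submodule F U} (hL : P.Iso L)
    (hx : Maximal P.Iso x) :
    Maximal P.Iso (P.proj L x) := by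
  apply maximal_of_finrank hx (proj_iso hL hx)
  have h1 := Submodule.finrank_sup_add_finrank_inf_eq L (P.perp L ⊓ x)
  rw [← inf_assoc, inf_of_le_left hL.le_perp] at h1
  have h2 := finrank_perp_inf hL hx
  unfold proj
  omega

theorem finrank_proj_inf [FiniteDimensional F U] {L x : Submodule F U} (hL : P.Iso L)
    (hx : Maximal P.Iso x) :
    finrank F (P.proj L x ⊓ x : Submodule F U) + finrank F L =
      finrank F x + finrank F (L ⊓ x : Submodule F U) := by
  rw [proj_inf hL, finrank_perp_inf hL hx]

/-- Two distinct points of a line meet in that line. -/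
theorem inf_eq_of_ne [FiniteDimensional F U] {L y z : Submodule F U} (hy : Maximal P.Iso y)
    (hz : Maximal P.Iso z)
    (hLy : L ≤ y) (hLz : L ≤ z) (hL : finrank F L + 1 = finrank F y) (h : y ≠ z) : y ⊓ z = L := by
  refine (Submodule.eq_of_le_of_finrank_le (le_inf hLy hLz) ?_).symm
  by_contra hlt
  have h1 : finrank F y ≤ finrank F (y ⊓ z : Submodule F U) := by omega
  have h2 := Submodule.eq_of_le_of_finrank_le inf_le_left h1
  exact h (hy.eq_of_le hz.1 (inf_eq_left.1 h2))

/-- All points of a line but one meet `x` in the same subspace. -/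
theorem inf_eq_of_ne_proj [FiniteDimensional F U] {L x y : Submodule F U} (hx : Maximal P.Iso x)
    (hy : Maximal P.Iso y)
    (hLy : L ≤ y) (hL : finrank F L + 1 = finrank F y) (h : y ≠ P.proj L x) :
    y ⊓ x = L ⊓ x := by
  apply le_antisymm _ (inf_le_inf_right _ hLy)
  have hLi := hy.1.mono hLy
  -- `y ⊓ x` is orthogonal to `L`, hence contained in the projection of `x`, and `y` meets that
  -- projection only in `L`.
  rw [← inf_eq_of_ne hy (proj_maximal hLi hx) hLy (le_proj _ _) hL h]
  exact le_inf (le_inf inf_le_left ((inf_le_inf_right x (hy.1.le_perp_of_le le_rfl hLy)).trans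
    le_sup_right)) inf_le_right

theorem exists_hyperplane [FiniteDimensional F U] {A y : Submodule F U} (hA : A ≤ y) {m : U}
    (hm : m ∈ y) (hmA : m ∉ A) :
    ∃ L : Submodule F U, A ≤ L ∧ L ≤ y ∧ m ∉ L ∧ finrank F L + 1 = finrank F y := by
  obtain ⟨f, hf, hA'⟩ := Submodule.exists_le_ker_of_notMem hmA
  have hmL : m ∉ y ⊓ LinearMap.ker f := fun h => hf h.2
  refine ⟨y ⊓ LinearMap.ker f, le_inf hA hA', inf_le_left, hmL, ?_⟩
  have h1 := finrank_le_finrank_inf_ker_add_one y f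
  have h2 : finrank F (y ⊓ LinearMap.ker f : Submodule F U) < finrank F y :=
    Submodule.finrank_lt_finrank_of_lt (lt_of_le_of_ne inf_le_left fun h => hmL (h.ge hm))
  omega

end PolarSpace

/-! ### q-integers and the number of hyperplanes. -/

/-- The `q`-integer `1 + q + ⋯ + q ^ (n - 1)`. -/
def qInt (q n : ℕ) : ℕ := ∑ k ∈ Finset.range n, q ^ k

theorem qInt_two (q : ℕ) : qInt q 2 = q + 1 := by simp [qInt, Finset.sum_range_succ, add_comm]

theorem qInt_succ (q n : ℕ) : qInt q (n + 1) = q * qInt q n + 1 := by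
  simp [qInt, Finset.sum_range_succ', Finset.mul_sum, pow_succ']

theorem qInt_succ' (q n : ℕ) : qInt q (n + 1) = qInt q n + q ^ n := by
  simp [qInt, Finset.sum_range_succ]

theorem qInt_mono (q : ℕ) : Monotone (qInt q) :=
  monotone_nat_of_le_succ fun n => by rw [qInt_succ']; omega

theorem qInt_strictMono {q : ℕ} (hq : 0 < q) : StrictMono (qInt q) :=
  strictMono_nat_of_lt_succ fun n => by rw [qInt_succ']; have := pow_pos hq n; omega

/-- The number of hyperplanes of a finite vector space. -/
theorem card_finrank_add_one (F V : Type*) [Field F] [Finite F] [AddCommGroup V] [Module F V]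
    [FiniteDimensional F V] :
    Nat.card {H : Submodule F V // finrank F H + 1 = finrank F V} =
      qInt (Nat.card F) (finrank F V) := by
  -- Hyperplanes of `V` correspond to points of the projective space of the dual.
  have h := Projectivization.card_of_finrank (k := F) (V := Dual F V)
    (Subspace.dual_finrank_eq (K := F) (V := V))
  rw [qInt, ← h, Nat.card_congr (Projectivization.equivSubmodule F (Dual F V))]
  refine Nat.card_congr ((Subspace.orderIsoFiniteDimensional (K := F) (V := V)).toEquiv.trans
    OrderDual.ofDual |>.subtypeEquiv fun H => ?_)
  have h2 := Subspace.finrank_add_finrank_dualAnnihilator_eq H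
  show _ ↔ finrank F (H.dualAnnihilator) = 1
  omega

theorem finrank_map_add_finrank_inf_ker {F V V' : Type*} [Field F] [AddCommGroup V] [Module F V]
    [AddCommGroup V'] [Module F V'] [FiniteDimensional F V] (f : V →ₗ[F] V') (N : Submodule F V) :
    finrank F (N.map f) + finrank F (N ⊓ LinearMap.ker f : Submodule F V) = finrank F N := by
  have h := LinearMap.finrank_range_add_finrank_ker (f.domRestrict N)
  rwa [LinearMap.range_domRestrict, LinearMap.domRestrict, LinearMap.ker_comp,
    ← finrank_map_subtype_eq, Submodule.map_comap_subtype] at h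

/-- The number of hyperplanes of `y` that contain `A`. -/
theorem card_hyperplane {F U : Type*} [Field F] [Finite F] [AddCommGroup U] [Module F U]
    [FiniteDimensional F U] {A y : Submodule F U} (hA : A ≤ y) :
    Nat.card {L : Submodule F U // A ≤ L ∧ L ≤ y ∧ finrank F L + 1 = finrank F y} =
      qInt (Nat.card F) (finrank F y - finrank F A) := by
  set A' : Submodule F y := A.comap y.subtype with hA'
  have hfA : finrank F A' = finrank F A := by
    rw [hA', ← finrank_map_subtype_eq, Submodule.map_comap_subtype, inf_eq_right.2 hA]
  have hq : finrank F (y ⧸ A') = finrank F y - finrank F A := by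
    rw [← hfA, ← Submodule.finrank_quotient_add_finrank A']
    omega
  rw [← hq, ← card_finrank_add_one]
  symm
  -- Hyperplanes of `y` above `A` correspond to hyperplanes of the quotient `y ⧸ A'`.
  refine Nat.card_congr (Equiv.ofBijective (fun H => ⟨(H.1.comap A'.mkQ).map y.subtype, ?_, ?_, ?_⟩)
    ⟨?_, ?_⟩)
  · have : A = A'.map y.subtype := by rw [Submodule.map_comap_subtype, inf_eq_right.2 hA]
    conv_lhs => rw [this]
    exact Submodule.map_mono (Submodule.le_comap_mkQ _ _)
  · exact Submodule.map_subtype_le _ _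
  · have h1 := H.2
    rw [finrank_map_subtype_eq]
    have h2 := Submodule.finrank_quotient_add_finrank A'
    have h3 := finrank_map_add_finrank_inf_ker (A'.mkQ) (H.1.comap A'.mkQ)
    rw [Submodule.map_comap_eq_of_surjective A'.mkQ_surjective, Submodule.ker_mkQ,
      inf_eq_right.2 (Submodule.le_comap_mkQ _ _)] at h3
    omega
  · intro H H' h
    have h1 := Submodule.map_injective_of_injective y.injective_subtype (congrArg Subtype.val h)
    exact Subtype.ext (Submodule.comap_injective_of_surjective A'.mkQ_surjective h1)
  · rintro ⟨L, hAL, hLy, hL⟩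
    set L' : Submodule F y := L.comap y.subtype
    have hfL : finrank F L' = finrank F L := by
      rw [← finrank_map_subtype_eq, Submodule.map_comap_subtype, inf_eq_right.2 hLy]
    have hAL' : A' ≤ L' := Submodule.comap_mono hAL
    refine ⟨⟨L'.map A'.mkQ, ?_⟩, Subtype.ext ?_⟩
    · have h3 := finrank_map_add_finrank_inf_ker A'.mkQ L'
      rw [Submodule.ker_mkQ, inf_eq_right.2 hAL'] at h3
      have h4 : finrank F A ≤ finrank F L := Submodule.finrank_mono hAL
      omega
    · show ((L'.map A'.mkQ).comap A'.mkQ).map y.subtype = L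
      rw [Submodule.comap_map_eq, Submodule.ker_mkQ, sup_eq_left.2 hAL',
        Submodule.map_comap_subtype, inf_eq_right.2 hLy]

/-! ### The graph of a polar space: distance and lines. -/

/-- The graph on the maximal elements of a family of subspaces in which two vertices are adjacent
if they meet in dimension `D - 1`. -/
def polarGraph {F U : Type*} [Field F] [AddCommGroup U] [Module F U] (I : Submodule F U → Prop)
    (D : ℕ) : SimpleGraph {W : Submodule F U // Maximal I W} where
  Adj y z := y ≠ z ∧ Module.finrank F (y.1 ⊓ z.1 : Submodule F U) + 1 = D
  symm := ⟨fun _ _ h => ⟨h.1.symm, by rw [inf_comm]; exact h.2⟩⟩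
  loopless := ⟨fun _ h => h.1 rfl⟩

namespace PolarSpace

variable {F U : Type*} [Field F] [AddCommGroup U] [Module F U] {P : PolarSpace F U}

/-- The maximal isotropic subspaces. -/
abbrev Vertex (P : PolarSpace F U) : Type _ := {W : Submodule F U // Maximal P.Iso W}

/-- The dual polar graph of a polar space. -/
abbrev graph (P : PolarSpace F U) (D : ℕ) : SimpleGraph P.Vertex := polarGraph P.Iso D

/-- The maximal isotropic subspaces have dimension `D`, and those through a fixed isotropic
subspace of dimension `D - 1` are `s + 1` in number. -/
structure HasOrder (P : PolarSpace F U) (D s : ℕ) : Prop where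
  finrank_eq : ∀ y : P.Vertex, finrank F y.1 = D
  card_line : ∀ (y : P.Vertex) (L : Submodule F U), L ≤ y.1 → finrank F L + 1 = D →
    Nat.card {w : P.Vertex // L ≤ w.1 ∧ w ≠ y} = s

variable {D s : ℕ}

theorem HasOrder.finrank_inf_self (h : P.HasOrder D s) (y : P.Vertex) :
    finrank F (y.1 ⊓ y.1 : Submodule F U) = D := by rw [inf_idem, h.finrank_eq]

section
variable [FiniteDimensional F U]

theorem HasOrder.adj_of_le (h : P.HasOrder D s) {y z : P.Vertex} {L : Submodule F U} (hy : L ≤ y.1)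
    (hz : L ≤ z.1)
    (hL : finrank F L + 1 = D) (hne : y ≠ z) : (P.graph D).Adj y z :=
  ⟨hne, by rw [inf_eq_of_ne y.2 z.2 hy hz (by rw [h.finrank_eq, hL]) fun e => hne (Subtype.ext e),
    hL]⟩

theorem HasOrder.inf_eq (h : P.HasOrder D s) {y z : P.Vertex} {L : Submodule F U} (hy : L ≤ y.1)
    (hz : L ≤ z.1)
    (hL : finrank F L + 1 = D) (hne : y ≠ z) : y.1 ⊓ z.1 = L :=
  inf_eq_of_ne y.2 z.2 hy hz (by rw [h.finrank_eq, hL]) fun e => hne (Subtype.ext e)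

theorem HasOrder.finrank_inf_lt (h : P.HasOrder D s) {y z : P.Vertex} (hne : y ≠ z) :
    finrank F (y.1 ⊓ z.1 : Submodule F U) < D := by
  rw [← h.finrank_eq y]
  refine Submodule.finrank_lt_finrank_of_lt (lt_of_le_of_ne inf_le_left fun e => hne ?_)
  exact Subtype.ext (y.2.eq_of_le z.2.1 (inf_eq_left.1 e))

/-- `y ⊓ z` is a hyperplane of `y`, so intersecting `y ⊓ x` with it costs at most one dimension. -/
theorem HasOrder.finrank_le_of_adj (h : P.HasOrder D s) {y z : P.Vertex} (hyz : (P.graph D).Adj y z)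
    (x : Submodule F U) : finrank F (y.1 ⊓ x : Submodule F U) ≤
      finrank F (z.1 ⊓ x : Submodule F U) + 1 := by
  have h1 := Submodule.finrank_sup_add_finrank_inf_eq (y.1 ⊓ x) (y.1 ⊓ z.1)
  have h2 : finrank F ((y.1 ⊓ x) ⊔ (y.1 ⊓ z.1) : Submodule F U) ≤ D := by
    rw [← h.finrank_eq y]
    exact Submodule.finrank_mono (sup_le inf_le_left inf_le_left)
  have h3 : finrank F ((y.1 ⊓ x) ⊓ (y.1 ⊓ z.1) : Submodule F U) ≤
      finrank F (z.1 ⊓ x : Submodule F U) :=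
    Submodule.finrank_mono (le_inf (inf_le_right.trans inf_le_right)
      (inf_le_left.trans inf_le_right))
  have h4 := hyz.2
  omega

/-- A vertex distinct from `z` has a neighbour that is closer to `z`. -/
theorem HasOrder.exists_closer (h : P.HasOrder D s) {y z : P.Vertex} (hne : y ≠ z) : ∃ w : P.Vertex,
    (P.graph D).Adj y w ∧ finrank F (w.1 ⊓ z.1 : Submodule F U) =
      finrank F (y.1 ⊓ z.1 : Submodule F U) + 1 := by
  obtain ⟨m, hm, hmz⟩ : ∃ m ∈ y.1, m ∉ y.1 ⊓ z.1 := by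
    by_contra! hc
    exact hne (Subtype.ext (y.2.eq_of_le z.2.1 fun m hm => (hc m hm).2))
  -- A line through `y` that contains `y ⊓ z` still meets `z` in all of `y ⊓ z`, so its projection
  -- of `z` gains one dimension over `y`.
  obtain ⟨L, hzL, hLy, -, hL⟩ := exists_hyperplane inf_le_left hm hmz
  have hLz : L ⊓ z.1 = y.1 ⊓ z.1 := le_antisymm (inf_le_inf_right _ hLy) (le_inf hzL inf_le_right)
  have h1 := finrank_proj_inf (y.2.1.mono hLy) z.2
  rw [hLz, h.finrank_eq] at h1
  rw [h.finrank_eq] at hL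
  refine ⟨⟨P.proj L z.1, proj_maximal (y.2.1.mono hLy) z.2⟩,
    h.adj_of_le hLy (le_proj _ _) hL ?_, by dsimp only; omega⟩
  intro e
  have e' : y.1 = P.proj L z.1 := congrArg Subtype.val e
  rw [← e'] at h1
  omega

theorem HasOrder.exists_walk (h : P.HasOrder D s) (y z : P.Vertex) : ∃ p : (P.graph D).Walk y z,
    p.length + finrank F (y.1 ⊓ z.1 : Submodule F U) = D := by
  induction hn : D - finrank F (y.1 ⊓ z.1 : Submodule F U) generalizing y with
  | zero =>
    by_cases hyz : y = z
    · subst hyz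
      exact ⟨.nil, by simp [h.finrank_inf_self]⟩
    · have := h.finrank_inf_lt hyz
      omega
  | succ n ih =>
    by_cases hyz : y = z
    · subst hyz
      simp [h.finrank_inf_self] at hn
    · obtain ⟨w, hw, hwz⟩ := h.exists_closer hyz
      obtain ⟨p, hp⟩ := ih w (by omega)
      exact ⟨.cons hw p, by rw [SimpleGraph.Walk.length_cons]; omega⟩

theorem HasOrder.le_length_add (h : P.HasOrder D s) {y z : P.Vertex} (p : (P.graph D).Walk y z) :
    D ≤ p.length + finrank F (y.1 ⊓ z.1 : Submodule F U) := by
  induction p with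
  | nil => simp [h.finrank_inf_self]
  | cons hadj p ih =>
    rw [SimpleGraph.Walk.length_cons]
    rename_i u v w
    have := h.finrank_le_of_adj hadj.symm w.1
    exact ih.trans (by omega)

/-- Moving towards `z` raises the dimension of the intersection by one per step, and no step can
raise it by more. -/
theorem HasOrder.dist_add_finrank (h : P.HasOrder D s) (y z : P.Vertex) :
    (P.graph D).dist y z + finrank F (y.1 ⊓ z.1 : Submodule F U) = D := by
  obtain ⟨p, hp⟩ := h.exists_walk y z
  obtain ⟨p', hp'⟩ := (SimpleGraph.Walk.reachable p).exists_walk_length_eq_dist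
  have h1 := h.le_length_add p'
  have h2 := SimpleGraph.dist_le p
  omega

theorem HasOrder.connected (h : P.HasOrder D s) [Nonempty P.Vertex] : (P.graph D).Connected :=
  ⟨fun y z => (h.exists_walk y z).choose.reachable⟩

/-- The point of the line through `L` that is nearest to `x`, as a vertex. -/
def projVertex {y : P.Vertex} {L : Submodule F U} (hL : L ≤ y.1) (x : P.Vertex) : P.Vertex :=
  ⟨P.proj L x.1, proj_maximal (y.2.1.mono hL) x.2⟩

theorem HasOrder.dist_proj (h : P.HasOrder D s) {y : P.Vertex} {L : Submodule F U} (hL : L ≤ y.1)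
    (hd : finrank F L + 1 = D) (x : P.Vertex) :
    (P.graph D).dist x (projVertex hL x) + finrank F (L ⊓ x.1 : Submodule F U) + 1 = D := by
  have h1 : (P.graph D).dist x (projVertex hL x) +
      finrank F (x.1 ⊓ P.proj L x.1 : Submodule F U) = D := h.dist_add_finrank x (projVertex hL x)
  have h2 := finrank_proj_inf (y.2.1.mono hL) x.2
  rw [h.finrank_eq, inf_comm] at h2
  omega

theorem HasOrder.inf_eq_of_ne_projVertex (h : P.HasOrder D s) {y w : P.Vertex} {L : Submodule F U}
    (hL : L ≤ y.1)
    (hd : finrank F L + 1 = D) {x : P.Vertex} (hw : L ≤ w.1) (hne : w ≠ projVertex hL x) :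
    w.1 ⊓ x.1 = L ⊓ x.1 :=
  inf_eq_of_ne_proj x.2 w.2 hw (by rw [h.finrank_eq, hd]) fun e => hne (Subtype.ext e)

/-- The near polygon property: each line has a unique point nearest to `x`, and its other points are
all one step farther. Most of the local counts below reduce to it. -/
theorem HasOrder.dist_of_ne_projVertex (h : P.HasOrder D s) {y w : P.Vertex} {L : Submodule F U}
    (hL : L ≤ y.1)
    (hd : finrank F L + 1 = D) {x : P.Vertex} (hw : L ≤ w.1) (hne : w ≠ projVertex hL x) :
    (P.graph D).dist x w = (P.graph D).dist x (projVertex hL x) + 1 := by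
  have h1 := h.dist_proj hL hd x
  have h2 := h.dist_add_finrank x w
  rw [inf_comm, h.inf_eq_of_ne_projVertex hL hd hw hne] at h2
  omega

/-- Adjacent vertices at the same distance from `x` meet `x` in the same subspace. -/
theorem HasOrder.inf_eq_of_adj (h : P.HasOrder D s) {x y z : P.Vertex} (hyz : (P.graph D).Adj y z)
    (hd : (P.graph D).dist x y = (P.graph D).dist x z) : y.1 ⊓ x.1 = z.1 ⊓ x.1 := by
  have hL : y.1 ⊓ z.1 ≤ y.1 := inf_le_left
  have hy : y ≠ projVertex hL x := by
    rintro e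
    have := h.dist_of_ne_projVertex hL hyz.2 inf_le_right (x := x) fun e' => hyz.1 (e.trans e'.symm)
    rw [← e] at this
    omega
  have hz : z ≠ projVertex hL x := by
    rintro e
    have := h.dist_of_ne_projVertex hL hyz.2 inf_le_left hy
    rw [← e] at this
    omega
  rw [h.inf_eq_of_ne_projVertex hL hyz.2 inf_le_left hy,
    h.inf_eq_of_ne_projVertex hL hyz.2 inf_le_right hz]

/-- If `y` is adjacent to `z` and closer to `x` than `z`, then `z ∩ x ≤ y ∩ x`. -/
theorem HasOrder.inf_le_of_adj (h : P.HasOrder D s) {x y z : P.Vertex} (hyz : (P.graph D).Adj y z)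
    (hd : (P.graph D).dist x y < (P.graph D).dist x z) : z.1 ⊓ x.1 ≤ y.1 ⊓ x.1 := by
  have hL : y.1 ⊓ z.1 ≤ y.1 := inf_le_left
  have hz : z ≠ projVertex hL x := by
    rintro e
    have := h.dist_of_ne_projVertex hL hyz.2 inf_le_left (x := x) (fun e' => hyz.1 (e'.trans e.symm))
    rw [← e] at this
    omega
  rw [h.inf_eq_of_ne_projVertex hL hyz.2 inf_le_right hz]
  exact inf_le_inf_right _ inf_le_left

/-- A common neighbour of two vertices contains their intersection. -/
theorem HasOrder.inf_le_of_adj_adj (h : P.HasOrder D s) {w y z : P.Vertex}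
    (hy : (P.graph D).Adj y w)
    (hz : (P.graph D).Adj z w) (hne : y ≠ z) : y.1 ⊓ z.1 ≤ w.1 := by
  by_cases he : y.1 ⊓ w.1 = z.1 ⊓ w.1
  · have := h.inf_eq (L := y.1 ⊓ w.1) inf_le_left (he.le.trans inf_le_left) hy.2 hne
    exact this.le.trans inf_le_right
  -- The distinct hyperplanes `y ⊓ w` and `z ⊓ w` span `w`. Since `y ⊓ z` lies in both `y` and `z`,
  -- it is orthogonal to each of them, hence to `w`, and maximality of `w` absorbs it.
  · have h1 : (y.1 ⊓ w.1) ⊔ (z.1 ⊓ w.1) = w.1 := by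
      apply Submodule.eq_of_le_of_finrank_le (sup_le inf_le_right inf_le_right)
      rw [h.finrank_eq, ← hy.2]
      apply Submodule.finrank_lt_finrank_of_lt
      refine lt_of_le_of_ne le_sup_left fun e => he ?_
      refine (Submodule.eq_of_le_of_finrank_le (le_sup_right.trans e.ge) ?_).symm
      have := hy.2
      have := hz.2
      omega
    apply le_of_le_perp (y.2.1.mono inf_le_left) w.2
    rw [← h1, perp_sup]
    exact le_inf (y.2.1.le_perp_of_le inf_le_left inf_le_left)
      (z.2.1.le_perp_of_le inf_le_right inf_le_left)

end

/-! ### Intersection numbers of the graph. -/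

section counting

variable [Finite U]

/-- Neighbours of `z` are fibred over the lines through `z` by `w ↦ z ⊓ w`; `Q` selects the lines
that carry neighbours with the property `p`, and each selected line carries `n` of them. -/
theorem card_adj {z : P.Vertex} {p : P.Vertex → Prop} {n : ℕ} (Q : Submodule F U → Prop)
    (h : P.HasOrder D s) [FiniteDimensional F U]
    (hQ : ∀ L, Q L → L ≤ z.1 ∧ finrank F L + 1 = D)
    (hn : ∀ L, Q L → Nat.card {w : P.Vertex // L ≤ w.1 ∧ w ≠ z ∧ p w} = n)
    (hp : ∀ w, (P.graph D).Adj z w → p w → Q (z.1 ⊓ w.1)) :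
    Nat.card {w : P.Vertex // (P.graph D).Adj z w ∧ p w} = Nat.card {L // Q L} * n := by
  have : Finite (Submodule F U) := Finite.of_injective _ SetLike.coe_injective
  have : Fintype {L // Q L} := Fintype.ofFinite _
  let e : {w : P.Vertex // (P.graph D).Adj z w ∧ p w} ≃
      Σ L : {L // Q L}, {w : P.Vertex // L.1 ≤ w.1 ∧ w ≠ z ∧ p w} :=
    { toFun := fun w => ⟨⟨z.1 ⊓ w.1.1, hp _ w.2.1 w.2.2⟩, w.1, inf_le_right, w.2.1.1.symm, w.2.2⟩
      invFun := fun a => ⟨a.2.1, h.adj_of_le (hQ _ a.1.2).1 a.2.2.1 (hQ _ a.1.2).2 a.2.2.2.1.symm,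
        a.2.2.2.2⟩
      left_inv := fun w => rfl
      right_inv := by
        rintro ⟨⟨L, hL⟩, w, hw⟩
        have : z.1 ⊓ w.1 = L := h.inf_eq (hQ _ hL).1 hw.1 (hQ _ hL).2 hw.2.1.symm
        subst this
        rfl }
  rw [Nat.card_congr e, Nat.card_sigma]
  simp only [hn _ (Subtype.prop _), Finset.sum_const, Finset.card_univ, smul_eq_mul,
    Nat.card_eq_fintype_card]

end counting

end PolarSpace

theorem card_and_add_card_and_not {α : Type*} [Finite α] (p r : α → Prop) :
    Nat.card {a // p a ∧ r a} + Nat.card {a // p a ∧ ¬ r a} = Nat.card {a // p a} := by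
  classical
  have := Fintype.ofFinite α
  simp only [Nat.card_eq_fintype_card, Fintype.card_subtype, ← Finset.filter_filter]
  exact Finset.card_filter_add_card_filter_not _

theorem card_subtype_eq_one {α : Type*} {p : α → Prop} {a : α} (ha : p a) (h : ∀ b, p b → b = a) :
    Nat.card {a // p a} = 1 :=
  Nat.card_eq_one_iff_unique.2 ⟨⟨fun b c => Subtype.ext ((h _ b.2).trans (h _ c.2).symm)⟩, ⟨a, ha⟩⟩

namespace PolarSpace

variable {F U : Type*} [Field F] [Finite F] [AddCommGroup U] [Module F U] [Finite U]
  [FiniteDimensional F U] {P : PolarSpace F U} {D s : ℕ}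

/-- Every vertex at distance `i` from `x` has `[i]` neighbours at distance `i - 1` from `x`. -/
theorem HasOrder.card_closer (h : P.HasOrder D s) (x z : P.Vertex) :
    Nat.card {w // (P.graph D).Adj z w ∧ (P.graph D).dist x w + 1 = (P.graph D).dist x z} =
      qInt (Nat.card F) ((P.graph D).dist x z) := by
  have hxz := h.dist_add_finrank x z
  rw [inf_comm] at hxz
  -- The lines through `z` with a point nearer to `x` are those containing `z ⊓ x`: on any other
  -- line `z` itself is the nearest point.
  rw [card_adj (n := 1) (fun L => z.1 ⊓ x.1 ≤ L ∧ L ≤ z.1 ∧ finrank F L + 1 = finrank F z.1) h,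
    card_hyperplane inf_le_left, mul_one, h.finrank_eq]
  · congr 1
    omega
  · rintro L ⟨-, h1, h2⟩
    exact ⟨h1, h2.trans (h.finrank_eq z)⟩
  · rintro L ⟨h0, h1, h2⟩
    rw [h.finrank_eq] at h2
    have hz : z ≠ projVertex h1 x := by
      intro e
      have h3 := h.dist_proj h1 h2 x
      rw [← e] at h3
      have h4 : finrank F (z.1 ⊓ x.1 : Submodule F U) ≤ finrank F (L ⊓ x.1 : Submodule F U) :=
        Submodule.finrank_mono (le_inf h0 inf_le_right)
      omega
    have h3 := h.dist_of_ne_projVertex h1 h2 h1 hz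
    refine card_subtype_eq_one (a := projVertex h1 x) ⟨le_proj _ _, hz.symm, h3.symm⟩ ?_
    rintro w ⟨hw, -, hd⟩
    by_contra hne
    have := h.dist_of_ne_projVertex h1 h2 hw hne
    omega
  · intro w hw hd
    exact ⟨le_inf inf_le_left ((h.inf_le_of_adj hw.symm (by omega)).trans inf_le_left),
      inf_le_left, hw.2.trans (h.finrank_eq z).symm⟩

/-- Every vertex at distance `i` from `x` has `(s - 1) [i]` neighbours at distance `i` from `x`. -/
theorem HasOrder.card_level (h : P.HasOrder D s) (x z : P.Vertex) :
    Nat.card {w // (P.graph D).Adj z w ∧ (P.graph D).dist x w = (P.graph D).dist x z} =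
      qInt (Nat.card F) ((P.graph D).dist x z) * (s - 1) := by
  have hxz := h.dist_add_finrank x z
  rw [inf_comm] at hxz
  -- The lines are those of the previous count; of the `s` points other than `z` only the nearest
  -- one leaves the level.
  rw [card_adj (n := s - 1)
    (fun L => z.1 ⊓ x.1 ≤ L ∧ L ≤ z.1 ∧ finrank F L + 1 = finrank F z.1) h,
    card_hyperplane inf_le_left, h.finrank_eq]
  · congr 2
    omega
  · rintro L ⟨-, h1, h2⟩
    exact ⟨h1, h2.trans (h.finrank_eq z)⟩
  · rintro L ⟨h0, h1, h2⟩
    rw [h.finrank_eq] at h2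
    have hz : z ≠ projVertex h1 x := by
      intro e
      have h3 := h.dist_proj h1 h2 x
      rw [← e] at h3
      have h4 : finrank F (z.1 ⊓ x.1 : Submodule F U) ≤ finrank F (L ⊓ x.1 : Submodule F U) :=
        Submodule.finrank_mono (le_inf h0 inf_le_right)
      omega
    have h3 := h.dist_of_ne_projVertex h1 h2 h1 hz
    have h4 := card_and_add_card_and_not (fun w : P.Vertex => L ≤ w.1 ∧ w ≠ z)
      (fun w => (P.graph D).dist x w = (P.graph D).dist x z)
    rw [h.card_line z L h1 h2, card_subtype_eq_one (a := projVertex h1 x)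
      (p := fun w => (L ≤ w.1 ∧ w ≠ z) ∧ ¬ (P.graph D).dist x w = (P.graph D).dist x z)
      ⟨⟨le_proj _ _, hz.symm⟩, by omega⟩] at h4
    · simp only [and_assoc] at h4
      omega
    · rintro w ⟨⟨hw, -⟩, hd⟩
      by_contra hne
      have := h.dist_of_ne_projVertex h1 h2 hw hne
      omega
  · intro w hw hd
    exact ⟨le_inf inf_le_left ((h.inf_eq_of_adj hw hd.symm).le.trans inf_le_left),
      inf_le_left, hw.2.trans (h.finrank_eq z).symm⟩

theorem HasOrder.card_adj_of_le (h : P.HasOrder D s) {K : Submodule F U} {z : P.Vertex}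
    (hK : K ≤ z.1) : Nat.card {w : P.Vertex // (P.graph D).Adj z w ∧ K ≤ w.1} =
      qInt (Nat.card F) (D - finrank F K) * s := by
  rw [card_adj (n := s) (fun L => K ≤ L ∧ L ≤ z.1 ∧ finrank F L + 1 = finrank F z.1) h,
    card_hyperplane hK, h.finrank_eq]
  · rintro L ⟨-, h1, h2⟩
    exact ⟨h1, h2.trans (h.finrank_eq z)⟩
  · rintro L ⟨h0, h1, h2⟩
    rw [h.finrank_eq] at h2
    rw [← h.card_line z L h1 h2]
    refine Nat.card_congr (Equiv.subtypeEquivRight fun w => ?_)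
    exact ⟨fun hw => ⟨hw.1, hw.2.1⟩, fun hw => ⟨hw.1, hw.2, h0.trans hw.1⟩⟩
  · intro w hw hd
    exact ⟨le_inf hK hd, inf_le_left, hw.2.trans (h.finrank_eq z).symm⟩

/-- Every vertex at distance `i` from `x` has `s ([D] - [i])` neighbours at distance `i + 1`
from `x`. -/
theorem HasOrder.card_farther (h : P.HasOrder D s) (hs : 1 ≤ s) (x z : P.Vertex) :
    Nat.card {w // (P.graph D).Adj z w ∧ (P.graph D).dist x w = (P.graph D).dist x z + 1} +
      qInt (Nat.card F) ((P.graph D).dist x z) * s = qInt (Nat.card F) D * s := by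
  -- With `K = ⊥` this is the valency; the farther neighbours are what remains after removing the
  -- two previous counts.
  have h1 := h.card_adj_of_le (bot_le : ⊥ ≤ z.1)
  rw [finrank_bot, Nat.sub_zero] at h1
  simp only [bot_le, and_true] at h1
  have h2 := card_and_add_card_and_not (fun w => (P.graph D).Adj z w)
    (fun w => (P.graph D).dist x w = (P.graph D).dist x z)
  have h3 := card_and_add_card_and_not
    (fun w => (P.graph D).Adj z w ∧ ¬ (P.graph D).dist x w = (P.graph D).dist x z)
    (fun w => (P.graph D).dist x w + 1 = (P.graph D).dist x z)
  have h4 : Nat.card {w // ((P.graph D).Adj z w ∧ ¬ (P.graph D).dist x w = (P.graph D).dist x z) ∧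
      (P.graph D).dist x w + 1 = (P.graph D).dist x z} =
      Nat.card {w // (P.graph D).Adj z w ∧ (P.graph D).dist x w + 1 = (P.graph D).dist x z} :=
    Nat.card_congr (Equiv.subtypeEquivRight fun w =>
      ⟨fun hw => ⟨hw.1.1, hw.2⟩, fun hw => ⟨⟨hw.1, by omega⟩, hw.2⟩⟩)
  have h5 : Nat.card {w // ((P.graph D).Adj z w ∧ ¬ (P.graph D).dist x w = (P.graph D).dist x z) ∧
      ¬ (P.graph D).dist x w + 1 = (P.graph D).dist x z} =
      Nat.card {w // (P.graph D).Adj z w ∧ (P.graph D).dist x w = (P.graph D).dist x z + 1} := by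
    refine Nat.card_congr (Equiv.subtypeEquivRight fun w =>
      ⟨fun hw => ⟨hw.1.1, ?_⟩, fun hw => ⟨⟨hw.1, by omega⟩, by omega⟩⟩)
    have a1 := h.finrank_le_of_adj hw.1.1 x.1
    have a2 := h.finrank_le_of_adj hw.1.1.symm x.1
    have a3 := h.dist_add_finrank x z
    have a4 := h.dist_add_finrank x w
    rw [inf_comm] at a3 a4
    have := hw.1.2
    have := hw.2
    omega
  rw [h4, h5, h.card_closer] at h3
  rw [h1, h.card_level, ← h3] at h2
  obtain ⟨t, rfl⟩ := Nat.exists_eq_add_of_le hs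
  rw [Nat.add_sub_cancel_left] at h2
  rw [← h2]
  ring

/-- The action of the adjacency matrix on the characteristic vector of the set of vertices that
contain `K`. -/
theorem HasOrder.card_adj_add (h : P.HasOrder D s) {K : Submodule F U} (hK : P.Iso K)
    (z : P.Vertex) [Decidable (K ≤ z.1)] :
    Nat.card {w : P.Vertex // (P.graph D).Adj z w ∧ K ≤ w.1} +
        qInt (Nat.card F) (finrank F K) * (if K ≤ z.1 then 1 else 0) =
      qInt (Nat.card F) (D - finrank F K) * s * (if K ≤ z.1 then 1 else 0) +
        Nat.card {M : Submodule F U // M ≤ K ∧ finrank F M + 1 = finrank F K ∧ M ≤ z.1} := by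
  -- The codimension of `K ⊓ z` in `K` decides. If it is zero, both sides are explicit. If it is
  -- one, the projection of `z` onto `K` is the only neighbour containing `K`, and `K ⊓ z` the only
  -- hyperplane. If it is larger, nothing is counted.
  by_cases hKz : K ≤ z.1
  · rw [if_pos hKz, mul_one, mul_one, h.card_adj_of_le hKz]
    congr 1
    have h1 := card_hyperplane (bot_le : ⊥ ≤ K)
    rw [finrank_bot, Nat.sub_zero] at h1
    rw [← h1]
    refine Nat.card_congr (Equiv.subtypeEquivRight fun w => ?_)
    exact ⟨fun hw => ⟨hw.2.1, hw.2.2, hw.2.1.trans hKz⟩, fun hw => ⟨bot_le, hw.1, hw.2.1⟩⟩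
  · rw [if_neg hKz, mul_zero, mul_zero, add_zero, zero_add]
    have hlt : finrank F (K ⊓ z.1 : Submodule F U) < finrank F K :=
      Submodule.finrank_lt_finrank_of_lt (lt_of_le_of_ne inf_le_left fun e => hKz (inf_eq_left.1 e))
    have h2 := finrank_proj_inf hK z.2
    rw [h.finrank_eq] at h2
    by_cases hd : finrank F (K ⊓ z.1 : Submodule F U) + 1 = finrank F K
    · rw [card_subtype_eq_one (a := ⟨P.proj K z.1, proj_maximal hK z.2⟩),
        card_subtype_eq_one (a := K ⊓ z.1) ⟨inf_le_left, hd, inf_le_right⟩]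
      · rintro M ⟨h3, h4, h5⟩
        exact Submodule.eq_of_le_of_finrank_le (le_inf h3 h5) (by omega)
      · refine ⟨⟨?_, ?_⟩, le_proj _ _⟩
        · intro e
          exact hKz ((le_proj K z.1).trans (congrArg Subtype.val e).ge)
        · rw [inf_comm]
          show finrank F (P.proj K z.1 ⊓ z.1 : Submodule F U) + 1 = D
          omega
      · rintro w ⟨h3, h4⟩
        refine Subtype.ext (w.2.eq_of_le (proj_iso hK z.2) ?_)
        have h5 : K ⊔ (z.1 ⊓ w.1) = w.1 := by
          apply Submodule.eq_of_le_of_finrank_le (sup_le h4 inf_le_right)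
          rw [h.finrank_eq, ← h3.2]
          apply Submodule.finrank_lt_finrank_of_lt
          exact lt_of_le_of_ne le_sup_right fun e => hKz
            ((le_sup_left.trans e.ge).trans inf_le_left)
        rw [← h5]
        exact sup_le_sup_left (le_inf (w.2.1.le_perp_of_le inf_le_right h4) inf_le_left) _
    · have e1 : IsEmpty {M : Submodule F U // M ≤ K ∧ finrank F M + 1 = finrank F K ∧ M ≤ z.1} := by
        refine ⟨fun ⟨M, h3, h4, h5⟩ => ?_⟩
        have := Submodule.finrank_mono (le_inf h3 h5)
        omega
      have e2 : IsEmpty {w : P.Vertex // (P.graph D).Adj z w ∧ K ≤ w.1} := by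
        refine ⟨fun ⟨w, h3, h4⟩ => ?_⟩
        have h5 := h.finrank_le_of_adj h3.symm K
        rw [inf_eq_right.2 h4, inf_comm] at h5
        omega
      rw [Nat.card_of_isEmpty, Nat.card_of_isEmpty]

end PolarSpace

/-! ### Common neighbours, and the count behind the relation FR = qRF + (s - 1)R. -/

namespace PolarSpace

variable {F U : Type*} [Field F] [AddCommGroup U] [Module F U]
  [FiniteDimensional F U] {P : PolarSpace F U} {D s : ℕ}

theorem HasOrder.dist_le_succ (h : P.HasOrder D s) (x : P.Vertex) {y z : P.Vertex}
    (hyz : (P.graph D).Adj y z) : (P.graph D).dist x y ≤ (P.graph D).dist x z + 1 := by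
  have a1 := h.finrank_le_of_adj hyz.symm x.1
  have a3 := h.dist_add_finrank x y
  have a4 := h.dist_add_finrank x z
  rw [inf_comm] at a3 a4
  omega

theorem HasOrder.eq_projVertex (h : P.HasOrder D s) {x y z : P.Vertex} {L : Submodule F U}
    (hy : L ≤ y.1) (hz : L ≤ z.1) (hd : finrank F L + 1 = D)
    (hlt : (P.graph D).dist x y < (P.graph D).dist x z) : y = projVertex hy x := by
  by_contra hne
  have h1 := h.dist_of_ne_projVertex hy hd hy hne
  by_cases hz' : z = projVertex hy x
  · rw [← hz'] at h1
    omega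
  · have h2 := h.dist_of_ne_projVertex hy hd hz hz'
    omega

theorem HasOrder.dist_eq_of_lt (h : P.HasOrder D s) {x y z w : P.Vertex} {L : Submodule F U}
    (hy : L ≤ y.1) (hz : L ≤ z.1) (hw : L ≤ w.1) (hd : finrank F L + 1 = D)
    (hlt : (P.graph D).dist x y < (P.graph D).dist x z) (hwy : w ≠ y) :
    (P.graph D).dist x w = (P.graph D).dist x z := by
  have e := h.eq_projVertex hy hz hd hlt
  have h1 := h.dist_of_ne_projVertex hy hd hw (e ▸ hwy)
  have h2 := h.dist_of_ne_projVertex hy hd (x := x) hz (fun e' => by rw [← e, ] at e'; subst e'; omega)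
  omega

/-- On a line, at most one point is adjacent to a vertex that is not adjacent to another point of
the line. -/
theorem HasOrder.eq_of_adj_of_line (h : P.HasOrder D s) {y z w w' : P.Vertex} {L : Submodule F U}
    (hy : L ≤ y.1) (hw : L ≤ w.1) (hw' : L ≤ w'.1) (hd : finrank F L + 1 = D)
    (hzw : (P.graph D).Adj z w) (hzw' : (P.graph D).Adj z w') (hzy : ¬ (P.graph D).Adj z y)
    (hne : z ≠ y) : w = w' := by
  have h1 : (P.graph D).dist z w = 1 := SimpleGraph.dist_eq_one_iff_adj.2 hzw
  have h2 : (P.graph D).dist z w' = 1 := SimpleGraph.dist_eq_one_iff_adj.2 hzw'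
  have h3 : (P.graph D).dist z y ≠ 1 := fun e => hzy (SimpleGraph.dist_eq_one_iff_adj.1 e)
  have h4 : (P.graph D).dist z y ≠ 0 := by
    have := h.dist_add_finrank z y
    have := h.finrank_inf_lt hne
    omega
  rw [h.eq_projVertex (x := z) hw hy hd (by omega), h.eq_projVertex (x := z) hw' hy hd (by omega)]
  rfl

/-- Of the common neighbours of two nonadjacent vertices at different distance from `x`, exactly
one is as close to `x` as the nearer of the two. -/
theorem HasOrder.card_common_closer (h : P.HasOrder D s) {x y z w₀ : P.Vertex}
    (hd : (P.graph D).dist x z = (P.graph D).dist x y + 1) (hna : ¬ (P.graph D).Adj z y)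
    (hz₀ : (P.graph D).Adj z w₀) (hy₀ : (P.graph D).Adj y w₀) :
    Nat.card {w // (P.graph D).Adj z w ∧ (P.graph D).Adj y w ∧
      (P.graph D).dist x w = (P.graph D).dist x y} = 1 := by
  have hne : y ≠ z := by rintro rfl; omega
  have hey := h.dist_add_finrank x y
  have hez := h.dist_add_finrank x z
  rw [inf_comm] at hey hez
  have hYN : ¬ y.1 ⊓ x.1 ≤ y.1 ⊓ z.1 := by
    intro hc
    have := Submodule.finrank_mono (le_inf (hc.trans inf_le_right) inf_le_right :
      y.1 ⊓ x.1 ≤ z.1 ⊓ x.1)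
    omega
  have hunique : ∀ w w', (P.graph D).Adj z w → (P.graph D).Adj y w →
      (P.graph D).dist x w = (P.graph D).dist x y → (P.graph D).Adj z w' → (P.graph D).Adj y w' →
      (P.graph D).dist x w' = (P.graph D).dist x y → w = w' := by
    -- Such a `w` contains `y ⊓ z`, as a common neighbour, and `y ⊓ x`, as a neighbour of `y` on the
    -- same level. By dimension it meets `y` in the sum of these two, so all candidates lie on one
    -- line through `y`, and only one point of that line is adjacent to `z`.
    intro w w' h1 h2 h3 h1' h2' h3'
    have hN := h.inf_le_of_adj_adj h2 h1 hne
    have hN' := h.inf_le_of_adj_adj h2' h1' hne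
    have hY := h.inf_eq_of_adj h2 h3.symm
    have hY' := h.inf_eq_of_adj h2' h3'.symm
    have hle : (y.1 ⊓ z.1) ⊔ (y.1 ⊓ x.1) ≤ y.1 ⊓ w.1 :=
      le_inf (sup_le inf_le_left inf_le_left) (sup_le hN (hY.le.trans inf_le_left))
    have hle' : (y.1 ⊓ z.1) ⊔ (y.1 ⊓ x.1) ≤ y.1 ⊓ w'.1 :=
      le_inf (sup_le inf_le_left inf_le_left) (sup_le hN' (hY'.le.trans inf_le_left))
    have hlt : finrank F (y.1 ⊓ z.1 : Submodule F U) <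
        finrank F ((y.1 ⊓ z.1) ⊔ (y.1 ⊓ x.1) : Submodule F U) :=
      Submodule.finrank_lt_finrank_of_lt (lt_of_le_of_ne le_sup_left fun e => hYN
        (le_sup_right.trans e.ge))
    have hbd := h.finrank_le_of_adj hz₀.symm y.1
    have h5 := hy₀.2
    have h6 := h2.2
    have h7 := h2'.2
    rw [inf_comm, inf_comm z.1] at hbd
    have heq := Submodule.eq_of_le_of_finrank_le hle (by omega)
    have heq' := Submodule.eq_of_le_of_finrank_le hle' (by omega)
    refine h.eq_of_adj_of_line (L := y.1 ⊓ w.1) inf_le_left inf_le_right ?_ h2.2 h1 h1' hna hne.symm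
    rw [← heq, heq']
    exact inf_le_right
  obtain ⟨w, hw⟩ : ∃ w, (P.graph D).Adj z w ∧ (P.graph D).Adj y w ∧
      (P.graph D).dist x w = (P.graph D).dist x y := by
    by_cases h₀ : (P.graph D).dist x w₀ = (P.graph D).dist x y
    · exact ⟨w₀, hz₀, hy₀, h₀⟩
    have h₁ : (P.graph D).dist x w₀ = (P.graph D).dist x y + 1 := by
      have := h.dist_le_succ x hz₀
      have := h.dist_le_succ x hy₀.symm
      omega
    -- If the given common neighbour lies on the level of `z`, then `y ⊓ z` and `y ⊓ x` meet exactly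
    -- in `z ⊓ x`, so their sum is a line. Its point nearest to `z` is the required vertex.
    have hZ : z.1 ⊓ x.1 ≤ y.1 ⊓ x.1 :=
      (h.inf_eq_of_adj hz₀ (by omega)).le.trans (h.inf_le_of_adj hy₀ (by omega))
    have hNY : (y.1 ⊓ z.1) ⊓ (y.1 ⊓ x.1) = z.1 ⊓ x.1 :=
      le_antisymm (le_inf (inf_le_left.trans inf_le_right) (inf_le_right.trans inf_le_right))
        (le_inf (le_inf (hZ.trans inf_le_left) inf_le_left) hZ)
    have h2 := Submodule.finrank_sup_add_finrank_inf_eq (y.1 ⊓ z.1) (y.1 ⊓ x.1)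
    rw [hNY] at h2
    have hbd := h.finrank_le_of_adj hz₀.symm y.1
    have h5 := hy₀.2
    rw [inf_comm, inf_comm z.1] at hbd
    have h6 := h.finrank_inf_lt hne
    have h7 : finrank F (y.1 ⊓ z.1 : Submodule F U) + 1 ≠ D :=
      fun e => hna (SimpleGraph.Adj.symm ⟨hne, e⟩)
    have hLy : (y.1 ⊓ z.1) ⊔ (y.1 ⊓ x.1) ≤ y.1 := sup_le inf_le_left inf_le_left
    have hL : finrank F ((y.1 ⊓ z.1) ⊔ (y.1 ⊓ x.1) : Submodule F U) + 1 = D := by omega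
    have hLz : ((y.1 ⊓ z.1) ⊔ (y.1 ⊓ x.1)) ⊓ z.1 = y.1 ⊓ z.1 :=
      le_antisymm (inf_le_inf_right _ hLy) (le_inf le_sup_left inf_le_right)
    have h8 := h.dist_proj hLy hL z
    rw [hLz] at h8
    have h9 : (P.graph D).dist z (projVertex hLy z) = 1 := by omega
    have hadj := SimpleGraph.dist_eq_one_iff_adj.1 h9
    have hyw : (P.graph D).Adj y (projVertex hLy z) := by
      refine h.adj_of_le hLy (le_proj _ _) hL fun e => hna ?_
      rw [← e] at hadj
      exact hadj
    refine ⟨_, hadj, hyw, ?_⟩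
    have h10 := h.dist_add_finrank x (projVertex hLy z)
    have h11 : finrank F (y.1 ⊓ x.1 : Submodule F U) ≤
        finrank F (x.1 ⊓ (projVertex hLy z).1 : Submodule F U) :=
      Submodule.finrank_mono (le_inf inf_le_right (le_sup_right.trans (le_proj _ _)))
    have h12 := h.dist_le_succ x hadj
    omega
  exact card_subtype_eq_one hw fun w' hw' => hunique _ _ hw'.1 hw'.2.1 hw'.2.2 hw.1 hw.2.1 hw.2.2

variable [Finite F] [Finite U]

/-- The two vertices are at distance two, so this is the intersection number [2]. -/
theorem HasOrder.card_common (h : P.HasOrder D s) {y z w₀ : P.Vertex}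
    (hne : y ≠ z) (hna : ¬ (P.graph D).Adj z y)
    (hz₀ : (P.graph D).Adj z w₀) (hy₀ : (P.graph D).Adj y w₀) :
    Nat.card {w // (P.graph D).Adj z w ∧ (P.graph D).Adj y w} = Nat.card F + 1 := by
  have hd : (P.graph D).dist z y = 2 := by
    have hbd := h.finrank_le_of_adj hz₀.symm y.1
    have h5 := hy₀.2
    have h6 := h.finrank_inf_lt hne
    have h7 : finrank F (y.1 ⊓ z.1 : Submodule F U) + 1 ≠ D :=
      fun e => hna (SimpleGraph.Adj.symm ⟨hne, e⟩)
    have h8 := h.dist_add_finrank z y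
    rw [inf_comm, inf_comm z.1] at hbd
    rw [inf_comm] at h8
    omega
  have h1 := h.card_closer z y
  rw [hd, qInt_two] at h1
  rw [← h1]
  refine Nat.card_congr (Equiv.subtypeEquivRight fun w => ?_)
  rw [← SimpleGraph.dist_eq_one_iff_adj (v := w) (u := z), and_comm]
  exact and_congr_right fun _ => by omega

/-- The commutation relation between the raising matrix and the flat matrix. -/
theorem HasOrder.card_common_level (h : P.HasOrder D s) {x y z : P.Vertex}
    (hd : (P.graph D).dist x z = (P.graph D).dist x y + 1) [Decidable ((P.graph D).Adj z y)] :
    Nat.card {w // (P.graph D).Adj z w ∧ (P.graph D).Adj y w ∧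
        (P.graph D).dist x w = (P.graph D).dist x z} =
      Nat.card F * Nat.card {w // (P.graph D).Adj z w ∧ (P.graph D).Adj y w ∧
        (P.graph D).dist x w = (P.graph D).dist x y} +
      (s - 1) * (if (P.graph D).Adj z y then 1 else 0) := by
  have hne : y ≠ z := by rintro rfl; omega
  -- If adjacent, all common neighbours lie on the line of `y` and `z`, where `y` is the unique
  -- nearest point, so `s - 1` of them are on the level of `z` and none on that of `y`. If not
  -- adjacent but with a common neighbour, the q + 1 common neighbours split as 1 on the level of
  -- `y` and q on that of `z`.
  by_cases hadj : (P.graph D).Adj z y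
  · rw [if_pos hadj, mul_one]
    have hL := hadj.2
    have hline : ∀ w, (P.graph D).Adj z w → (P.graph D).Adj y w →
        (P.graph D).dist x w = (P.graph D).dist x z := by
      intro w h1 h2
      exact h.dist_eq_of_lt (y := y) (L := z.1 ⊓ y.1) inf_le_right inf_le_left
        (h.inf_le_of_adj_adj h1 h2 hne.symm) hL (by omega) h2.1.symm
    have e2 : IsEmpty {w // (P.graph D).Adj z w ∧ (P.graph D).Adj y w ∧
        (P.graph D).dist x w = (P.graph D).dist x y} :=
      ⟨fun ⟨w, h1, h2, h3⟩ => by have := hline w h1 h2; omega⟩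
    rw [Nat.card_of_isEmpty (α := {w // (P.graph D).Adj z w ∧ (P.graph D).Adj y w ∧
        (P.graph D).dist x w = (P.graph D).dist x y}), mul_zero, zero_add]
    have h4 := card_and_add_card_and_not (fun w : P.Vertex => z.1 ⊓ y.1 ≤ w.1 ∧ w ≠ y)
      (fun w => w ≠ z)
    rw [h.card_line y _ inf_le_right hL, card_subtype_eq_one (a := z)
      (p := fun w => (z.1 ⊓ y.1 ≤ w.1 ∧ w ≠ y) ∧ ¬ w ≠ z)
      ⟨⟨inf_le_left, hne.symm⟩, fun e => e rfl⟩ fun w hw => not_not.1 hw.2] at h4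
    have h5 : Nat.card {w // (P.graph D).Adj z w ∧ (P.graph D).Adj y w ∧
        (P.graph D).dist x w = (P.graph D).dist x z} =
        Nat.card {w : P.Vertex // (z.1 ⊓ y.1 ≤ w.1 ∧ w ≠ y) ∧ w ≠ z} := by
      refine Nat.card_congr (Equiv.subtypeEquivRight fun w => ⟨fun hw => ?_, fun hw => ?_⟩)
      · exact ⟨⟨h.inf_le_of_adj_adj hw.1 hw.2.1 hne.symm, hw.2.1.1.symm⟩, hw.1.1.symm⟩
      · have h1 := h.adj_of_le inf_le_left hw.1.1 hL hw.2.symm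
        have h2 := h.adj_of_le inf_le_right hw.1.1 hL hw.1.2.symm
        exact ⟨h1, h2, hline w h1 h2⟩
    omega
  · rw [if_neg hadj, mul_zero, add_zero]
    by_cases hex : ∃ w₀, (P.graph D).Adj z w₀ ∧ (P.graph D).Adj y w₀
    · obtain ⟨w₀, hz₀, hy₀⟩ := hex
      have h1 := h.card_common hne hadj hz₀ hy₀
      have h2 := h.card_common_closer hd hadj hz₀ hy₀
      have h3 := card_and_add_card_and_not
        (fun w => (P.graph D).Adj z w ∧ (P.graph D).Adj y w)
        (fun w => (P.graph D).dist x w = (P.graph D).dist x y)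
      have h4 : Nat.card {w // ((P.graph D).Adj z w ∧ (P.graph D).Adj y w) ∧
          ¬ (P.graph D).dist x w = (P.graph D).dist x y} =
          Nat.card {w // (P.graph D).Adj z w ∧ (P.graph D).Adj y w ∧
            (P.graph D).dist x w = (P.graph D).dist x z} := by
        refine Nat.card_congr (Equiv.subtypeEquivRight fun w => ?_)
        rw [and_assoc]
        refine and_congr_right fun a1 => and_congr_right fun a2 => ?_
        have := h.dist_le_succ x a1
        have := h.dist_le_succ x a2.symm
        omega
      simp only [and_assoc] at h3 h4
      rw [h2, mul_one]
      omega
    · have e1 : IsEmpty {w // (P.graph D).Adj z w ∧ (P.graph D).Adj y w ∧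
          (P.graph D).dist x w = (P.graph D).dist x z} :=
        ⟨fun ⟨w, h1, h2, _⟩ => hex ⟨w, h1, h2⟩⟩
      have e2 : IsEmpty {w // (P.graph D).Adj z w ∧ (P.graph D).Adj y w ∧
          (P.graph D).dist x w = (P.graph D).dist x y} :=
        ⟨fun ⟨w, h1, h2, _⟩ => hex ⟨w, h1, h2⟩⟩
      simp only [Nat.card_of_isEmpty, mul_zero]

end PolarSpace

/-! ### Connected components of the subconstituents. -/

namespace Nucleus

variable {Y : Type*} {Γ : SimpleGraph Y} {x y z : Y}

theorem sim_of_adj (hyz : Γ.Adj y z) (hd : Γ.dist x y = Γ.dist x z) : sim Γ x y z :=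
  ⟨Γ.dist x z, hd, rfl, SimpleGraph.Adj.reachable
    (show (Γ.induce (subconstituent Γ x (Γ.dist x z))).Adj ⟨y, hd⟩ ⟨z, rfl⟩ from hyz)⟩

theorem dist_eq_of_sim (h : sim Γ x y z) : Γ.dist x y = Γ.dist x z := by
  obtain ⟨i, hy, hz, -⟩ := h
  exact hy.trans hz.symm

theorem sim_induction {p : Y → Prop} (h : sim Γ x y z) (hy : p y)
    (hstep : ∀ a b, p a → Γ.Adj a b → Γ.dist x a = Γ.dist x b → p b) : p z := by
  obtain ⟨i, hy', hz, ⟨w⟩⟩ := h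
  have key : ∀ (a b : subconstituent Γ x i),
      (Γ.induce (subconstituent Γ x i)).Walk a b → p a.1 → p b.1 := by
    intro a b w
    induction w with
    | nil => exact id
    | cons hadj w ih =>
      rename_i a b c
      exact fun ha => ih (hstep a.1 b.1 ha hadj (a.2.trans b.2.symm))
  exact key _ _ w hy

end Nucleus

namespace PolarSpace

open Nucleus

variable {F U : Type*} [Field F] [AddCommGroup U] [Module F U]
  [FiniteDimensional F U] {P : PolarSpace F U} {D s : ℕ}

theorem HasOrder.inf_eq_of_sim (h : P.HasOrder D s) {x y z : P.Vertex}
    (hyz : sim (P.graph D) x y z) : y.1 ⊓ x.1 = z.1 ⊓ x.1 :=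
  sim_induction (p := fun z => y.1 ⊓ x.1 = z.1 ⊓ x.1) hyz rfl
    fun _ _ ha hab hd => ha.trans (h.inf_eq_of_adj hab hd)

theorem HasOrder.dist_eq_of_inf_eq (h : P.HasOrder D s) {x y z : P.Vertex}
    (he : y.1 ⊓ x.1 = z.1 ⊓ x.1) : (P.graph D).dist x y = (P.graph D).dist x z := by
  have h1 := h.dist_add_finrank x y
  have h2 := h.dist_add_finrank x z
  rw [inf_comm] at h1 h2
  rw [he] at h1
  omega

/-- The projection of `y` onto `span F {m}` contains `m`, and also `y ⊓ x`, because `x` is isotropic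
and contains `m`. -/
theorem HasOrder.exists_inf_eq_sup (h : P.HasOrder D s) {x y : P.Vertex} {m : U} (hm : m ∈ x.1)
    (hmy : m ∉ y.1) : ∃ p : P.Vertex, (P.graph D).Adj y p ∧
      p.1 ⊓ x.1 = (y.1 ⊓ x.1) ⊔ span F {m} := by
  have hmx : span F {m} ≤ x.1 := (span_singleton_le_iff_mem _ _).2 hm
  have hiso : P.Iso (span F {m}) := x.2.1.mono hmx
  have hm0 : m ≠ 0 := fun e => hmy (e ▸ y.1.zero_mem)
  have h1 := finrank_proj_inf hiso y.2
  have hbot : span F {m} ⊓ y.1 = ⊥ := by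
    rw [eq_bot_iff]
    rintro v ⟨hv, hvy⟩
    obtain ⟨a, rfl⟩ := mem_span_singleton.1 hv
    by_cases ha : a = 0
    · simp [ha]
    · exact absurd ((Submodule.smul_mem_iff _ ha).1 hvy) hmy
  rw [hbot, finrank_bot, finrank_span_singleton hm0, h.finrank_eq, add_zero] at h1
  let p : P.Vertex := ⟨P.proj (span F {m}) y.1, proj_maximal hiso y.2⟩
  have hmp : span F {m} ≤ p.1 := le_proj _ _
  have hadj : (P.graph D).Adj y p := by
    refine ⟨fun e => hmy ?_, by rw [inf_comm]; exact h1⟩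
    rw [e]
    exact hmp (mem_span_singleton_self m)
  refine ⟨p, hadj, (Submodule.eq_of_le_of_finrank_le (sup_le (le_inf ?_ inf_le_right)
    (le_inf hmp hmx)) ?_).symm⟩
  · exact (le_inf (x.2.1.le_perp_of_le inf_le_right hmx) inf_le_left).trans le_sup_right
  · refine (h.finrank_le_of_adj hadj.symm x.1).trans ?_
    apply Submodule.finrank_lt_finrank_of_lt
    refine lt_of_le_of_ne le_sup_left fun e => hmy ?_
    exact (e.ge (mem_sup_right (mem_span_singleton_self m))).1

/-- Starting from `p` with `p ⊓ x = K ⊔ span F {m}`, choose a line through `p` that keeps `K` and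
omits `m`. Then `p` is its point nearest to `x`, and any other point, of which there is one because
`s ≥ 1`, meets `x` in `K` alone. -/
theorem HasOrder.exists_inf_eq_of_le (h : P.HasOrder D s) (hs : 1 ≤ s) {x : P.Vertex}
    {K : Submodule F U} (hK : K ≤ x.1) : ∃ y : P.Vertex, y.1 ⊓ x.1 = K := by
  induction hn : finrank F x.1 - finrank F K generalizing K with
  | zero =>
    refine ⟨x, ?_⟩
    rw [inf_idem]
    exact (Submodule.eq_of_le_of_finrank_le hK (by omega)).symm
  | succ n ih =>
    obtain ⟨m, hm, hmK⟩ : ∃ m ∈ x.1, m ∉ K := by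
      by_contra! hc
      have : x.1 = K := le_antisymm hc hK
      rw [this] at hn
      omega
    have hmx : span F {m} ≤ x.1 := (span_singleton_le_iff_mem _ _).2 hm
    have hm0 : m ≠ 0 := fun e => hmK (e ▸ K.zero_mem)
    have hbot : K ⊓ span F {m} = ⊥ := by
      rw [eq_bot_iff]
      rintro v ⟨hvK, hv⟩
      obtain ⟨a, rfl⟩ := mem_span_singleton.1 hv
      by_cases ha : a = 0
      · simp [ha]
      · exact absurd ((Submodule.smul_mem_iff _ ha).1 hvK) hmK
    have h1 := Submodule.finrank_sup_add_finrank_inf_eq K (span F {m})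
    rw [hbot, finrank_bot, finrank_span_singleton hm0] at h1
    obtain ⟨p, hp⟩ := ih (K := K ⊔ span F {m}) (sup_le hK hmx) (by omega)
    have hmp : m ∈ p.1 := (hp.ge (mem_sup_right (mem_span_singleton_self m))).1
    have hKp : K ≤ p.1 := (le_sup_left.trans hp.ge).trans inf_le_left
    obtain ⟨L, hKL, hLp, hmL, hL⟩ := exists_hyperplane hKp hmp hmK
    rw [h.finrank_eq] at hL
    have hpos : Nat.card {w : P.Vertex // L ≤ w.1 ∧ w ≠ p} ≠ 0 := by
      rw [h.card_line p L hLp hL]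
      omega
    obtain ⟨⟨w, hw, hwp⟩⟩ := (Nat.card_ne_zero.1 hpos).1
    have hproj : p = projVertex hLp x := by
      by_contra hne
      have := h.inf_eq_of_ne_projVertex hLp hL hLp hne
      exact hmL (this.le ⟨hmp, hm⟩).1
    refine ⟨w, ?_⟩
    rw [h.inf_eq_of_ne_projVertex hLp hL hw (hproj ▸ hwp)]
    symm
    apply Submodule.eq_of_le_of_finrank_le (le_inf hKL hK)
    have h2 : finrank F (L ⊓ x.1 : Submodule F U) <
        finrank F (K ⊔ span F {m} : Submodule F U) := by
      rw [← hp]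
      apply Submodule.finrank_lt_finrank_of_lt
      refine lt_of_le_of_ne (inf_le_inf_right _ hLp) fun e => hmL (e.ge ⟨hmp, hm⟩).1
    omega

variable [Finite F] [Finite U]

/-- A step in a subconstituent lifts to the next subconstituent. -/
theorem HasOrder.exists_lift_adj (h : P.HasOrder D s) {x p p' y : P.Vertex}
    (hpp : (P.graph D).Adj p p') (hd : (P.graph D).dist x p = (P.graph D).dist x p')
    (hyp : (P.graph D).Adj y p) (hyd : (P.graph D).dist x y = (P.graph D).dist x p + 1) :
    ∃ w, (P.graph D).Adj w p' ∧ sim (P.graph D) x y w := by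
  have hna : ¬ (P.graph D).Adj y p' := by
    intro hadj
    have hle := h.inf_le_of_adj_adj hyp.symm hadj.symm hpp.1
    have := h.dist_eq_of_lt (x := x) (y := p) (z := y) (w := p') inf_le_left hle inf_le_right hpp.2
      (by omega) hpp.1.symm
    omega
  classical
  -- The nonadjacent vertices `y` and `p'` have the common neighbour `p`, so they have exactly q
  -- common neighbours on the level of `y`; any of these is a lift.
  have h1 := h.card_common_level (x := x) (y := p') (z := y) (by omega)
  have h2 := h.card_common_closer (x := x) (y := p') (z := y) (by omega) hna hyp hpp.symm
  rw [h2, if_neg hna] at h1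
  have h3 : Nat.card {w // (P.graph D).Adj y w ∧ (P.graph D).Adj p' w ∧
      (P.graph D).dist x w = (P.graph D).dist x y} ≠ 0 := by
    have : 0 < Nat.card F := Nat.card_pos
    omega
  obtain ⟨⟨w, hw⟩⟩ := (Nat.card_ne_zero.1 h3).1
  exact ⟨w, hw.2.1.symm, sim_of_adj hw.1 hw.2.2.symm⟩

/-- Neighbours of a vertex that meet `x` in the same smaller subspace are in the same connected
component of their subconstituent. -/
theorem HasOrder.sim_of_common (h : P.HasOrder D s) (hs : 2 ≤ s) {x p y z : P.Vertex}
    (hyp : (P.graph D).Adj y p) (hzp : (P.graph D).Adj z p)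
    (hyd : (P.graph D).dist x y = (P.graph D).dist x p + 1)
    (hK : y.1 ⊓ x.1 = z.1 ⊓ x.1) : sim (P.graph D) x y z := by
  have hyz := h.dist_eq_of_inf_eq hK
  by_cases hne : y = z
  · subst hne; exact (sim _ _).refl _
  by_cases hadj : (P.graph D).Adj z y
  · exact sim_of_adj hadj.symm hyz
  have hcard := h.card_common hne hadj hzp hyp
  have hKN : y.1 ⊓ x.1 ≤ y.1 ⊓ z.1 := le_inf inf_le_left (hK.le.trans inf_le_left)
  have hz' : ¬ (P.graph D).Adj y z := fun e => hadj e.symm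
  -- There are q + 1 ≥ 2 common neighbours, hence one besides `p`.
  obtain ⟨w₀, hw₀p, hzw₀, hyw₀⟩ : ∃ w₀, w₀ ≠ p ∧ (P.graph D).Adj z w₀ ∧ (P.graph D).Adj y w₀ := by
    by_contra! hc
    have := card_subtype_eq_one (p := fun w => (P.graph D).Adj z w ∧ (P.graph D).Adj y w)
      (a := p) ⟨hzp, hyp⟩ fun w hw => by
        by_contra hne
        exact hc w hne hw.1 hw.2
    have h0 : 0 < Nat.card F := Nat.card_pos
    omega
  have hNw₀ := h.inf_le_of_adj_adj hyw₀ hzw₀ hne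
  have hNp := h.inf_le_of_adj_adj hyp hzp hne
  have hd₀ : (P.graph D).dist x w₀ ≤ (P.graph D).dist x y := by
    have h1 := h.dist_add_finrank x w₀
    have h2 := h.dist_add_finrank x y
    have h3 := Submodule.finrank_mono (le_inf inf_le_right (hKN.trans hNw₀) :
      y.1 ⊓ x.1 ≤ x.1 ⊓ w₀.1)
    rw [inf_comm x.1 y.1] at h2
    omega
  rcases hd₀.eq_or_lt with he | hlt
  · exact (sim _ _).trans (sim_of_adj hyw₀ he.symm) (sim_of_adj hzw₀.symm (he.trans hyz))
  have hL := hyw₀.2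
  -- If `w₀` is nearer to `x`, a detour is needed. Since `s ≥ 2`, the line of `y` and `w₀` has a
  -- third point `w`, on the level of `y`. The point `z'` nearest to `w` on the line of `z` and `p`
  -- is within distance one of `w`, and it is not `p` because `w` is neither equal nor adjacent to
  -- `p`. So `y`, `w`, `z'`, `z` stay on one level.
  obtain ⟨w, hw, hwy, hww₀⟩ : ∃ w : P.Vertex, y.1 ⊓ w₀.1 ≤ w.1 ∧ w ≠ y ∧ w ≠ w₀ := by
    by_contra! hc
    have := card_subtype_eq_one (p := fun w : P.Vertex => y.1 ⊓ w₀.1 ≤ w.1 ∧ w ≠ y)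
      (a := w₀) ⟨inf_le_right, hyw₀.1.symm⟩ fun w hw => hc w hw.1 hw.2
    rw [h.card_line y _ inf_le_left hL] at this
    omega
  have hdw : (P.graph D).dist x w = (P.graph D).dist x y :=
    h.dist_eq_of_lt inf_le_right inf_le_left hw hL hlt hww₀
  have hyw : (P.graph D).Adj y w := h.adj_of_le inf_le_left hw hL hwy.symm
  have hpw : ¬ (P.graph D).Adj p w := by
    intro hc
    have hle : y.1 ⊓ w₀.1 ≤ p.1 := by
      rw [← h.inf_eq inf_le_left hw hL hwy.symm]
      exact h.inf_le_of_adj_adj hyp hc.symm hwy.symm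
    exact hw₀p (h.eq_of_adj_of_line (y := y) (z := z) inf_le_left inf_le_right hle hL
      hzw₀ hzp hadj (Ne.symm hne))
  have hpw' : p ≠ w := by
    rintro rfl
    omega
  have hN2 := h.finrank_le_of_adj hzp.symm y.1
  have hyp2 := hyp.2
  rw [inf_comm, inf_comm z.1] at hN2
  have hNw : y.1 ⊓ z.1 ≤ w.1 := (le_inf inf_le_left hNw₀).trans hw
  have hLz : z.1 ⊓ p.1 ≤ z.1 := inf_le_left
  let z' : P.Vertex := projVertex hLz w
  have hz'd := h.dist_proj hLz hzp.2 w
  have h5 : finrank F (y.1 ⊓ z.1 : Submodule F U) ≤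
      finrank F ((z.1 ⊓ p.1) ⊓ w.1 : Submodule F U) :=
    Submodule.finrank_mono (le_inf (le_inf inf_le_right hNp) hNw)
  have hz'1 : (P.graph D).dist w z' ≤ 1 := by
    show (P.graph D).dist w (projVertex hLz w) ≤ 1
    omega
  have hz'p : z' ≠ p := by
    intro e
    rw [e] at hz'1
    have h6 := h.dist_add_finrank w p
    have h7 := h.finrank_inf_lt hpw'.symm
    exact hpw (SimpleGraph.Adj.symm (SimpleGraph.dist_eq_one_iff_adj.1 (by omega)))
  have hdz' : (P.graph D).dist x z' = (P.graph D).dist x z :=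
    h.dist_eq_of_lt (y := p) (L := z.1 ⊓ p.1) inf_le_right inf_le_left (le_proj _ _) hzp.2
      (by omega) hz'p
  have s1 : sim (P.graph D) x y w := sim_of_adj hyw hdw.symm
  have s2 : sim (P.graph D) x w z' := by
    by_cases hwz' : w = z'
    · rw [← hwz']
    · have h6 := h.dist_add_finrank w z'
      have h7 := h.finrank_inf_lt hwz'
      exact sim_of_adj (SimpleGraph.dist_eq_one_iff_adj.1 (by omega)) (by omega)
  have s3 : sim (P.graph D) x z' z := by
    by_cases hzz' : z' = z
    · rw [hzz']
    · exact sim_of_adj (h.adj_of_le (le_proj _ _) hLz hzp.2 hzz') hdz'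
  exact (sim _ _).trans ((sim _ _).trans s1 s2) s3

/-- The connected components of the subconstituents are the sets of vertices that meet `x` in a
given subspace. -/
theorem HasOrder.sim_iff (h : P.HasOrder D s) (hs : 2 ≤ s) {x y z : P.Vertex} :
    sim (P.graph D) x y z ↔ y.1 ⊓ x.1 = z.1 ⊓ x.1 := by
  refine ⟨h.inf_eq_of_sim, fun hK => ?_⟩
  induction hn : (P.graph D).dist x y generalizing y z with
  | zero =>
    have hzero : ∀ w : P.Vertex, (P.graph D).dist x w = 0 → w = x := by
      intro w hw
      by_contra hne
      have h1 := h.dist_add_finrank x w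
      have h2 := h.finrank_inf_lt (Ne.symm hne)
      omega
    rw [hzero y hn, hzero z ((h.dist_eq_of_inf_eq hK).symm.trans hn)]
  | succ n ih =>
    -- The same `m` serves `y` and `z`, so the nearer neighbours `p` and `p'` meet `x` in the same
    -- subspace and are connected by induction. Lifting that walk leads from `y` to a neighbour `w`
    -- of `p'`, and then `w` and `z` have `p'` as a common nearer neighbour.
    obtain ⟨m, hm, hmy⟩ : ∃ m ∈ x.1, m ∉ y.1 := by
      by_contra! hc
      have h1 := h.dist_add_finrank x y
      rw [inf_eq_left.2 hc, h.finrank_eq] at h1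
      omega
    have hmz : m ∉ z.1 := fun e => hmy (hK.ge ⟨e, hm⟩).1
    obtain ⟨p, hyp, hp⟩ := h.exists_inf_eq_sup hm hmy
    obtain ⟨p', hzp', hp'⟩ := h.exists_inf_eq_sup hm hmz
    have hpp' : p.1 ⊓ x.1 = p'.1 ⊓ x.1 := by rw [hp, hp', hK]
    have hdp : (P.graph D).dist x y = (P.graph D).dist x p + 1 := by
      have h1 := h.dist_add_finrank x p
      have h2 := h.dist_add_finrank x y
      have h3 := h.dist_le_succ x hyp
      have h4 : finrank F (y.1 ⊓ x.1 : Submodule F U) < finrank F (p.1 ⊓ x.1 : Submodule F U) := by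
        rw [hp]
        apply Submodule.finrank_lt_finrank_of_lt
        refine lt_of_le_of_ne le_sup_left fun e => hmy ?_
        exact (e.ge (mem_sup_right (mem_span_singleton_self m))).1
      rw [inf_comm] at h1 h2
      omega
    have hpsim := ih hpp' (by omega)
    have hdp' := dist_eq_of_sim hpsim
    obtain ⟨-, w, hwp', hyw⟩ := sim_induction
      (p := fun a => (P.graph D).dist x a = (P.graph D).dist x p ∧
        ∃ w, (P.graph D).Adj w a ∧ sim (P.graph D) x y w) hpsim ⟨rfl, y, hyp, (sim _ _).refl _⟩ (by
        rintro a b ⟨ha, w, hwa, hyw⟩ hab hd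
        obtain ⟨w', hw'b, hww'⟩ := h.exists_lift_adj hab hd hwa (by
          rw [ha, ← dist_eq_of_sim hyw, hdp])
        exact ⟨hd.symm.trans ha, w', hw'b, (sim _ _).trans hyw hww'⟩)
    refine (sim _ _).trans hyw (h.sim_of_common hs hwp' hzp' ?_ ?_)
    · rw [← dist_eq_of_sim hyw, hdp, hdp']
    · rw [← h.inf_eq_of_sim hyw, hK]

end PolarSpace

/-! ### The order of a polar space by double counting. -/

/-- The number of vectors of a subspace on which a nonzero functional takes the value one. -/
theorem card_mem_and_eq_one {F U : Type*} [Field F] [Finite F] [AddCommGroup U] [Module F U]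
    [FiniteDimensional F U] {N : Submodule F U} {f : U →ₗ[F] F} {w : U} (hw : w ∈ N)
    (hfw : f w ≠ 0) {n : ℕ} (hn : finrank F N = n + 1) :
    Nat.card {v // v ∈ N ∧ f v = 1} = Nat.card F ^ n := by
  have hker : finrank F (N ⊓ LinearMap.ker f : Submodule F U) = n := by
    have h1 := PolarSpace.finrank_le_finrank_inf_ker_add_one N f
    have h2 : finrank F (N ⊓ LinearMap.ker f : Submodule F U) < finrank F N :=
      Submodule.finrank_lt_finrank_of_lt (lt_of_le_of_ne inf_le_left fun e => hfw (e.ge hw).2)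
    omega
  rw [← hker, ← Module.natCard_eq_pow_finrank (K := F)]
  have hf1 : f ((f w)⁻¹ • w) = 1 := by rw [map_smul, smul_eq_mul, inv_mul_cancel₀ hfw]
  exact Nat.card_congr
    { toFun := fun v => ⟨v.1 - (f w)⁻¹ • w, N.sub_mem v.2.1 (N.smul_mem _ hw), by
        rw [SetLike.mem_coe, LinearMap.mem_ker, map_sub, v.2.2, hf1, sub_self]⟩
      invFun := fun v => ⟨v.1 + (f w)⁻¹ • w, N.add_mem v.2.1 (N.smul_mem _ hw), by
        rw [map_add, LinearMap.mem_ker.1 v.2.2, hf1, zero_add]⟩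
      left_inv := fun v => Subtype.ext (sub_add_cancel _ _)
      right_inv := fun v => Subtype.ext (add_sub_cancel_right _ _) }

namespace PolarSpace

variable {F U : Type*} [Field F] [AddCommGroup U] [Module F U]
  [FiniteDimensional F U] {P : PolarSpace F U}

/-- Nondegeneracy is asked of singular vectors only, since in characteristic two the polar form of a
nondegenerate quadratic form in odd dimension has a radical. This suffices because `L` consists of
singular vectors. -/
theorem finrank_perp (hnd : ∀ u, P.sing u → (∀ v, P.form u v = 0) → u = 0) {L : Submodule F U}
    (hL : P.Iso L) : finrank F (P.perp L) + finrank F L = finrank F U := by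
  have h := finrank_inf_perp (P := P) ⊤ L
  have hbot : L ⊓ P.perp ⊤ = ⊥ := by
    rw [eq_bot_iff]
    rintro u ⟨hu, hu'⟩
    exact hnd u (hL u hu).1 fun v => mem_perp'.1 hu' v mem_top
  rwa [hbot, top_inf_eq, finrank_bot, finrank_top, add_zero] at h

/-- The order of a polar space in terms of the number of singular vectors on a line through a
singular vector in a hyperbolic direction. -/
theorem hasOrder_of_card [Finite F] [Finite U] {D m κ : ℕ}
    (hnd : ∀ u, P.sing u → (∀ v, P.form u v = 0) → u = 0)
    (hκ : ∀ u w, P.sing u → P.form u w = 1 → Nat.card {a : F // P.sing (w + a • u)} = κ)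
    (hU : finrank F U = 2 * D + m) (hD : ∀ y : P.Vertex, finrank F y.1 = D) :
    P.HasOrder D (κ * Nat.card F ^ m) := by
  refine ⟨hD, fun y L hLy hL => ?_⟩
  obtain ⟨u, huy, huL⟩ : ∃ u ∈ y.1, u ∉ L := by
    by_contra! hc
    have h1 : y.1 = L := le_antisymm hc hLy
    have h2 := hD y
    rw [h1] at h2
    omega
  have hsing := (y.2.1 u huy).1
  have hLi := y.2.1.mono hLy
  have hsup : L ⊔ span F {u} = y.1 := by
    apply Submodule.eq_of_le_of_finrank_le
      (sup_le hLy ((span_singleton_le_iff_mem _ _).2 huy))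
    rw [hD, ← hL]
    apply Submodule.finrank_lt_finrank_of_lt
    exact lt_of_le_of_ne le_sup_left fun e => huL (e.ge (mem_sup_right (mem_span_singleton_self u)))
  have hN : finrank F (P.perp L) = D + m + 1 := by
    have := finrank_perp hnd hLi
    omega
  obtain ⟨w, hw, hfw⟩ : ∃ w ∈ P.perp L, P.form u w ≠ 0 := by
    by_contra! hc
    have h1 : P.perp L = P.perp y.1 := by
      rw [← hsup, perp_sup, perp_span_singleton, eq_comm, inf_eq_left]
      exact hc
    have h2 := finrank_perp hnd y.2.1
    rw [← h1, hD] at h2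
    omega
  have hA := card_mem_and_eq_one hw hfw hN
  have huN : u ∈ P.perp L := y.2.1.le_perp_of_le le_rfl hLy huy
  have hu0 := P.form_self u hsing
  have : Fintype F := Fintype.ofFinite F
  have : Fintype {v // v ∈ P.perp L ∧ P.form u v = 1} := Fintype.ofFinite _
  -- The singular `v` orthogonal to `L` with `P.form u v = 1` are counted in two ways. Here pairs of
  -- such a vector and a scalar are matched with a vector of the affine hyperplane, which has
  -- q^(D+m) elements, and one of the κ scalars making its translate along `u` singular.
  have hS : Nat.card {v // (v ∈ P.perp L ∧ P.form u v = 1) ∧ P.sing v} * Nat.card F =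
      Nat.card F ^ (D + m) * κ := by
    rw [← Nat.card_prod, ← hA]
    let e : {v // (v ∈ P.perp L ∧ P.form u v = 1) ∧ P.sing v} × F ≃
        Σ v : {v // v ∈ P.perp L ∧ P.form u v = 1}, {a : F // P.sing (v.1 + a • u)} :=
      { toFun := fun p => ⟨⟨p.1.1 - p.2 • u, (P.perp L).sub_mem p.1.2.1.1
            ((P.perp L).smul_mem _ huN), by
              rw [map_sub, map_smul, hu0, smul_zero, sub_zero, p.1.2.1.2]⟩,
          p.2, by rw [sub_add_cancel]; exact p.1.2.2⟩
        invFun := fun p => (⟨p.1.1 + p.2.1 • u, ⟨(P.perp L).add_mem p.1.2.1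
            ((P.perp L).smul_mem _ huN), by
              rw [map_add, map_smul, hu0, smul_zero, add_zero, p.1.2.2]⟩, p.2.2⟩, p.2.1)
        left_inv := fun p => by simp
        right_inv := fun ⟨⟨v, hv⟩, ⟨a, ha⟩⟩ => by
          simp only [Sigma.mk.injEq, add_sub_cancel_right, true_and]
          congr!
          simp }
    rw [Nat.card_congr e, Nat.card_sigma]
    rw [Finset.sum_congr rfl fun v _ => hκ u v.1 hsing v.2.2]
    simp only [Finset.sum_const, Finset.card_univ, smul_eq_mul, Nat.card_eq_fintype_card]
  have : Fintype {w : P.Vertex // L ≤ w.1 ∧ w ≠ y} := Fintype.ofFinite _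
  -- The second count: each such `v` spans with `L` a vertex other than `y`, and each such vertex
  -- arises from q^(D-1) vectors.
  have hZ : Nat.card {v // (v ∈ P.perp L ∧ P.form u v = 1) ∧ P.sing v} =
      Nat.card {w : P.Vertex // L ≤ w.1 ∧ w ≠ y} * Nat.card F ^ (D - 1) := by
    have hz : ∀ z : {w : P.Vertex // L ≤ w.1 ∧ w ≠ y},
        Nat.card {v // v ∈ z.1.1 ∧ P.form u v = 1} = Nat.card F ^ (D - 1) := by
      rintro ⟨z, hLz, hzy⟩
      obtain ⟨v, hv, hfv⟩ : ∃ v ∈ z.1, P.form u v ≠ 0 := by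
        by_contra! hc
        refine hzy (Subtype.ext (y.2.eq_of_le z.2.1 ?_).symm)
        rw [← hsup]
        refine sup_le hLz (le_of_le_perp (iso_span_singleton hsing) z.2 (le_perp_comm.1 ?_))
        rw [perp_span_singleton]
        exact hc
      exact card_mem_and_eq_one hv hfv (by rw [hD]; omega)
    have hv : ∀ v, (v ∈ P.perp L ∧ P.form u v = 1) ∧ P.sing v →
        Maximal P.Iso (L ⊔ span F {v}) := by
      intro v hv
      apply maximal_of_finrank y.2 (hLi.sup (iso_span_singleton hv.2)
        (le_perp_comm.1 ((span_singleton_le_iff_mem _ _).2 hv.1.1)))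
      rw [hD, ← hL]
      apply Submodule.finrank_lt_finrank_of_lt
      refine lt_of_le_of_ne le_sup_left fun e => one_ne_zero (α := F) ?_
      rw [← hv.1.2]
      exact (y.2.1 u huy).2 v (hLy (e.ge (mem_sup_right (mem_span_singleton_self v))))
    let e : {v // (v ∈ P.perp L ∧ P.form u v = 1) ∧ P.sing v} ≃
        Σ z : {w : P.Vertex // L ≤ w.1 ∧ w ≠ y}, {v // v ∈ z.1.1 ∧ P.form u v = 1} :=
      { toFun := fun v => ⟨⟨⟨L ⊔ span F {v.1}, hv _ v.2⟩, le_sup_left, fun e => by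
            have h1 : v.1 ∈ y.1 := by
              rw [← e]
              exact mem_sup_right (mem_span_singleton_self _)
            exact one_ne_zero (v.2.1.2.symm.trans ((y.2.1 u huy).2 _ h1))⟩,
          ⟨v.1, mem_sup_right (mem_span_singleton_self _), v.2.1.2⟩⟩
        invFun := fun p => ⟨p.2.1, ⟨p.1.1.2.1.le_perp_of_le le_rfl p.1.2.1 p.2.2.1, p.2.2.2⟩,
          (p.1.1.2.1 _ p.2.2.1).1⟩
        left_inv := fun v => rfl
        right_inv := fun ⟨⟨z, hLz, hzy⟩, ⟨v, hvz, hfv⟩⟩ => by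
          have hzv : L ⊔ span F {v} = z.1 :=
            (hv v ⟨⟨z.2.1.le_perp_of_le le_rfl hLz hvz, hfv⟩, (z.2.1 v hvz).1⟩).eq_of_le z.2.1
              (sup_le hLz ((span_singleton_le_iff_mem _ _).2 hvz))
          obtain ⟨z, hzm⟩ := z
          dsimp only at hzv
          subst hzv
          rfl }
    rw [Nat.card_congr e, Nat.card_sigma]
    simp only [hz, Finset.sum_const, Finset.card_univ, smul_eq_mul, Nat.card_eq_fintype_card]
  have hq : 0 < Nat.card F := Nat.card_pos
  rw [hZ, mul_assoc, ← pow_succ, show D - 1 + 1 = D by omega] at hS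
  apply Nat.eq_of_mul_eq_mul_right (pow_pos hq D)
  rw [hS, pow_add]
  ring

end PolarSpace

/-! ### Norm and trace of an involution of a finite field. -/

section involution

variable {F : Type*} [Field F] [Finite F] {σ : F →+* F}

/-- Hilbert 90 and counting: norms are fixed by σ, elements of norm one are quotients a / σ(a), and
comparing orders of kernels and images makes the image of the norm the whole fixed group. -/
theorem exists_mul_map_eq (hσ : ∀ a, σ (σ a) = a) (hne : ∃ a, σ a ≠ a) {c : F} (hc : σ c = c)
    (hc0 : c ≠ 0) : ∃ a, a * σ a = c := by
  let s : Fˣ →* Fˣ := Units.map (σ : F →* F)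
  let N : Fˣ →* Fˣ := MonoidHom.id _ * s
  let φ : Fˣ →* Fˣ := MonoidHom.id _ / s
  have hss : ∀ a, s (s a) = a := fun a => Units.ext (hσ a)
  have hN : ∀ a, N a = a * s a := fun a => rfl
  have hφ : ∀ a, φ a = a / s a := fun a => rfl
  have h1 : N.range ≤ φ.ker := by
    rintro _ ⟨a, rfl⟩
    rw [MonoidHom.mem_ker, hφ, hN, map_mul, hss, mul_comm, div_self']
  have h2 : N.ker ≤ φ.range := by
    intro a ha
    rw [MonoidHom.mem_ker, hN] at ha
    have ha' : (a : F) * σ a = 1 := congrArg Units.val ha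
    -- Hilbert's witness: b = y + a σ(y) satisfies a σ(b) = b. If it vanished for all `y`, then `y =
    -- 1` would give a = -1 and σ would be the identity.
    obtain ⟨y, hy⟩ : ∃ y, y + a * σ y ≠ 0 := by
      by_contra! hall
      have h3 : (a : F) = -1 := by
        have := hall 1
        rw [map_one, mul_one] at this
        exact (neg_eq_of_add_eq_zero_right this).symm
      obtain ⟨b, hb⟩ := hne
      have := hall b
      rw [h3] at this
      exact hb (by linear_combination -this)
    refine ⟨Units.mk0 _ hy, ?_⟩
    rw [hφ, div_eq_iff_eq_mul]
    ext
    show y + a * σ y = a * σ (y + a * σ y)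
    rw [map_add, map_mul, hσ]
    linear_combination (-y) * ha'
  have h3 := N.ker.card_mul_index
  have h4 := φ.ker.card_mul_index
  rw [Subgroup.index_ker] at h3 h4
  have h5 : Nat.card N.ker ≤ Nat.card φ.range := Subgroup.card_le_of_le h2
  have h6 : N.range = φ.ker := by
    apply Subgroup.eq_of_le_of_card_ge h1
    have h7 : 0 < Nat.card φ.range := Nat.card_pos
    by_contra! hlt
    have h8 : Nat.card N.ker * Nat.card N.range < Nat.card φ.ker * Nat.card φ.range := by
      calc _ ≤ Nat.card φ.range * Nat.card N.range := Nat.mul_le_mul_right _ h5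
        _ < Nat.card φ.range * Nat.card φ.ker := Nat.mul_lt_mul_of_pos_left hlt h7
        _ = _ := mul_comm _ _
    omega
  have hmem : Units.mk0 c hc0 ∈ N.range := by
    rw [h6, MonoidHom.mem_ker, hφ, div_eq_one]
    ext
    exact hc.symm
  obtain ⟨a, ha⟩ := hmem
  exact ⟨a, congrArg Units.val ha⟩

/-- The fibres of the trace of an involution of a finite field all have the same cardinality, the
square root of the order of the field. -/
theorem exists_card_add_map_eq (hσ : ∀ a, σ (σ a) = a) (hne : ∃ a, σ a ≠ a) :
    ∃ κ : ℕ, κ ^ 2 = Nat.card F ∧ ∀ c, σ c = c → Nat.card {a // a + σ a = c} = κ := by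
  let s : F →+ F := σ.toAddMonoidHom
  let T : F →+ F := AddMonoidHom.id _ + s
  let S : F →+ F := AddMonoidHom.id _ - s
  have hT : ∀ a, T a = a + σ a := fun a => rfl
  have hS : ∀ a, S a = a - σ a := fun a => rfl
  obtain ⟨b, hb⟩ := hne
  have hε : b - σ b ≠ 0 := sub_ne_zero.2 hb.symm
  have hσε : σ (b - σ b) = -(b - σ b) := by rw [map_sub, hσ, neg_sub]
  obtain ⟨e, he⟩ : ∃ e, e + σ e ≠ 0 := by
    by_contra! hall
    have h1 := hall 1
    have h2 := hall b
    rw [map_one] at h1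
    exact hb (by linear_combination h2 - b * h1)
  have h1 : T.range ≤ S.ker := by
    rintro _ ⟨a, rfl⟩
    rw [AddMonoidHom.mem_ker, hS, hT, map_add, hσ]
    ring
  have h2 : T.ker ≤ S.range := by
    intro a ha
    rw [AddMonoidHom.mem_ker, hT] at ha
    -- The additive form of Hilbert 90: the denominator is fixed by σ and σ(a) = -a.
    refine ⟨a * e / (e + σ e), ?_⟩
    have h3 : σ (e + σ e) = e + σ e := by rw [map_add, hσ, add_comm]
    rw [hS, map_div₀, h3, map_mul]
    field_simp
    linear_combination (-σ e) * ha
  have h3 := T.ker.card_mul_index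
  have h4 := S.ker.card_mul_index
  rw [AddSubgroup.index_ker] at h3 h4
  have h5 : Nat.card T.ker ≤ Nat.card S.range := AddSubgroup.card_le_of_le h2
  have h6 : T.range = S.ker := by
    apply AddSubgroup.eq_of_le_of_card_ge h1
    have h7 : 0 < Nat.card S.range := Nat.card_pos
    by_contra! hlt
    have h8 : Nat.card T.ker * Nat.card T.range < Nat.card S.ker * Nat.card S.range := by
      calc _ ≤ Nat.card S.range * Nat.card T.range := Nat.mul_le_mul_right _ h5
        _ < Nat.card S.range * Nat.card S.ker := Nat.mul_lt_mul_of_pos_left hlt h7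
        _ = _ := mul_comm _ _
    omega
  -- Multiplication by the skew element b - σ(b) exchanges fixed and skew elements, so the kernel of
  -- the trace has order the square root of that of the field.
  have h7 : Nat.card S.ker = Nat.card T.ker := by
    refine Nat.card_congr
      { toFun := fun a => ⟨(b - σ b) * a.1, ?_⟩
        invFun := fun a => ⟨(b - σ b)⁻¹ * a.1, ?_⟩
        left_inv := fun a => Subtype.ext (inv_mul_cancel_left₀ hε _)
        right_inv := fun a => Subtype.ext (mul_inv_cancel_left₀ hε _) }
    · have := a.2
      rw [AddMonoidHom.mem_ker, hS] at this
      rw [AddMonoidHom.mem_ker, hT, map_mul, hσε]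
      linear_combination (b - σ b) * this
    · have := a.2
      rw [AddMonoidHom.mem_ker, hT] at this
      rw [AddMonoidHom.mem_ker, hS, map_mul, map_inv₀, hσε, inv_neg]
      linear_combination (b - σ b)⁻¹ * this
  refine ⟨Nat.card T.ker, by rw [← h3, h6, h7, sq], fun c hc => ?_⟩
  have hmem : c ∈ T.range := by
    rw [h6, AddMonoidHom.mem_ker, hS, hc, sub_self]
  obtain ⟨a₀, rfl⟩ := hmem
  refine Nat.card_congr
    { toFun := fun a => ⟨a.1 - a₀, ?_⟩
      invFun := fun a => ⟨a.1 + a₀, ?_⟩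
      left_inv := fun a => Subtype.ext (sub_add_cancel _ _)
      right_inv := fun a => Subtype.ext (add_sub_cancel_right _ _) }
  · have : T a.1 = T a₀ := a.2
    rw [AddMonoidHom.mem_ker, map_sub, this, sub_self]
  · show T (a.1 + a₀) = T a₀
    rw [map_add, AddMonoidHom.mem_ker.1 a.2, zero_add]

end involution

/-! ### Existence of singular vectors over finite fields. -/

section isotropicVectors

variable {F U : Type*} [Field F] [Finite F] [AddCommGroup U] [Module F U]

/-- A quadratic form in three variables over a finite field has a nontrivial zero. -/
theorem QuadraticForm.exists_ne_zero_of_three_le (Q : QuadraticForm F U) {C : Submodule F U}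
    [FiniteDimensional F U] (hC : 3 ≤ finrank F C) : ∃ u ∈ C, u ≠ 0 ∧ Q u = 0 := by
  classical
  have : Fintype F := Fintype.ofFinite F
  -- A bilinear form, not necessarily symmetric, with diagonal `Q` exists in every characteristic.
  obtain ⟨B, hB⟩ := LinearMap.BilinMap.toQuadraticMap_surjective Q
  obtain ⟨v, hv⟩ := exists_linearIndependent_of_le_finrank hC
  let f : MvPolynomial (Fin 3) F := ∑ i, ∑ j,
    MvPolynomial.C (B (v i) (v j)) * (MvPolynomial.X i * MvPolynomial.X j)
  -- Chevalley–Warning: the degree is 2 and there are 3 variables, so the number of zeros is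
  -- divisible by the characteristic and the trivial zero is not the only one.
  have hf : f.totalDegree < Fintype.card (Fin 3) := by
    refine lt_of_le_of_lt (b := 2) ?_ (by simp)
    refine MvPolynomial.totalDegree_finsetSum_le fun i _ =>
      MvPolynomial.totalDegree_finsetSum_le fun j _ => ?_
    refine (MvPolynomial.totalDegree_mul _ _).trans ?_
    rw [MvPolynomial.totalDegree_C, zero_add]
    refine (MvPolynomial.totalDegree_mul _ _).trans ?_
    rw [MvPolynomial.totalDegree_X, MvPolynomial.totalDegree_X]
  have heval : ∀ c : Fin 3 → F, MvPolynomial.eval c f = Q (∑ i, c i • (v i : U)) := by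
    intro c
    rw [← hB, LinearMap.BilinMap.toQuadraticMap_apply]
    simp only [f, map_sum, map_mul, MvPolynomial.eval_C, MvPolynomial.eval_X, map_smul,
      LinearMap.sum_apply, LinearMap.smul_apply, smul_eq_mul, Finset.mul_sum]
    rw [Finset.sum_comm]
    exact Finset.sum_congr rfl fun i _ => Finset.sum_congr rfl fun j _ => by ring
  obtain ⟨p, hp⟩ := CharP.exists F
  have hpp : p.Prime := CharP.char_is_prime F p
  have hdvd := char_dvd_card_solutions p hf
  have h0 : MvPolynomial.eval 0 f = 0 := by rw [heval]; simp
  have hcard : 1 < Fintype.card {c : Fin 3 → F // MvPolynomial.eval c f = 0} := by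
    have hpos : 0 < Fintype.card {c : Fin 3 → F // MvPolynomial.eval c f = 0} :=
      Fintype.card_pos_iff.2 ⟨⟨0, h0⟩⟩
    exact hpp.one_lt.trans_le (Nat.le_of_dvd hpos hdvd)
  obtain ⟨⟨c, hc⟩, hne⟩ := Fintype.exists_ne_of_one_lt_card hcard ⟨0, h0⟩
  refine ⟨∑ i, c i • (v i : U), C.sum_mem fun i _ => C.smul_mem _ (v i).2, fun hz => hne ?_,
    (heval c).symm.trans hc⟩
  have hsum : ∑ i, c i • v i = 0 := Subtype.ext (by simpa using hz)
  exact Subtype.ext (funext fun i => Fintype.linearIndependent_iff.1 hv c hsum i)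

/-- A Hermitean form in two variables over a finite field has a nontrivial zero. -/
theorem exists_ne_zero_of_two_le [FiniteDimensional F U] {σ : F →+* F} {B : U →ₛₗ[σ] U →ₗ[F] F}
    (hσ : ∀ a, σ (σ a) = a) (hne : ∃ a, σ a ≠ a) (hB : B.IsSymm) {C : Submodule F U}
    (hC : 2 ≤ finrank F C) : ∃ u ∈ C, u ≠ 0 ∧ B u u = 0 := by
  obtain ⟨v, hv⟩ := exists_linearIndependent_of_le_finrank hC
  by_cases hα : B (v 0) (v 0) = 0
  · exact ⟨v 0, (v 0).2, fun e => hv.ne_zero 0 (Subtype.ext e), hα⟩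
  have hpair : ∀ a b : F, a • (v 0 : U) + b • (v 1 : U) = 0 → a = 0 ∧ b = 0 := by
    intro a b hab
    have := Fintype.linearIndependent_iff.1 hv ![a, b] (Subtype.ext (by simpa using hab))
    exact ⟨this 0, this 1⟩
  set α := B (v 0) (v 0) with hαdef
  have hσα : σ α = α := hB.eq _ _
  -- Orthogonalisation: on v 0 and w the form is diagonal, and a zero `v 0 + a • w` amounts to a
  -- prescribed norm of `a` in the fixed field.
  set c := B (v 0) (v 1) / α with hc
  set w : U := (v 1 : U) - c • (v 0 : U) with hw
  have hwC : w ∈ C := C.sub_mem (v 1).2 (C.smul_mem _ (v 0).2)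
  have h0w : B (v 0) w = 0 := by
    rw [hw, map_sub, map_smul, smul_eq_mul, hc, ← hαdef, div_mul_cancel₀ _ hα, sub_self]
  have hw0 : B w (v 0) = 0 := by rw [← hB.eq, h0w, map_zero]
  have hcomb : ∀ a : F, (v 0 : U) + a • w = (1 - a * c) • (v 0 : U) + a • (v 1 : U) := by
    intro a
    rw [hw, smul_sub, sub_smul, one_smul, smul_smul]
    abel
  by_cases hβ : B w w = 0
  · refine ⟨w, hwC, fun e => ?_, hβ⟩
    have := (hpair (-c) 1 (by rw [← e, hw, neg_smul, one_smul]; abel)).2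
    exact one_ne_zero this
  have hσβ : σ (B w w) = B w w := hB.eq _ _
  obtain ⟨a, ha⟩ := exists_mul_map_eq hσ hne (c := -α / B w w)
    (by rw [map_div₀, map_neg, hσα, hσβ]) (div_ne_zero (neg_ne_zero.2 hα) hβ)
  refine ⟨(v 0 : U) + a • w, C.add_mem (v 0).2 (C.smul_mem _ hwC), fun e => ?_, ?_⟩
  · rw [hcomb] at e
    obtain ⟨h1, h2⟩ := hpair _ _ e
    rw [h2, zero_mul, sub_zero] at h1
    exact one_ne_zero h1
  · simp only [map_add, LinearMap.add_apply, LinearMap.map_smulₛₗ, LinearMap.smul_apply, h0w, hw0,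
      zero_add, smul_eq_mul, RingHom.id_apply, ← hαdef]
    have : a * σ a * B w w = -α := by rw [ha, div_mul_cancel₀ _ hβ]
    linear_combination this

end isotropicVectors

/-! ### The polar spaces of the six families and their orders. -/

namespace PolarSpace

variable {F U : Type*} [Field F] [AddCommGroup U] [Module F U]

/-- The polar space of a quadratic form. -/
def ofQuadratic (Q : QuadraticForm F U) : PolarSpace F U where
  form := Q.polarBilin
  sing u := Q u = 0
  refl u v h := by
    rw [QuadraticMap.polarBilin_apply_apply] at h ⊢
    rw [QuadraticMap.polar_comm, h]
  sing_zero := map_zero Q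
  sing_smul a u h := by rw [QuadraticMap.map_smul, h, smul_zero]
  sing_add u v hu hv h := by
    rw [QuadraticMap.polarBilin_apply_apply] at h
    rw [QuadraticMap.map_add Q, hu, hv, h, add_zero, add_zero]
  form_self u h := by
    rw [QuadraticMap.polarBilin_apply_apply, QuadraticMap.polar_self, h, smul_zero]

theorem ofQuadratic_iso (Q : QuadraticForm F U) :
    (PolarForm.quadratic Q).IsIsotropic = (ofQuadratic Q).Iso := by
  funext W
  refine propext ⟨fun h u hu => ⟨h u hu, fun v hv => ?_⟩, fun h u hu => (h u hu).1⟩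
  show Q.polarBilin u v = 0
  rw [QuadraticMap.polarBilin_apply_apply, QuadraticMap.polar, h _ (W.add_mem hu hv), h u hu,
    h v hv, sub_zero, sub_zero]

/-- The polar space of a symplectic form. -/
def ofSymplectic (B : LinearMap.BilinForm F U) (hB : B.IsAlt) : PolarSpace F U where
  form := B
  sing _ := True
  refl u v h := hB.isRefl u v h
  sing_zero := trivial
  sing_smul _ _ _ := trivial
  sing_add _ _ _ _ _ := trivial
  form_self u _ := hB u

theorem ofSymplectic_iso (B : LinearMap.BilinForm F U) (hB : B.IsAlt) :
    (PolarForm.symplectic B).IsIsotropic = (ofSymplectic B hB).Iso := by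
  funext W
  exact propext ⟨fun h u hu => ⟨trivial, fun v hv => h u hu v hv⟩, fun h u hu => (h u hu).2⟩

/-- The polar space of a Hermitean form. -/
def ofHermitian (σ : F →+* F) (B : U →ₛₗ[σ] U →ₗ[F] F) (hB : B.IsSymm) : PolarSpace F U where
  form := B
  sing u := B u u = 0
  refl u v h := hB.isRefl u v h
  sing_zero := by simp
  sing_smul a u h := by simp [h]
  sing_add u v hu hv h := by
    simp only [map_add, LinearMap.add_apply, hu, hv, h, hB.isRefl u v h, add_zero]
  form_self u h := h

theorem ofHermitian_iso (σ : F →+* F) (B : U →ₛₗ[σ] U →ₗ[F] F) (hB : B.IsSymm) :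
    (PolarForm.hermitian σ B).IsIsotropic = (ofHermitian σ B hB).Iso := by
  funext W
  exact propext ⟨fun h u hu => ⟨h u hu u hu, fun v hv => h u hu v hv⟩, fun h u hu => (h u hu).2⟩

variable [FiniteDimensional F U] {P : PolarSpace F U}

/-- If every subspace of dimension `n` contains a nonzero singular vector, then a maximal isotropic
subspace has codimension less than `n` in its orthogonal complement. -/
theorem finrank_lt_two_mul_add (hnd : ∀ u, P.sing u → (∀ v, P.form u v = 0) → u = 0) {n : ℕ}
    (hn : ∀ C : Submodule F U, n ≤ finrank F C → ∃ u ∈ C, u ≠ 0 ∧ P.sing u) (y : P.Vertex) :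
    finrank F U < 2 * finrank F y.1 + n := by
  by_contra! hle
  obtain ⟨C, hC, hyC⟩ := exists_sup_eq_inf_eq_bot y.2.1.le_perp
  have h1 := Submodule.finrank_sup_add_finrank_inf_eq y.1 C
  have h2 := finrank_perp hnd y.2.1
  rw [hC, hyC, finrank_bot] at h1
  obtain ⟨u, hu, hu0, hs⟩ := hn C (by omega)
  have huy : span F {u} ≤ y.1 := by
    apply le_of_le_perp (iso_span_singleton hs) y.2
    rw [span_singleton_le_iff_mem, ← hC]
    exact mem_sup_right hu
  have : u ∈ y.1 ⊓ C := ⟨huy (mem_span_singleton_self u), hu⟩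
  rw [hyC, mem_bot] at this
  exact hu0 this

theorem two_mul_finrank_le (hnd : ∀ u, P.sing u → (∀ v, P.form u v = 0) → u = 0) (y : P.Vertex) :
    2 * finrank F y.1 ≤ finrank F U := by
  have h1 := finrank_perp hnd y.2.1
  have h2 := Submodule.finrank_mono y.2.1.le_perp
  omega

end PolarSpace

namespace PolarForm

open PolarSpace

variable {F U : Type*} [Field F] [AddCommGroup U] [Module F U] [Finite U]

theorem finrank_eq_of_hasWittIndex {Φ : PolarForm F U} {P : PolarSpace F U} {D : ℕ}
    (hP : Φ.IsIsotropic = P.Iso) (hD : Φ.HasWittIndex D) (y : P.Vertex) : finrank F y.1 = D := by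
  have hfd : FiniteDimensional F U := Module.Finite.of_finite
  have : Finite (Submodule F U) := Finite.of_injective _ SetLike.coe_injective
  rw [HasWittIndex, hP] at hD
  apply le_antisymm (hD.2 ⟨y.1, y.2.1, rfl⟩)
  obtain ⟨W, hW, rfl⟩ := hD.1
  obtain ⟨z, hWz, hz⟩ := Finite.exists_le_maximal hW
  rw [finrank_maximal_eq y.2 hz]
  exact Submodule.finrank_mono hWz

/-- The polar space of a form of one of the six types, and its order. -/
theorem exists_polarSpace [Finite F] {Φ : PolarForm F U} {τ : DualPolarType} {D : ℕ}
    (hΦ : Φ.IsOfType τ D) : ∃ (P : PolarSpace F U) (s : ℕ), Φ.IsIsotropic = P.Iso ∧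
      P.HasOrder D s ∧ 1 ≤ s ∧ (s : ℝ) = (Nat.card F : ℝ) ^ (τ.e + 1) := by
  have hfd : FiniteDimensional F U := Module.Finite.of_finite
  have hq : 0 < Nat.card F := Nat.card_pos
  obtain ⟨hnd, hτ⟩ := hΦ
  cases Φ with
  | quadratic Q =>
    have hnd' : ∀ u, (ofQuadratic Q).sing u → (∀ v, (ofQuadratic Q).form u v = 0) → u = 0 := by
      intro u hu hv
      have : u ∈ Q.radical := ⟨hu, LinearMap.ext hv⟩
      rwa [hnd.radical_eq_bot, mem_bot] at this
    -- The order is s = κ q^m with m = dim U - 2D. Here κ = 1 because Q(w + a u) = Q(w) + a; in the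
    -- symplectic case κ = q as all vectors are singular; in the Hermitean case κ is the square root
    -- of q, the size of a fibre of the trace.
    have hκ : ∀ u w, (ofQuadratic Q).sing u → (ofQuadratic Q).form u w = 1 →
        Nat.card {a : F // (ofQuadratic Q).sing (w + a • u)} = 1 := by
      intro u w hu huw
      have hpol : QuadraticMap.polar Q w u = 1 := by
        rw [QuadraticMap.polar_comm]
        exact huw
      have hiff : ∀ a : F, Q (w + a • u) = Q w + a := by
        intro a
        rw [QuadraticMap.map_add Q, QuadraticMap.map_smul, show Q u = 0 from hu, smul_zero, add_zero,
          QuadraticMap.polar_smul_right, hpol, smul_eq_mul, mul_one]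
      refine card_subtype_eq_one (a := -Q w) ?_ fun a ha => ?_
      · show Q _ = 0
        rw [hiff, add_neg_cancel]
      · have : Q (w + a • u) = 0 := ha
        rw [hiff] at this
        exact (neg_eq_of_add_eq_zero_right this).symm
    refine ⟨ofQuadratic Q, ?_⟩
    cases τ with
    | B =>
      have hU : finrank F U = 2 * D + 1 := hτ
      refine ⟨_, ofQuadratic_iso Q, hasOrder_of_card hnd' hκ hU fun y => ?_, ?_, ?_⟩
      · have h1 := finrank_lt_two_mul_add hnd' (n := 3) (fun C hC =>
          Q.exists_ne_zero_of_three_le hC) y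
        have h2 := two_mul_finrank_le hnd' y
        omega
      · rw [Nat.one_le_iff_ne_zero]
        simp [hq.ne']
      · simp [DualPolarType.e]
    | D =>
      refine ⟨_, ofQuadratic_iso Q, hasOrder_of_card hnd' hκ (m := 0) hτ.1
        (finrank_eq_of_hasWittIndex (ofQuadratic_iso Q) hτ.2), by simp, ?_⟩
      simp [DualPolarType.e]
    | twistedD =>
      refine ⟨_, ofQuadratic_iso Q, hasOrder_of_card hnd' hκ hτ.1
        (finrank_eq_of_hasWittIndex (ofQuadratic_iso Q) hτ.2), ?_, ?_⟩
      · rw [Nat.one_le_iff_ne_zero]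
        simp [hq.ne']
      · norm_num [DualPolarType.e]
    | C => exact hτ.elim
    | twistedAEven => exact hτ.elim
    | twistedAOdd => exact hτ.elim
  | symplectic B =>
    have hnd' : ∀ u, (ofSymplectic B hnd.1).sing u →
        (∀ v, (ofSymplectic B hnd.1).form u v = 0) → u = 0 := fun u _ hv => hnd.2.1 u hv
    have hκ : ∀ u w, (ofSymplectic B hnd.1).sing u → (ofSymplectic B hnd.1).form u w = 1 →
        Nat.card {a : F // (ofSymplectic B hnd.1).sing (w + a • u)} = Nat.card F :=
      fun u w _ _ => Nat.card_congr (Equiv.subtypeUnivEquiv fun _ => trivial)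
    refine ⟨ofSymplectic B hnd.1, ?_⟩
    cases τ with
    | C =>
      have hU : finrank F U = 2 * D := hτ
      refine ⟨_, ofSymplectic_iso B hnd.1, hasOrder_of_card hnd' hκ (m := 0) hU fun y => ?_, ?_, ?_⟩
      · have h1 := finrank_lt_two_mul_add hnd' (n := 1) (fun C hC => by
          obtain ⟨u, hu, hu0⟩ := C.exists_mem_ne_zero_of_ne_bot (by rintro rfl; simp at hC)
          exact ⟨u, hu, hu0, trivial⟩) y
        have h2 := two_mul_finrank_le hnd' y
        omega
      · rw [Nat.one_le_iff_ne_zero]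
        simp [hq.ne']
      · simp [DualPolarType.e]
    | B => exact hτ.elim
    | D => exact hτ.elim
    | twistedD => exact hτ.elim
    | twistedAEven => exact hτ.elim
    | twistedAOdd => exact hτ.elim
  | hermitian σ B =>
    obtain ⟨hσ, hne, hB, hnd⟩ := hnd
    have hnd' : ∀ u, (ofHermitian σ B hB).sing u →
        (∀ v, (ofHermitian σ B hB).form u v = 0) → u = 0 := fun u _ hv => hnd.1 u hv
    obtain ⟨κ, hκq, hκ₀⟩ := exists_card_add_map_eq hσ hne
    have hκ : ∀ u w, (ofHermitian σ B hB).sing u → (ofHermitian σ B hB).form u w = 1 →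
        Nat.card {a : F // (ofHermitian σ B hB).sing (w + a • u)} = κ := by
      intro u w hu huw
      have hu' : B u u = 0 := hu
      have huw' : B u w = 1 := huw
      have hwu : B w u = 1 := by rw [← hB.eq, huw', map_one]
      rw [← hκ₀ (-B w w) (by rw [map_neg, hB.eq])]
      refine Nat.card_congr (Equiv.subtypeEquivRight fun a => ?_)
      show B (w + a • u) (w + a • u) = 0 ↔ _
      simp only [map_add, LinearMap.add_apply, LinearMap.map_smulₛₗ, LinearMap.smul_apply, hu',
        huw', hwu, smul_eq_mul, RingHom.id_apply, mul_one]
      constructor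
      · intro h
        linear_combination h
      · intro h
        linear_combination h
    have hκpos : 0 < κ := Nat.pos_of_ne_zero (by rintro rfl; simp at hκq; omega)
    have hκr : (κ : ℝ) = (Nat.card F : ℝ) ^ (1 / 2 : ℝ) := by
      rw [← hκq, ← Real.sqrt_eq_rpow, Nat.cast_pow, Real.sqrt_sq (Nat.cast_nonneg _)]
    have hsing := fun (C : Submodule F U) (hC : 2 ≤ finrank F C) =>
      exists_ne_zero_of_two_le (U := U) (B := B) hσ hne hB (C := C) hC
    refine ⟨ofHermitian σ B hB, ?_⟩
    cases τ with
    | twistedAEven =>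
      have hU : finrank F U = 2 * D + 1 := hτ
      refine ⟨_, ofHermitian_iso σ B hB, hasOrder_of_card hnd' hκ hU fun y => ?_, ?_, ?_⟩
      · have h1 := finrank_lt_two_mul_add hnd' (n := 2) hsing y
        have h2 := two_mul_finrank_le hnd' y
        omega
      · have := Nat.mul_pos hκpos hq
        rw [pow_one]
        omega
      · rw [Nat.cast_mul, hκr, DualPolarType.e, pow_one,
          Real.rpow_add (by exact_mod_cast hq), Real.rpow_one]
    | twistedAOdd =>
      have hU : finrank F U = 2 * D := hτ
      refine ⟨_, ofHermitian_iso σ B hB, hasOrder_of_card hnd' hκ (m := 0) hU fun y => ?_, ?_, ?_⟩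
      · have h1 := finrank_lt_two_mul_add hnd' (n := 2) hsing y
        have h2 := two_mul_finrank_le hnd' y
        omega
      · rw [pow_zero, mul_one]
        omega
      · rw [pow_zero, mul_one, hκr, DualPolarType.e]
        norm_num
    | B => exact hτ.elim
    | C => exact hτ.elim
    | D => exact hτ.elim
    | twistedD => exact hτ.elim

end PolarForm

set_option linter.unusedSectionVars false

/-! ### Operators, distance-regularity and modules of the subconstituent algebra. -/

namespace Nucleus

variable {X : Type*} [Fintype X] [DecidableEq X]

/-- The adjacency operator of a graph. -/
noncomputable def adjOp (Γ : SimpleGraph X) : EuclideanSpace ℂ X →ₗ[ℂ] EuclideanSpace ℂ X :=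
  Matrix.toEuclideanLin (distMatrix Γ 1)

/-- The projection onto the vectors supported on the `i`-th subconstituent. -/
noncomputable def levelProj (Γ : SimpleGraph X) (x : X) (i : ℕ) :
    EuclideanSpace ℂ X →ₗ[ℂ] EuclideanSpace ℂ X :=
  Matrix.toEuclideanLin (dualIdem Γ x i)

theorem toEuclideanLin_apply_apply (M : Matrix X X ℂ) (v : EuclideanSpace ℂ X) (y : X) :
    Matrix.toEuclideanLin M v y = ∑ z, M y z * v z := rfl

theorem toEuclideanLin_mul (M N : Matrix X X ℂ) (v : EuclideanSpace ℂ X) :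
    Matrix.toEuclideanLin (M * N) v = Matrix.toEuclideanLin M (Matrix.toEuclideanLin N v) := by
  simp

theorem toEuclideanLin_one (v : EuclideanSpace ℂ X) :
    Matrix.toEuclideanLin (1 : Matrix X X ℂ) v = v := by
  simp

open scoped Classical in
theorem dualIdem_apply (Γ : SimpleGraph X) (x : X) (i : ℕ) (y z : X) :
    dualIdem Γ x i y z = if y = z ∧ Γ.dist x y = i then 1 else 0 := by
  have h : dualIdem Γ x i y z = @ite ℂ (y = z) (Classical.propDecidable _)
    (if Γ.dist x y = i then 1 else 0) 0 := rfl
  rw [h]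
  by_cases hyz : y = z <;> by_cases hd : Γ.dist x y = i <;> simp [hyz, hd]

open scoped Classical in
theorem levelProj_apply (Γ : SimpleGraph X) (x : X) (i : ℕ) (v : EuclideanSpace ℂ X) (y : X) :
    levelProj Γ x i v y = if Γ.dist x y = i then v y else 0 := by
  rw [levelProj, toEuclideanLin_apply_apply, Finset.sum_eq_single y]
  · simp [dualIdem_apply]
  · intro z _ hz
    rw [dualIdem_apply, if_neg fun h => hz h.1.symm, zero_mul]
  · simp

open scoped Classical in
theorem adjOp_apply (Γ : SimpleGraph X) (v : EuclideanSpace ℂ X) (y : X) :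
    adjOp Γ v y = ∑ z, (if Γ.Adj y z then v z else 0) := by
  rw [adjOp, toEuclideanLin_apply_apply]
  refine Finset.sum_congr rfl fun z _ => ?_
  simp [distMatrix, SimpleGraph.dist_eq_one_iff_adj]

theorem inner_toEuclideanLin_left {M : Matrix X X ℂ} (hM : M.conjTranspose = M)
    (v w : EuclideanSpace ℂ X) :
    inner ℂ (Matrix.toEuclideanLin M v) w = inner ℂ v (Matrix.toEuclideanLin M w) :=
  (Matrix.isSymmetric_toEuclideanLin_iff.2 hM) v w

theorem distMatrix_conjTranspose (Γ : SimpleGraph X) (i : ℕ) :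
    (distMatrix Γ i).conjTranspose = distMatrix Γ i := by
  ext y z
  simp [distMatrix, SimpleGraph.dist_comm, apply_ite]

theorem dualIdem_conjTranspose (Γ : SimpleGraph X) (x : X) (i : ℕ) :
    (dualIdem Γ x i).conjTranspose = dualIdem Γ x i := by
  ext y z
  rw [Matrix.conjTranspose_apply, dualIdem_apply, dualIdem_apply]
  by_cases hy : z = y
  · simp [hy, apply_ite]
  · simp [hy, Ne.symm hy]

theorem inner_adjOp_left (Γ : SimpleGraph X) (v w : EuclideanSpace ℂ X) :
    inner ℂ (adjOp Γ v) w = inner ℂ v (adjOp Γ w) :=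
  inner_toEuclideanLin_left (distMatrix_conjTranspose Γ 1) v w

theorem inner_levelProj_left (Γ : SimpleGraph X) (x : X) (i : ℕ) (v w : EuclideanSpace ℂ X) :
    inner ℂ (levelProj Γ x i v) w = inner ℂ v (levelProj Γ x i w) :=
  inner_toEuclideanLin_left (dualIdem_conjTranspose Γ x i) v w

/-- The intersection numbers of a distance-regular graph of diameter at most `D`. -/
structure IsDistReg (Γ : SimpleGraph X) (D : ℕ) (a b c : ℕ → ℕ) : Prop where
  connected : Γ.Connected
  dist_le : ∀ y z, Γ.dist y z ≤ D
  card_closer : ∀ x z, Nat.card {w // Γ.Adj z w ∧ Γ.dist x w + 1 = Γ.dist x z} = c (Γ.dist x z)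
  card_level : ∀ x z, Nat.card {w // Γ.Adj z w ∧ Γ.dist x w = Γ.dist x z} = a (Γ.dist x z)
  card_farther : ∀ x z, Nat.card {w // Γ.Adj z w ∧ Γ.dist x w = Γ.dist x z + 1} = b (Γ.dist x z)
  c_ne_zero : ∀ i, c (i + 1) ≠ 0
  b_ne_zero : ∀ i, i < D → b i ≠ 0

variable {Γ : SimpleGraph X} {D : ℕ} {a b c : ℕ → ℕ}

open scoped Classical in
theorem distMatrix_one_mul_apply (Γ : SimpleGraph X) (i : ℕ) (y z : X) :
    (distMatrix Γ 1 * distMatrix Γ i) y z =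
      (Nat.card {w // Γ.Adj y w ∧ Γ.dist z w = i} : ℂ) := by
  rw [Matrix.mul_apply, Nat.card_eq_fintype_card, Fintype.card_subtype, Finset.card_filter,
    Nat.cast_sum]
  refine Finset.sum_congr rfl fun w _ => ?_
  simp only [distMatrix, Matrix.of_apply, SimpleGraph.dist_eq_one_iff_adj,
    SimpleGraph.dist_comm (u := w), mul_ite, mul_one, mul_zero]
  split_ifs <;> simp_all

theorem dist_le_dist_add_one (hΓ : Γ.Connected) (x : X) {y z : X} (h : Γ.Adj y z) :
    Γ.dist x y ≤ Γ.dist x z + 1 := by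
  have h1 := hΓ.dist_triangle (u := x) (v := z) (w := y)
  rwa [SimpleGraph.dist_eq_one_iff_adj.2 h.symm] at h1

theorem distMatrix_zero (hΓ : Γ.Connected) : distMatrix Γ 0 = 1 := by
  ext y z
  simp [distMatrix, hΓ.dist_eq_zero_iff, Matrix.one_apply]

theorem IsDistReg.mul_distMatrix (h : IsDistReg Γ D a b c) (i : ℕ) :
    distMatrix Γ 1 * distMatrix Γ (i + 1) = (b i : ℂ) • distMatrix Γ i +
      (a (i + 1) : ℂ) • distMatrix Γ (i + 1) + (c (i + 2) : ℂ) • distMatrix Γ (i + 2) := by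
  ext y z
  rw [distMatrix_one_mul_apply]
  simp only [distMatrix, Matrix.add_apply, Matrix.smul_apply, Matrix.of_apply, smul_eq_mul,
    mul_ite, mul_one, mul_zero]
  rw [SimpleGraph.dist_comm (u := y)]
  have h1 := h.card_closer z y
  have h2 := h.card_level z y
  have h3 := h.card_farther z y
  rcases Nat.lt_trichotomy (Γ.dist z y) (i + 1) with hlt | heq | hgt
  · by_cases hi : Γ.dist z y = i
    · rw [hi] at h3
      simp [hi, h3]
    · have : IsEmpty {w // Γ.Adj y w ∧ Γ.dist z w = i + 1} :=
        ⟨fun ⟨w, hw, hd⟩ => by have := dist_le_dist_add_one h.connected z hw.symm; omega⟩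
      rw [Nat.card_of_isEmpty, if_neg hi, if_neg (by omega), if_neg (by omega)]
      simp
  · rw [heq] at h2
    rw [h2, if_neg (by omega), if_pos heq, if_neg (by omega)]
    simp
  · by_cases hi : Γ.dist z y = i + 2
    · have h4 : Nat.card {w // Γ.Adj y w ∧ Γ.dist z w = i + 1} =
          Nat.card {w // Γ.Adj y w ∧ Γ.dist z w + 1 = Γ.dist z y} :=
        Nat.card_congr (Equiv.subtypeEquivRight fun w => by rw [hi]; simp)
      rw [h4, h1, if_neg (by omega), if_neg (by omega), if_pos hi, hi]
      simp
    · have : IsEmpty {w // Γ.Adj y w ∧ Γ.dist z w = i + 1} :=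
        ⟨fun ⟨w, hw, hd⟩ => by have := dist_le_dist_add_one h.connected z hw; omega⟩
      rw [Nat.card_of_isEmpty, if_neg (by omega), if_neg (by omega), if_neg (by omega)]
      simp

theorem IsDistReg.distMatrix_mem_adjoin (h : IsDistReg Γ D a b c) (i : ℕ) :
    distMatrix Γ i ∈ Algebra.adjoin ℂ {distMatrix Γ 1} := by
  induction i using Nat.strong_induction_on with
  | _ i ih =>
    match i with
    | 0 => rw [distMatrix_zero h.connected]; exact one_mem _
    | 1 => exact Algebra.self_mem_adjoin_singleton _ _
    | i + 2 =>
      have h1 := h.mul_distMatrix i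
      have h2 : (c (i + 2) : ℂ) ≠ 0 := Nat.cast_ne_zero.2 (h.c_ne_zero _)
      have h3 : distMatrix Γ (i + 2) = (c (i + 2) : ℂ)⁻¹ • (distMatrix Γ 1 * distMatrix Γ (i + 1) -
          (b i : ℂ) • distMatrix Γ i - (a (i + 1) : ℂ) • distMatrix Γ (i + 1)) := by
        rw [eq_inv_smul_iff₀ h2, h1]
        abel
      rw [h3]
      exact Subalgebra.smul_mem _ (sub_mem (sub_mem (mul_mem (ih 1 (by omega)) (ih _ (by omega)))
        (Subalgebra.smul_mem _ (ih _ (by omega)) _)) (Subalgebra.smul_mem _ (ih _ (by omega)) _)) _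

theorem IsDistReg.mem_of_adjOp_mem (h : IsDistReg Γ D a b c) {W : Submodule ℂ (EuclideanSpace ℂ X)}
    (hW : ∀ w ∈ W, adjOp Γ w ∈ W) (i : ℕ) {w : EuclideanSpace ℂ X} (hw : w ∈ W) :
    Matrix.toEuclideanLin (distMatrix Γ i) w ∈ W := by
  have key : ∀ B ∈ Algebra.adjoin ℂ {distMatrix Γ 1}, ∀ w ∈ W, Matrix.toEuclideanLin B w ∈ W := by
    intro B hB
    induction hB using Algebra.adjoin_induction with
    | mem B hB => rw [Set.mem_singleton_iff.1 hB]; exact hW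
    | algebraMap r =>
      intro w hw
      rw [Algebra.algebraMap_eq_smul_one, map_smul, LinearMap.smul_apply, toEuclideanLin_one]
      exact W.smul_mem r hw
    | add B C _ _ hB hC =>
      intro w hw
      rw [map_add]
      exact W.add_mem (hB w hw) (hC w hw)
    | mul B C _ _ hB hC =>
      intro w hw
      rw [toEuclideanLin_mul]
      exact hB _ (hC w hw)
  exact key _ (h.distMatrix_mem_adjoin i) w hw

/-- A subspace is a module for the subconstituent algebra iff it is invariant under the adjacency
operator and the projections onto the subconstituents. -/
theorem IsDistReg.isTModule_iff (h : IsDistReg Γ D a b c) (hD : 1 ≤ D) {x : X}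
    {W : Submodule ℂ (EuclideanSpace ℂ X)} :
    IsTModule Γ D x W ↔ (∀ w ∈ W, adjOp Γ w ∈ W) ∧ ∀ i, ∀ w ∈ W, levelProj Γ x i w ∈ W := by
  constructor
  · intro hW
    refine ⟨fun w hw => hW _ (Algebra.subset_adjoin (Or.inl ⟨1, hD, rfl⟩)) w hw,
      fun i w hw => ?_⟩
    by_cases hi : i ≤ D
    · exact hW _ (Algebra.subset_adjoin (Or.inr ⟨i, hi, rfl⟩)) w hw
    · have : levelProj Γ x i w = 0 := by
        ext y
        rw [levelProj_apply, if_neg]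
        · rfl
        · have := h.dist_le x y
          omega
      rw [this]
      exact W.zero_mem
  · rintro ⟨hA, hE⟩ B hB
    induction hB using Algebra.adjoin_induction with
    | mem B hB =>
      rcases hB with ⟨i, -, rfl⟩ | ⟨i, -, rfl⟩
      · exact fun w hw => h.mem_of_adjOp_mem hA i hw
      · exact hE i
    | algebraMap r =>
      intro w hw
      rw [Algebra.algebraMap_eq_smul_one, map_smul, LinearMap.smul_apply, toEuclideanLin_one]
      exact W.smul_mem r hw
    | add B C _ _ hB hC =>
      intro w hw
      rw [map_add]
      exact W.add_mem (hB w hw) (hC w hw)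
    | mul B C _ _ hB hC =>
      intro w hw
      rw [toEuclideanLin_mul]
      exact hB _ (hC w hw)

/-- The last distance matrix of a distance-regular graph is injective. -/
theorem IsDistReg.eq_zero_of_distMatrix (h : IsDistReg Γ D a b c) {v : EuclideanSpace ℂ X}
    (hv : Matrix.toEuclideanLin (distMatrix Γ D) v = 0) : v = 0 := by
  have hlast : distMatrix Γ (D + 1) = 0 := by
    ext y z
    have := h.dist_le y z
    simp only [distMatrix, Matrix.of_apply, Matrix.zero_apply, ite_eq_right_iff, one_ne_zero,
      imp_false]
    omega
  -- The three-term recurrence is run downwards: since A_(D+1) = 0 and the b_i do not vanish, A_D v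
  -- = 0 forces A_(D-1) v = 0 and so on down to A_0 v = v.
  have key : ∀ n, n ≤ D → Matrix.toEuclideanLin (distMatrix Γ (D - n)) v = 0 ∧
      Matrix.toEuclideanLin (distMatrix Γ (D - n + 1)) v = 0 := by
    intro n
    induction n with
    | zero => intro _; exact ⟨hv, by simp [hlast]⟩
    | succ n ih =>
      intro hn
      obtain ⟨h1, h2⟩ := ih (by omega)
      have h3 := h.mul_distMatrix (D - (n + 1))
      rw [show D - (n + 1) + 1 = D - n by omega, show D - (n + 1) + 2 = D - n + 1 by omega] at h3
      have h4 := congrArg (fun M => Matrix.toEuclideanLin M v) h3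
      simp only [toEuclideanLin_mul, map_add, map_smul, LinearMap.add_apply, LinearMap.smul_apply,
        h1, h2, map_zero, smul_zero, add_zero] at h4
      refine ⟨(smul_eq_zero.1 h4.symm).resolve_left
        (Nat.cast_ne_zero.2 (h.b_ne_zero _ (by omega))), ?_⟩
      rw [show D - (n + 1) + 1 = D - n by omega]
      exact h1
  have h5 := (key D le_rfl).1
  rwa [Nat.sub_self, distMatrix_zero h.connected, toEuclideanLin_one] at h5

/-- Each factor A lowers the smallest distance index by at most one, so few factors leave only
distance matrices of large index, which are orthogonal to vectors supported close to x. -/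
theorem IsDistReg.adjOp_pow_distMatrix_mem (h : IsDistReg Γ D a b c) (v : EuclideanSpace ℂ X)
    (n : ℕ) : (adjOp Γ ^ n) (Matrix.toEuclideanLin (distMatrix Γ D) v) ∈
      span ℂ {w | ∃ i, D ≤ i + n ∧ w = Matrix.toEuclideanLin (distMatrix Γ i) v} := by
  induction n with
  | zero => exact subset_span ⟨D, le_rfl, rfl⟩
  | succ n ih =>
    rw [pow_succ', Module.End.mul_apply]
    have key : span ℂ {w | ∃ i, D ≤ i + n ∧ w = Matrix.toEuclideanLin (distMatrix Γ i) v} ≤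
        (span ℂ {w | ∃ i, D ≤ i + (n + 1) ∧
          w = Matrix.toEuclideanLin (distMatrix Γ i) v}).comap (adjOp Γ) := by
      rw [span_le]
      rintro _ ⟨i, hi, rfl⟩
      rw [SetLike.mem_coe, mem_comap, adjOp, ← toEuclideanLin_mul]
      cases i with
      | zero =>
        rw [distMatrix_zero h.connected, mul_one]
        exact subset_span ⟨1, by omega, rfl⟩
      | succ i =>
        rw [h.mul_distMatrix, map_add, map_add, map_smul, map_smul, map_smul]
        exact add_mem (add_mem (smul_mem _ _ (subset_span ⟨i, by omega, rfl⟩))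
          (smul_mem _ _ (subset_span ⟨i + 1, by omega, rfl⟩)))
          (smul_mem _ _ (subset_span ⟨i + 2, by omega, rfl⟩))
    exact key ih

end Nucleus

/-! ### Raising and flat matrices, and a Laplacian commuting with A. -/

namespace Nucleus

variable {X : Type*} [Fintype X] [DecidableEq X]

open scoped Classical in
/-- The raising matrix of a graph with respect to a vertex. -/
noncomputable def raiseMatrix (Γ : SimpleGraph X) (x : X) : Matrix X X ℂ :=
  Matrix.of fun z y => if Γ.Adj z y ∧ Γ.dist x z = Γ.dist x y + 1 then 1 else 0

open scoped Classical in
/-- The flat matrix of a graph with respect to a vertex. -/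
noncomputable def flatMatrix (Γ : SimpleGraph X) (x : X) : Matrix X X ℂ :=
  Matrix.of fun z y => if Γ.Adj z y ∧ Γ.dist x z = Γ.dist x y then 1 else 0

/-- The diagonal matrix of a function of the distance to a vertex. -/
noncomputable def levelMatrix (Γ : SimpleGraph X) (x : X) (g : ℕ → ℂ) : Matrix X X ℂ :=
  Matrix.diagonal fun y => g (Γ.dist x y)

/-- The Laplacian of the graph formed by the edges inside the subconstituents, scaled by a power
of `q` on each subconstituent. -/
noncomputable def levelLaplacian (Γ : SimpleGraph X) (x : X) (q : ℕ) (a : ℕ → ℕ) :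
    Matrix X X ℂ :=
  levelMatrix Γ x (fun i => (q : ℂ)⁻¹ ^ i) * (levelMatrix Γ x (fun i => (a i : ℂ)) - flatMatrix Γ x)

variable {Γ : SimpleGraph X} {x : X} {D : ℕ} {a b c : ℕ → ℕ}

theorem distMatrix_one_eq (hΓ : Γ.Connected) : distMatrix Γ 1 =
    raiseMatrix Γ x + flatMatrix Γ x + (raiseMatrix Γ x).transpose := by
  ext y z
  simp only [distMatrix, raiseMatrix, flatMatrix, Matrix.add_apply, Matrix.of_apply,
    Matrix.transpose_apply]
  by_cases hyz : Γ.Adj y z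
  · have hzy := hyz.symm
    have h3 : Γ.dist y z = 1 := SimpleGraph.dist_eq_one_iff_adj.2 hyz
    have h1 := dist_le_dist_add_one hΓ x hyz
    have h2 := dist_le_dist_add_one hΓ x hyz.symm
    rcases Nat.lt_trichotomy (Γ.dist x y) (Γ.dist x z) with h | h | h
    · rw [if_pos h3, if_neg (fun e => by omega), if_neg (fun e => by omega), if_pos ⟨hzy, by omega⟩]
      simp
    · rw [if_pos h3, if_neg (fun e => by omega), if_pos ⟨hyz, h⟩, if_neg fun e => by omega]
      simp
    · rw [if_pos h3, if_pos ⟨hyz, by omega⟩, if_neg (fun e => by omega), if_neg fun e => by omega]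
      simp
  · have hzy : ¬ Γ.Adj z y := fun h => hyz h.symm
    simp [hyz, hzy, SimpleGraph.dist_eq_one_iff_adj]

theorem flatMatrix_transpose : (flatMatrix Γ x).transpose = flatMatrix Γ x := by
  ext y z
  simp only [flatMatrix, Matrix.transpose_apply, Matrix.of_apply]
  have h : Γ.Adj z y ∧ Γ.dist x z = Γ.dist x y ↔ Γ.Adj y z ∧ Γ.dist x y = Γ.dist x z :=
    ⟨fun h => ⟨h.1.symm, h.2.symm⟩, fun h => ⟨h.1.symm, h.2.symm⟩⟩
  by_cases h' : Γ.Adj y z ∧ Γ.dist x y = Γ.dist x z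
  · rw [if_pos h', if_pos (h.2 h')]
  · rw [if_neg h', if_neg fun e => h' (h.1 e)]

theorem levelMatrix_mul_flatMatrix (g : ℕ → ℂ) :
    levelMatrix Γ x g * flatMatrix Γ x = flatMatrix Γ x * levelMatrix Γ x g := by
  ext y z
  rw [levelMatrix, Matrix.diagonal_mul, Matrix.mul_diagonal]
  simp only [flatMatrix, Matrix.of_apply]
  split_ifs with h
  · rw [h.2, mul_comm]
  · simp

theorem levelMatrix_mul_raiseMatrix (g : ℕ → ℂ) : levelMatrix Γ x g * raiseMatrix Γ x =
    raiseMatrix Γ x * levelMatrix Γ x (fun i => g (i + 1)) := by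
  ext y z
  rw [levelMatrix, levelMatrix, Matrix.diagonal_mul, Matrix.mul_diagonal]
  simp only [raiseMatrix, Matrix.of_apply]
  split_ifs with h
  · rw [h.2, mul_comm]
  · simp

/-- For z one level above y, the (z, y)-entries of FR and RF count the common neighbours of z and y
on the level of z and of y respectively. -/
theorem flatMatrix_mul_raiseMatrix {q σ : ℕ}
    (hcomm : ∀ y z, Γ.dist x z = Γ.dist x y + 1 → ∀ [Decidable (Γ.Adj z y)],
      Nat.card {w // Γ.Adj z w ∧ Γ.Adj y w ∧ Γ.dist x w = Γ.dist x z} =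
      q * Nat.card {w // Γ.Adj z w ∧ Γ.Adj y w ∧ Γ.dist x w = Γ.dist x y} +
        σ * (if Γ.Adj z y then 1 else 0)) :
    flatMatrix Γ x * raiseMatrix Γ x =
      (q : ℂ) • (raiseMatrix Γ x * flatMatrix Γ x) + (σ : ℂ) • raiseMatrix Γ x := by
  classical
  ext z y
  rw [Matrix.add_apply, Matrix.smul_apply, Matrix.smul_apply, Matrix.mul_apply, Matrix.mul_apply]
  by_cases hd : Γ.dist x z = Γ.dist x y + 1
  · have h := hcomm y z hd
    have h1 : ∑ w, flatMatrix Γ x z w * raiseMatrix Γ x w y =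
        (Nat.card {w // Γ.Adj z w ∧ Γ.Adj y w ∧ Γ.dist x w = Γ.dist x z} : ℂ) := by
      rw [Nat.card_eq_fintype_card, Fintype.card_subtype, Finset.card_filter, Nat.cast_sum]
      refine Finset.sum_congr rfl fun w _ => ?_
      simp only [flatMatrix, raiseMatrix, Matrix.of_apply]
      rw [ite_zero_mul_ite_zero, mul_one, Nat.cast_ite, Nat.cast_one, Nat.cast_zero]
      exact if_congr ⟨fun h => ⟨h.1.1, h.2.1.symm, h.1.2.symm⟩,
        fun h => ⟨⟨h.1, h.2.2.symm⟩, h.2.1.symm, h.2.2.trans hd⟩⟩ rfl rfl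
    have h2 : ∑ w, raiseMatrix Γ x z w * flatMatrix Γ x w y =
        (Nat.card {w // Γ.Adj z w ∧ Γ.Adj y w ∧ Γ.dist x w = Γ.dist x y} : ℂ) := by
      rw [Nat.card_eq_fintype_card, Fintype.card_subtype, Finset.card_filter, Nat.cast_sum]
      refine Finset.sum_congr rfl fun w _ => ?_
      simp only [flatMatrix, raiseMatrix, Matrix.of_apply]
      rw [ite_zero_mul_ite_zero, mul_one, Nat.cast_ite, Nat.cast_one, Nat.cast_zero]
      exact if_congr ⟨fun h => ⟨h.1.1, h.2.1.symm, h.2.2⟩,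
        fun h => ⟨⟨h.1, by rw [hd, h.2.2]⟩, h.2.1.symm, h.2.2⟩⟩ rfl rfl
    rw [h1, h2, h]
    simp only [raiseMatrix, Matrix.of_apply, hd, and_true, smul_eq_mul]
    push_cast
    rfl
  · have h1 : ∑ w, flatMatrix Γ x z w * raiseMatrix Γ x w y = 0 := by
      refine Finset.sum_eq_zero fun w _ => ?_
      simp only [flatMatrix, raiseMatrix, Matrix.of_apply]
      split_ifs with h1 h2 <;> simp
      exact hd (h1.2.trans h2.2)
    have h2 : ∑ w, raiseMatrix Γ x z w * flatMatrix Γ x w y = 0 := by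
      refine Finset.sum_eq_zero fun w _ => ?_
      simp only [flatMatrix, raiseMatrix, Matrix.of_apply]
      split_ifs with h1 h2 <;> simp
      exact hd (by rw [← h2.2]; exact h1.2)
    rw [h1, h2]
    simp [raiseMatrix, hd]

theorem levelLaplacian_transpose (q : ℕ) : (levelLaplacian Γ x q a).transpose =
    levelLaplacian Γ x q a := by
  have h1 : ∀ g : ℕ → ℂ, (levelMatrix Γ x g).transpose = levelMatrix Γ x g :=
    fun g => Matrix.diagonal_transpose _
  have h2 : levelMatrix Γ x (fun i => (a i : ℂ)) * levelMatrix Γ x (fun i => (q : ℂ)⁻¹ ^ i) =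
      levelMatrix Γ x (fun i => (q : ℂ)⁻¹ ^ i) * levelMatrix Γ x (fun i => (a i : ℂ)) := by
    simp only [levelMatrix, Matrix.diagonal_mul_diagonal, mul_comm]
  rw [levelLaplacian, Matrix.transpose_mul, Matrix.transpose_sub, h1, h1, flatMatrix_transpose,
    sub_mul, mul_sub, levelMatrix_mul_flatMatrix, h2]

/-- The valencies satisfy the same recursion as F, so (a - F)R = qR(a - F), and the scaling by
q^(-i) absorbs the factor q. -/
theorem levelLaplacian_mul_raiseMatrix {q σ : ℕ} (hq : q ≠ 0) (ha : ∀ i, a (i + 1) = q * a i + σ)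
    (hFR : flatMatrix Γ x * raiseMatrix Γ x =
      (q : ℂ) • (raiseMatrix Γ x * flatMatrix Γ x) + (σ : ℂ) • raiseMatrix Γ x) :
    levelLaplacian Γ x q a * raiseMatrix Γ x = raiseMatrix Γ x * levelLaplacian Γ x q a := by
  have hq' : (q : ℂ) ≠ 0 := Nat.cast_ne_zero.2 hq
  have h1 : levelMatrix Γ x (fun i => (a (i + 1) : ℂ)) =
      (q : ℂ) • levelMatrix Γ x (fun i => (a i : ℂ)) + (σ : ℂ) • 1 := by
    ext y z
    simp only [levelMatrix, Matrix.add_apply, Matrix.smul_apply, Matrix.diagonal_apply,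
      Matrix.one_apply, ha]
    split_ifs <;> simp
  have h2 : levelMatrix Γ x (fun i => (q : ℂ)⁻¹ ^ (i + 1)) =
      (q : ℂ)⁻¹ • levelMatrix Γ x (fun i => (q : ℂ)⁻¹ ^ i) := by
    ext y z
    simp only [levelMatrix, Matrix.smul_apply, Matrix.diagonal_apply, pow_succ']
    split_ifs <;> simp
  have h3 : (levelMatrix Γ x (fun i => (a i : ℂ)) - flatMatrix Γ x) * raiseMatrix Γ x =
      (q : ℂ) • (raiseMatrix Γ x * (levelMatrix Γ x (fun i => (a i : ℂ)) - flatMatrix Γ x)) := by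
    rw [sub_mul, levelMatrix_mul_raiseMatrix, h1, hFR, mul_add, Matrix.mul_smul, Matrix.mul_smul,
      mul_one, mul_sub, smul_sub]
    abel
  rw [levelLaplacian, mul_assoc, h3, Matrix.mul_smul, ← mul_assoc, levelMatrix_mul_raiseMatrix, h2,
    Matrix.mul_smul, Matrix.smul_mul, smul_smul, mul_inv_cancel₀ hq', one_smul, mul_assoc]

/-- A is the sum of R, F and the transpose of R; since the Laplacian is symmetric, commuting with R
implies commuting with its transpose. -/
theorem levelLaplacian_commute (hΓ : Γ.Connected) {q σ : ℕ} (hq : q ≠ 0)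
    (ha : ∀ i, a (i + 1) = q * a i + σ)
    (hFR : flatMatrix Γ x * raiseMatrix Γ x =
      (q : ℂ) • (raiseMatrix Γ x * flatMatrix Γ x) + (σ : ℂ) • raiseMatrix Γ x) :
    levelLaplacian Γ x q a * distMatrix Γ 1 = distMatrix Γ 1 * levelLaplacian Γ x q a := by
  have h1 := levelLaplacian_mul_raiseMatrix hq ha hFR
  have h2 := congrArg Matrix.transpose h1
  rw [Matrix.transpose_mul, Matrix.transpose_mul, levelLaplacian_transpose] at h2
  have h3 : levelLaplacian Γ x q a * flatMatrix Γ x = flatMatrix Γ x * levelLaplacian Γ x q a := by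
    rw [levelLaplacian, mul_assoc, sub_mul, levelMatrix_mul_flatMatrix, ← mul_sub, ← mul_assoc,
      levelMatrix_mul_flatMatrix, mul_assoc]
  rw [distMatrix_one_eq (x := x) hΓ, mul_add, mul_add, add_mul, add_mul, h1, h3, h2]

/-- The raising operator. -/
noncomputable def raiseOp (Γ : SimpleGraph X) (x : X) :
    EuclideanSpace ℂ X →ₗ[ℂ] EuclideanSpace ℂ X :=
  Matrix.toEuclideanLin (raiseMatrix Γ x)

/-- The flat operator. -/
noncomputable def flatOp (Γ : SimpleGraph X) (x : X) :
    EuclideanSpace ℂ X →ₗ[ℂ] EuclideanSpace ℂ X :=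
  Matrix.toEuclideanLin (flatMatrix Γ x)

/-- The operator of the scaled Laplacian of the subconstituents. -/
noncomputable def laplacianOp (Γ : SimpleGraph X) (x : X) (q : ℕ) (a : ℕ → ℕ) :
    EuclideanSpace ℂ X →ₗ[ℂ] EuclideanSpace ℂ X :=
  Matrix.toEuclideanLin (levelLaplacian Γ x q a)

open scoped Classical in
theorem raiseOp_apply (v : EuclideanSpace ℂ X) (y : X) : raiseOp Γ x v y =
    ∑ z, if Γ.Adj y z ∧ Γ.dist x y = Γ.dist x z + 1 then v z else 0 := by
  rw [raiseOp, toEuclideanLin_apply_apply]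
  exact Finset.sum_congr rfl fun z _ => by simp [raiseMatrix]

open scoped Classical in
theorem flatOp_apply (v : EuclideanSpace ℂ X) (y : X) : flatOp Γ x v y =
    ∑ z, if Γ.Adj y z ∧ Γ.dist x y = Γ.dist x z then v z else 0 := by
  rw [flatOp, toEuclideanLin_apply_apply]
  exact Finset.sum_congr rfl fun z _ => by simp [flatMatrix]

theorem laplacianOp_apply (q : ℕ) (v : EuclideanSpace ℂ X) (y : X) : laplacianOp Γ x q a v y =
    (q : ℂ)⁻¹ ^ Γ.dist x y * ((a (Γ.dist x y) : ℂ) * v y - flatOp Γ x v y) := by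
  have h1 : ∀ (g : ℕ → ℂ) (u : EuclideanSpace ℂ X),
      Matrix.toEuclideanLin (levelMatrix Γ x g) u y = g (Γ.dist x y) * u y := by
    intro g u
    rw [toEuclideanLin_apply_apply, Finset.sum_eq_single y]
    · simp [levelMatrix]
    · intro z _ hz
      rw [levelMatrix, Matrix.diagonal_apply_ne _ hz.symm, zero_mul]
    · simp
  rw [laplacianOp, levelLaplacian, toEuclideanLin_mul, h1, map_sub, LinearMap.sub_apply,
    PiLp.sub_apply, h1, flatOp]

theorem laplacianOp_adjOp (hΓ : Γ.Connected) {q σ : ℕ} (hq : q ≠ 0)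
    (ha : ∀ i, a (i + 1) = q * a i + σ)
    (hFR : flatMatrix Γ x * raiseMatrix Γ x =
      (q : ℂ) • (raiseMatrix Γ x * flatMatrix Γ x) + (σ : ℂ) • raiseMatrix Γ x)
    (v : EuclideanSpace ℂ X) :
    laplacianOp Γ x q a (adjOp Γ v) = adjOp Γ (laplacianOp Γ x q a v) := by
  rw [laplacianOp, adjOp, ← toEuclideanLin_mul, ← toEuclideanLin_mul,
    levelLaplacian_commute hΓ hq ha hFR]

theorem flatOp_levelProj (i : ℕ) (v : EuclideanSpace ℂ X) :
    flatOp Γ x (levelProj Γ x i v) = levelProj Γ x i (flatOp Γ x v) := by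
  ext y
  rw [flatOp_apply, levelProj_apply, flatOp_apply]
  by_cases hy : Γ.dist x y = i
  · rw [if_pos hy]
    refine Finset.sum_congr rfl fun z _ => ?_
    split_ifs with hz
    · rw [levelProj_apply, if_pos (hz.2.symm.trans hy)]
    · rfl
  · rw [if_neg hy]
    refine Finset.sum_eq_zero fun z _ => ?_
    split_ifs with hz
    · rw [levelProj_apply, if_neg fun e => hy (hz.2.trans e)]
    · rfl

theorem laplacianOp_levelProj (q i : ℕ) (v : EuclideanSpace ℂ X) :
    laplacianOp Γ x q a (levelProj Γ x i v) = levelProj Γ x i (laplacianOp Γ x q a v) := by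
  ext y
  rw [laplacianOp_apply, flatOp_levelProj, levelProj_apply, levelProj_apply, levelProj_apply,
    laplacianOp_apply]
  split_ifs <;> simp

theorem sum_levelProj (hD : ∀ y, Γ.dist x y ≤ D) (v : EuclideanSpace ℂ X) :
    ∑ i ∈ Finset.range (D + 1), levelProj Γ x i v = v := by
  ext y
  rw [WithLp.ofLp_sum, Finset.sum_apply]
  simp only [levelProj_apply]
  rw [Finset.sum_ite_eq, if_pos (Finset.mem_range.2 (Nat.lt_succ_of_le (hD y)))]

/-- Together with the analogous formula for the raising operator, this shows that every module is
invariant under both. -/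
theorem flatOp_eq_sum (hD : ∀ y, Γ.dist x y ≤ D) (v : EuclideanSpace ℂ X) : flatOp Γ x v =
    ∑ i ∈ Finset.range (D + 1), levelProj Γ x i (adjOp Γ (levelProj Γ x i v)) := by
  rw [← sum_levelProj hD (flatOp Γ x v)]
  refine Finset.sum_congr rfl fun i _ => ?_
  ext y
  rw [levelProj_apply, levelProj_apply]
  split_ifs with hy
  · rw [flatOp_apply, adjOp_apply]
    refine Finset.sum_congr rfl fun z _ => ?_
    rw [levelProj_apply]
    by_cases h1 : Γ.Adj y z <;> by_cases h2 : Γ.dist x z = i <;> simp [h1, h2, hy, eq_comm]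
    exact fun e => absurd e.symm h2
  · rfl

theorem raiseOp_eq_sum (hD : ∀ y, Γ.dist x y ≤ D) (v : EuclideanSpace ℂ X) : raiseOp Γ x v =
    ∑ i ∈ Finset.range (D + 1), levelProj Γ x (i + 1) (adjOp Γ (levelProj Γ x i v)) := by
  conv_lhs => rw [← sum_levelProj hD v, map_sum]
  refine Finset.sum_congr rfl fun i _ => ?_
  ext y
  rw [levelProj_apply, adjOp_apply, raiseOp_apply]
  split_ifs with hy
  · refine Finset.sum_congr rfl fun z _ => ?_
    rw [levelProj_apply]
    by_cases h1 : Γ.Adj y z <;> by_cases h2 : Γ.dist x z = i <;> simp [h1, h2, hy]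
  · refine Finset.sum_eq_zero fun z _ => ?_
    rw [levelProj_apply]
    by_cases h1 : Γ.Adj y z <;> by_cases h2 : Γ.dist x z = i <;> simp [h1, h2, hy]

end Nucleus

/-! ### Positivity and kernel of the Laplacian. -/

namespace Nucleus

variable {X : Type*} [Fintype X] [DecidableEq X]

variable {Γ : SimpleGraph X} {x : X} {D : ℕ} {a b c : ℕ → ℕ}

open scoped Classical in
/-- The energy form of the Laplacian of the subconstituents. -/
theorem IsDistReg.sum_flat (h : IsDistReg Γ D a b c) (v : EuclideanSpace ℂ X) :
    ∑ z, ∑ y, (if Γ.Adj z y ∧ Γ.dist x z = Γ.dist x y then ‖v z - v y‖ ^ 2 else 0) =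
      2 * ∑ z, (star (v z) * ((a (Γ.dist x z) : ℂ) * v z - flatOp Γ x v z)).re := by
  have hcard : ∀ z, ∑ y, (if Γ.Adj z y ∧ Γ.dist x z = Γ.dist x y then (1 : ℝ) else 0) =
      a (Γ.dist x z) := by
    intro z
    rw [← h.card_level x z, Nat.card_eq_fintype_card, Fintype.card_subtype, Finset.card_filter,
      Nat.cast_sum]
    refine Finset.sum_congr rfl fun y _ => ?_
    rw [Nat.cast_ite, Nat.cast_one, Nat.cast_zero]
    exact if_congr (and_congr_right fun _ => eq_comm) rfl rfl
  have hrow : ∑ z, ∑ y, (if Γ.Adj z y ∧ Γ.dist x z = Γ.dist x y then ‖v z‖ ^ 2 else 0) =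
      ∑ z, (a (Γ.dist x z) : ℝ) * ‖v z‖ ^ 2 := by
    refine Finset.sum_congr rfl fun z _ => ?_
    rw [← hcard, Finset.sum_mul]
    exact Finset.sum_congr rfl fun y _ => by split_ifs <;> simp
  have hcol : ∑ z, ∑ y, (if Γ.Adj z y ∧ Γ.dist x z = Γ.dist x y then ‖v y‖ ^ 2 else 0) =
      ∑ z, (a (Γ.dist x z) : ℝ) * ‖v z‖ ^ 2 := by
    rw [Finset.sum_comm, ← hrow]
    refine Finset.sum_congr rfl fun z _ => Finset.sum_congr rfl fun y _ => ?_
    exact if_congr ⟨fun h => ⟨h.1.symm, h.2.symm⟩, fun h => ⟨h.1.symm, h.2.symm⟩⟩ rfl rfl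
  have hmix : ∀ z, (star (v z) * flatOp Γ x v z).re =
      ∑ y, (if Γ.Adj z y ∧ Γ.dist x z = Γ.dist x y then (star (v z) * v y).re else 0) := by
    intro z
    rw [flatOp_apply, Finset.mul_sum, Complex.re_sum]
    exact Finset.sum_congr rfl fun y _ => by split_ifs <;> simp
  have hdiag : ∀ z, (star (v z) * ((a (Γ.dist x z) : ℂ) * v z)).re =
      (a (Γ.dist x z) : ℝ) * ‖v z‖ ^ 2 := by
    intro z
    rw [mul_left_comm, ← Complex.normSq_eq_norm_sq, Complex.star_def,
      ← Complex.normSq_eq_conj_mul_self, ← Complex.ofReal_natCast, ← Complex.ofReal_mul, Complex.ofReal_re]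
  have hexp : ∀ z y, ‖v z - v y‖ ^ 2 = ‖v z‖ ^ 2 + ‖v y‖ ^ 2 - 2 * (star (v z) * v y).re := by
    intro z y
    rw [← Complex.normSq_eq_norm_sq, ← Complex.normSq_eq_norm_sq, ← Complex.normSq_eq_norm_sq,
      Complex.normSq_sub]
    simp [Complex.mul_re]
  have hsplit : ∀ z y, (if Γ.Adj z y ∧ Γ.dist x z = Γ.dist x y then ‖v z - v y‖ ^ 2 else 0) =
      (if Γ.Adj z y ∧ Γ.dist x z = Γ.dist x y then ‖v z‖ ^ 2 else 0) +
      (if Γ.Adj z y ∧ Γ.dist x z = Γ.dist x y then ‖v y‖ ^ 2 else 0) -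
      2 * (if Γ.Adj z y ∧ Γ.dist x z = Γ.dist x y then (star (v z) * v y).re else 0) := by
    intro z y
    split_ifs
    · exact hexp z y
    · simp
  simp only [hsplit, Finset.sum_sub_distrib, Finset.sum_add_distrib, hrow, hcol, mul_sub,
    Complex.sub_re, hdiag, hmix, ← Finset.mul_sum]
  ring

/-- The eigenvalues of the Laplacian have nonnegative real part. -/
theorem IsDistReg.re_nonneg_of_laplacianOp (h : IsDistReg Γ D a b c) {q : ℕ} (hq : q ≠ 0)
    {v : EuclideanSpace ℂ X} (hv : v ≠ 0) {μ : ℂ} (hμ : laplacianOp Γ x q a v = μ • v) :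
    0 ≤ μ.re := by
  classical
  have hq' : (q : ℂ) ≠ 0 := Nat.cast_ne_zero.2 hq
  have h1 : ∀ z, (a (Γ.dist x z) : ℂ) * v z - flatOp Γ x v z = q ^ Γ.dist x z * (μ * v z) := by
    intro z
    have := congrArg (fun w : EuclideanSpace ℂ X => w z) hμ
    simp only [laplacianOp_apply, PiLp.smul_apply, smul_eq_mul] at this
    rw [← this, inv_pow, mul_inv_cancel_left₀ (pow_ne_zero _ hq')]
  have h2 := h.sum_flat (x := x) v
  have h3 : 0 ≤ ∑ z, ∑ y,
      (if Γ.Adj z y ∧ Γ.dist x z = Γ.dist x y then ‖v z - v y‖ ^ 2 else 0) :=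
    Finset.sum_nonneg fun z _ => Finset.sum_nonneg fun y _ => by positivity
  -- With the scaling undone, the energy of an eigenvector is `2 * μ.re` times the squared norm
  -- weighted by q^∂(x,z), which is positive.
  have h4 : ∀ z, (star (v z) * ((a (Γ.dist x z) : ℂ) * v z - flatOp Γ x v z)).re =
      μ.re * ((q : ℝ) ^ Γ.dist x z * ‖v z‖ ^ 2) := by
    intro z
    rw [h1, show star (v z) * ((q : ℂ) ^ Γ.dist x z * (μ * v z)) =
      ((q : ℂ) ^ Γ.dist x z * (star (v z) * v z)) * μ by ring, Complex.star_def,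
      ← Complex.normSq_eq_conj_mul_self, Complex.normSq_eq_norm_sq]
    rw [← Complex.ofReal_natCast, ← Complex.ofReal_pow, ← Complex.ofReal_mul, Complex.re_ofReal_mul,
      mul_comm]
  rw [h2] at h3
  simp only [h4, ← Finset.mul_sum] at h3
  have h5 : 0 < ∑ z, (q : ℝ) ^ Γ.dist x z * ‖v z‖ ^ 2 := by
    obtain ⟨z, hz⟩ : ∃ z, v z ≠ 0 := by
      by_contra! hz
      exact hv (by ext z; exact hz z)
    refine Finset.sum_pos' (fun z _ => by positivity) ⟨z, Finset.mem_univ z, ?_⟩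
    have : 0 < q := Nat.pos_of_ne_zero hq
    have : 0 < ‖v z‖ := norm_pos_iff.2 hz
    positivity
  by_contra! hneg
  nlinarith

/-- The kernel of the Laplacian consists of the vectors that are constant on the connected
components of the subconstituents. -/
theorem IsDistReg.laplacianOp_eq_zero_iff (h : IsDistReg Γ D a b c) {q : ℕ} (hq : q ≠ 0)
    {v : EuclideanSpace ℂ X} :
    laplacianOp Γ x q a v = 0 ↔ ∀ y z, sim Γ x y z → v y = v z := by
  classical
  have hq' : (q : ℂ) ≠ 0 := Nat.cast_ne_zero.2 hq
  constructor
  · intro hv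
    have h1 : ∀ z, (a (Γ.dist x z) : ℂ) * v z - flatOp Γ x v z = 0 := by
      intro z
      have := congrArg (fun w : EuclideanSpace ℂ X => w z) hv
      simp only [laplacianOp_apply, PiLp.zero_apply] at this
      exact (mul_eq_zero.1 this).resolve_left (pow_ne_zero _ (inv_ne_zero hq'))
    have h2 := h.sum_flat (x := x) v
    simp only [h1, mul_zero, Complex.zero_re, Finset.sum_const_zero] at h2
    have h3 : ∀ z y, Γ.Adj z y → Γ.dist x z = Γ.dist x y → v z = v y := by
      intro z y hzy hd
      have h4 := (Finset.sum_eq_zero_iff_of_nonneg fun z _ =>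
        Finset.sum_nonneg fun y _ => by positivity).1 h2 z (Finset.mem_univ z)
      have h5 := (Finset.sum_eq_zero_iff_of_nonneg fun y _ => by positivity).1 h4 y
        (Finset.mem_univ y)
      rw [if_pos ⟨hzy, hd⟩] at h5
      exact sub_eq_zero.1 (norm_eq_zero.1 (pow_eq_zero_iff two_ne_zero |>.1 h5))
    intro y z hyz
    exact sim_induction (p := fun z => v y = v z) hyz rfl fun _ _ hs hadj hd =>
      hs.trans (h3 _ _ hadj hd)
  · intro hv
    ext z
    rw [laplacianOp_apply, flatOp_apply]
    have h1 : ∑ y, (if Γ.Adj z y ∧ Γ.dist x z = Γ.dist x y then v y else 0) =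
        (a (Γ.dist x z) : ℂ) * v z := by
      rw [← h.card_level x z, Nat.card_eq_fintype_card, Fintype.card_subtype, Finset.card_filter,
        Nat.cast_sum, Finset.sum_mul]
      refine Finset.sum_congr rfl fun y _ => ?_
      by_cases hy : Γ.Adj z y ∧ Γ.dist x z = Γ.dist x y
      · rw [if_pos hy, if_pos ⟨hy.1, hy.2.symm⟩, Nat.cast_one, one_mul]
        exact (hv z y (sim_of_adj hy.1 hy.2)).symm
      · rw [if_neg hy, if_neg fun e => hy ⟨e.1, e.2.symm⟩, Nat.cast_zero, zero_mul]
    rw [h1, sub_self, mul_zero, PiLp.zero_apply]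

end Nucleus

/-! ### Flags with a triangular operator, and the flag of vectors supported near x. -/

namespace Nucleus

section Flag

variable {V : Type*} [AddCommGroup V] [Module ℂ V] {A : V →ₗ[ℂ] V} {θ : ℕ → ℂ}
  {G : ℕ → Submodule ℂ V} {W : Submodule ℂ V}

/-- An invariant subspace that meets the `n`-th member of a flag on which `A` acts triangularly
contains an eigenvector for one of the first `n` diagonal entries. -/
theorem exists_eigenvector_of_mem_flag (h0 : G 0 = ⊥)
    (hG : ∀ j, ∀ v ∈ G (j + 1), A v - θ j • v ∈ G j) (hW : ∀ w ∈ W, A w ∈ W) (n : ℕ) {v : V}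
    (hv : v ∈ G n) (hvW : v ∈ W) (hv0 : v ≠ 0) : ∃ i < n, ∃ u ∈ W, u ≠ 0 ∧ A u = θ i • u := by
  induction n generalizing v with
  | zero =>
    rw [h0] at hv
    exact absurd ((mem_bot ℂ).1 hv) hv0
  | succ n ih =>
    by_cases h : A v - θ n • v = 0
    · exact ⟨n, Nat.lt_succ_self n, v, hvW, hv0, sub_eq_zero.1 h⟩
    · obtain ⟨i, hi, hu⟩ := ih (hG n v hv) (W.sub_mem (hW v hvW) (W.smul_mem _ hvW)) h
      exact ⟨i, hi.trans (Nat.lt_succ_self n), hu⟩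

/-- An eigenvector for θ_t in G_(j+1) has (θ_t - θ_j) v in G_j, so it descends as long as j > t. -/
theorem mem_flag_of_eigenvector {D : ℕ} (hG : ∀ j, ∀ v ∈ G (j + 1), A v - θ j • v ∈ G j)
    {t : ℕ} (ht : t ≤ D) (hθ : ∀ i j, i < j → j ≤ D → θ i ≠ θ j) {v : V} (hv : v ∈ G (D + 1))
    (hvt : A v = θ t • v) : v ∈ G (t + 1) := by
  have key : ∀ n, t + n ≤ D → v ∈ G (t + n + 1) → v ∈ G (t + 1) := by
    intro n
    induction n with
    | zero => exact fun _ h => h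
    | succ n ih =>
      intro hn hv
      have h1 := hG _ v hv
      rw [hvt, ← sub_smul] at h1
      exact ih (by omega) ((Submodule.smul_mem_iff _
        (sub_ne_zero.2 (hθ t (t + (n + 1)) (by omega) hn))).1 h1)
  refine key (D - t) (by omega) ?_
  rwa [show t + (D - t) + 1 = D + 1 by omega]

end Flag

/-- An invariant subspace without eigenvectors for the first `t` diagonal entries is orthogonal
to the `t`-th member of the flag. -/
theorem inner_eq_zero_of_mem_flag {V : Type*} [NormedAddCommGroup V] [InnerProductSpace ℂ V]
    [FiniteDimensional ℂ V] {A : V →ₗ[ℂ] V} (hA : ∀ v w, inner ℂ (A v) w = inner ℂ v (A w))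
    {θ : ℕ → ℝ} {G : ℕ → Submodule ℂ V} {W : Submodule ℂ V} (h0 : G 0 = ⊥)
    (hG : ∀ j, ∀ v ∈ G (j + 1), A v - (θ j : ℂ) • v ∈ G j) (hW : ∀ w ∈ W, A w ∈ W) {t : ℕ}
    (ht : ∀ i < t, ∀ u ∈ W, A u = (θ i : ℂ) • u → u = 0) {w g : V} (hw : w ∈ W) (hg : g ∈ G t) :
    inner ℂ w g = 0 := by
  induction t generalizing w g with
  | zero =>
    rw [h0] at hg
    rw [(mem_bot ℂ).1 hg, inner_zero_right]
  | succ t ih =>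
    set B : V →ₗ[ℂ] V := A - (θ t : ℂ) • LinearMap.id
    have hB : ∀ w ∈ W, B w ∈ W := fun w hw =>
      W.sub_mem (hW w hw) (W.smul_mem _ hw)
    -- A - θ_t is injective on `W`, hence bijective there, so w = (A - θ_t) u. Moving the
    -- selfadjoint factor to `g` lowers `g` by one step of the flag.
    have hinj : Function.Injective (B.restrict hB) := by
      rw [← LinearMap.ker_eq_bot, LinearMap.ker_eq_bot']
      intro u hu
      have h1 : A u - (θ t : ℂ) • (u : V) = 0 := congrArg Subtype.val hu
      exact Subtype.ext (ht t (Nat.lt_succ_self t) u u.2 (sub_eq_zero.1 h1))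
    obtain ⟨u, hu⟩ := (LinearMap.injective_iff_surjective.1 hinj) ⟨w, hw⟩
    have hu' : w = A u - (θ t : ℂ) • (u : V) := (congrArg Subtype.val hu).symm
    have h2 := ih (fun i hi => ht i (hi.trans (Nat.lt_succ_self t))) u.2 (hG t g hg)
    rw [inner_sub_right, inner_smul_right] at h2
    rw [hu', inner_sub_left, inner_smul_left, hA, Complex.conj_ofReal]
    exact h2

variable {X : Type*} [Fintype X] [DecidableEq X]

variable {Γ : SimpleGraph X} {x : X} {D : ℕ} {a b c : ℕ → ℕ}

/-- The vectors supported on the vertices at distance less than `i` from `x`. -/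
def low (Γ : SimpleGraph X) (x : X) (i : ℕ) : Submodule ℂ (EuclideanSpace ℂ X) where
  carrier := {v | ∀ y, i ≤ Γ.dist x y → v y = 0}
  add_mem' := fun hu hv y hy => by
    rw [PiLp.add_apply, hu y hy, hv y hy, add_zero]
  zero_mem' := fun _ _ => rfl
  smul_mem' := fun r v hv y hy => by
    rw [PiLp.smul_apply, hv y hy, smul_zero]

theorem low_mono {i j : ℕ} (h : i ≤ j) : low Γ x i ≤ low Γ x j :=
  fun _ hv y hy => hv y (h.trans hy)

theorem low_zero : low Γ x 0 = ⊥ :=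
  (Submodule.eq_bot_iff _).2 fun v hv => by ext y; exact hv y (Nat.zero_le _)

theorem adjOp_mem_low (hΓ : Γ.Connected) {i : ℕ} {v : EuclideanSpace ℂ X} (hv : v ∈ low Γ x i) :
    adjOp Γ v ∈ low Γ x (i + 1) := by
  classical
  intro y hy
  rw [adjOp_apply]
  refine Finset.sum_eq_zero fun z _ => ?_
  split_ifs with h
  · exact hv z (by have := dist_le_dist_add_one hΓ x h; omega)
  · rfl

theorem adjOp_sub_mem_low (hΓ : Γ.Connected) {i : ℕ} {v : EuclideanSpace ℂ X}
    (hv : v ∈ low Γ x (i + 1)) : adjOp Γ v - raiseOp Γ x v - flatOp Γ x v ∈ low Γ x i := by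
  classical
  intro y hy
  rw [PiLp.sub_apply, PiLp.sub_apply, adjOp_apply, raiseOp_apply, flatOp_apply,
    ← Finset.sum_sub_distrib, ← Finset.sum_sub_distrib]
  refine Finset.sum_eq_zero fun z _ => ?_
  by_cases hyz : Γ.Adj y z
  · have h1 := dist_le_dist_add_one hΓ x hyz
    rcases Nat.lt_trichotomy (Γ.dist x y) (Γ.dist x z) with h | h | h
    · rw [hv z (by omega)]
      simp
    · rw [if_pos hyz, if_neg (fun e => by omega), if_pos ⟨hyz, h⟩]
      simp
    · rw [if_pos hyz, if_pos ⟨hyz, by omega⟩, if_neg (fun e => by omega)]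
      simp
  · simp [hyz]

theorem levelProj_mem_low {i j : ℕ} (h : i < j) (v : EuclideanSpace ℂ X) :
    levelProj Γ x i v ∈ low Γ x j := by
  classical
  intro y hy
  rw [levelProj_apply, if_neg (by omega)]

theorem levelProj_levelProj (i : ℕ) (v : EuclideanSpace ℂ X) :
    levelProj Γ x i (levelProj Γ x i v) = levelProj Γ x i v := by
  classical
  ext y
  rw [levelProj_apply, levelProj_apply]
  split_ifs <;> rfl

theorem levelProj_eq_zero_of_mem_low {i : ℕ} {v : EuclideanSpace ℂ X} (hv : v ∈ low Γ x i) :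
    levelProj Γ x i v = 0 := by
  classical
  ext y
  rw [levelProj_apply]
  split_ifs with h
  · exact hv y h.ge
  · rfl

theorem mem_low_of_levelProj_eq_zero {i : ℕ} {v : EuclideanSpace ℂ X} (hv : v ∈ low Γ x (i + 1))
    (h0 : levelProj Γ x i v = 0) : v ∈ low Γ x i := by
  classical
  intro y hy
  rcases hy.lt_or_eq with h | h
  · exact hv y h
  · have := congrArg (fun w : EuclideanSpace ℂ X => w y) h0
    simp only [levelProj_apply, if_pos h.symm, PiLp.zero_apply] at this
    exact this

theorem levelProj_raiseOp {i : ℕ} {v : EuclideanSpace ℂ X} (hv : levelProj Γ x i v = v) :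
    levelProj Γ x (i + 1) (raiseOp Γ x v) = raiseOp Γ x v := by
  classical
  ext y
  rw [levelProj_apply]
  split_ifs with hy
  · rfl
  · symm
    rw [raiseOp_apply]
    refine Finset.sum_eq_zero fun z _ => ?_
    split_ifs with h
    · rw [← hv, levelProj_apply, if_neg (by omega)]
    · rfl

/-- The operator multiplying the value at each vertex by a function of its distance to `x`. -/
noncomputable def levelOp (Γ : SimpleGraph X) (x : X) (g : ℕ → ℂ) :
    EuclideanSpace ℂ X →ₗ[ℂ] EuclideanSpace ℂ X where
  toFun v := WithLp.toLp 2 fun y => g (Γ.dist x y) * v y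
  map_add' u v := by ext y; exact mul_add _ _ _
  map_smul' r v := by ext y; exact mul_left_comm _ _ _

theorem levelOp_apply (g : ℕ → ℂ) (v : EuclideanSpace ℂ X) (y : X) :
    levelOp Γ x g v y = g (Γ.dist x y) * v y := rfl

theorem levelOp_mem (hD : ∀ y, Γ.dist x y ≤ D) (g : ℕ → ℂ) {W : Submodule ℂ (EuclideanSpace ℂ X)}
    (hW : ∀ i, ∀ w ∈ W, levelProj Γ x i w ∈ W) {w : EuclideanSpace ℂ X} (hw : w ∈ W) :
    levelOp Γ x g w ∈ W := by
  classical
  have h : levelOp Γ x g w = ∑ i ∈ Finset.range (D + 1), g i • levelProj Γ x i w := by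
    rw [← sum_levelProj hD (levelOp Γ x g w)]
    refine Finset.sum_congr rfl fun i _ => ?_
    ext y
    rw [levelProj_apply, PiLp.smul_apply, levelProj_apply, levelOp_apply]
    split_ifs with hy
    · rw [hy, smul_eq_mul]
    · rw [smul_zero]
  rw [h]
  exact W.sum_mem fun i _ => W.smul_mem _ (hW i w hw)

/-- An operator with distinct values on the levels has the level projections as polynomials in it,
by Lagrange interpolation. -/
theorem levelProj_mem_of_levelOp_mem (hD : ∀ y, Γ.dist x y ≤ D) {g : ℕ → ℂ}
    (hg : Set.InjOn g (Finset.range (D + 1))) {W : Submodule ℂ (EuclideanSpace ℂ X)}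
    (hW : ∀ w ∈ W, levelOp Γ x g w ∈ W) (i : ℕ) {w : EuclideanSpace ℂ X} (hw : w ∈ W) :
    levelProj Γ x i w ∈ W := by
  classical
  by_cases hi : i ∈ Finset.range (D + 1)
  · have key : ∀ (p : Polynomial ℂ), ∀ w ∈ W, levelOp Γ x (fun i => p.eval (g i)) w ∈ W := by
      intro p
      induction p using Polynomial.induction_on' with
      | add p r hp hr =>
        intro w hw
        have : levelOp Γ x (fun i => (p + r).eval (g i)) w =
            levelOp Γ x (fun i => p.eval (g i)) w + levelOp Γ x (fun i => r.eval (g i)) w := by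
          ext y
          simp only [levelOp_apply, PiLp.add_apply, Polynomial.eval_add, add_mul]
        rw [this]
        exact W.add_mem (hp w hw) (hr w hw)
      | monomial n r =>
        intro w hw
        induction n generalizing w with
        | zero =>
          have : levelOp Γ x (fun i => (Polynomial.monomial 0 r).eval (g i)) w = r • w := by
            ext y
            simp [levelOp_apply]
          rw [this]
          exact W.smul_mem r hw
        | succ n ih =>
          have : levelOp Γ x (fun i => (Polynomial.monomial (n + 1) r).eval (g i)) w =
              levelOp Γ x (fun i => (Polynomial.monomial n r).eval (g i)) (levelOp Γ x g w) := by
            ext y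
            simp only [levelOp_apply, Polynomial.eval_monomial]
            ring
          rw [this]
          exact ih _ (hW w hw)
    have h1 := key (Lagrange.basis (Finset.range (D + 1)) g i) w hw
    convert h1 using 1
    ext y
    rw [levelProj_apply, levelOp_apply]
    have hy : Γ.dist x y ∈ Finset.range (D + 1) := Finset.mem_range.2 (Nat.lt_succ_of_le (hD y))
    split_ifs with h
    · rw [h, Lagrange.eval_basis_self hg hi, one_mul]
    · rw [Lagrange.eval_basis_of_ne (Ne.symm h) hy, zero_mul]
  · have : levelProj Γ x i w = 0 := by
      ext y
      rw [levelProj_apply, if_neg]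
      · rfl
      · intro e
        exact hi (Finset.mem_range.2 (Nat.lt_succ_of_le (e ▸ hD y)))
    rw [this]
    exact W.zero_mem

end Nucleus

/-! ### Endpoints of irreducible modules. -/

namespace Nucleus

variable {X : Type*} [Fintype X] [DecidableEq X]

variable {Γ : SimpleGraph X} {x : X} {D : ℕ} {a b c : ℕ → ℕ} {θ : ℕ → ℝ}
  {W : Submodule ℂ (EuclideanSpace ℂ X)}

theorem mem_support_iff {i : ℕ} :
    i ∈ support Γ D x W ↔ i ≤ D ∧ ∃ w ∈ W, levelProj Γ x i w ≠ 0 := by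
  refine and_congr_right fun _ => ?_
  rw [Submodule.ne_bot_iff]
  constructor
  · rintro ⟨_, ⟨w, hw, rfl⟩, h⟩
    exact ⟨w, hw, h⟩
  · rintro ⟨w, hw, h⟩
    exact ⟨_, ⟨w, hw, rfl⟩, h⟩

theorem adjOp_mem_orthogonal (hW : ∀ w ∈ W, adjOp Γ w ∈ W) {v : EuclideanSpace ℂ X}
    (hv : v ∈ Wᗮ) : adjOp Γ v ∈ Wᗮ := by
  rw [mem_orthogonal] at hv ⊢
  exact fun w hw => by rw [← inner_adjOp_left]; exact hv _ (hW w hw)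

/-- A θ_i-eigenvector splits along `W` and `Wᗮ`, both invariant under A, into parts that are again
killed by A - θ_i. If `W` has no eigenvector, every eigenvector is therefore orthogonal to `W` and
the projection kills `W`. -/
theorem mem_dualSupport_iff (hW : ∀ w ∈ W, adjOp Γ w ∈ W) {i : ℕ} :
    i ∈ dualSupport Γ D θ W ↔ i ≤ D ∧ ∃ u ∈ W, u ≠ 0 ∧ adjOp Γ u = (θ i : ℂ) • u := by
  refine and_congr_right fun _ => ?_
  rw [Submodule.ne_bot_iff]
  constructor
  · rintro ⟨_, ⟨w, hw, rfl⟩, h⟩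
    by_contra! hno
    refine h ?_
    change (End.eigenspace (adjOp Γ) (θ i : ℂ)).starProjection w = 0
    rw [starProjection_apply_eq_zero_iff, mem_orthogonal]
    intro u hu
    rw [End.mem_eigenspace_iff] at hu
    obtain ⟨p, hp, p', hp', rfl⟩ := W.exists_add_mem_mem_orthogonal u
    have h1 : adjOp Γ p - (θ i : ℂ) • p = (θ i : ℂ) • p' - adjOp Γ p' := by
      rw [map_add, smul_add] at hu
      rw [sub_eq_sub_iff_add_eq_add, hu, add_comm]
    have h2 : adjOp Γ p - (θ i : ℂ) • p ∈ W ⊓ Wᗮ := by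
      refine ⟨W.sub_mem (hW p hp) (W.smul_mem _ hp), ?_⟩
      rw [h1]
      exact Wᗮ.sub_mem (Wᗮ.smul_mem _ hp') (adjOp_mem_orthogonal hW hp')
    rw [inf_orthogonal_eq_bot, mem_bot] at h2
    have h3 : p = 0 := by
      by_contra hp0
      exact hno p hp hp0 (sub_eq_zero.1 h2)
    rw [h3, zero_add]
    exact inner_left_of_mem_orthogonal hw hp'
  · rintro ⟨u, hu, hu0, h⟩
    refine ⟨_, ⟨u, hu, rfl⟩, ?_⟩
    change (End.eigenspace (adjOp Γ) (θ i : ℂ)).starProjection u ≠ 0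
    rw [starProjection_eq_self_iff.2 (End.mem_eigenspace_iff.2 h)]
    exact hu0

/-- The range of levels and the first eigenvalue that occur in a module. -/
structure HasEndpoints (Γ : SimpleGraph X) (D : ℕ) (θ : ℕ → ℝ) (x : X)
    (W : Submodule ℂ (EuclideanSpace ℂ X)) (r m t : ℕ) : Prop where
  le : r ≤ m
  le_diam : m ≤ D
  dual_le_diam : t ≤ D
  le_low : W ≤ low Γ x (m + 1)
  inf_low : W ⊓ low Γ x r = ⊥
  exists_first : ∃ w ∈ W, levelProj Γ x r w ≠ 0
  exists_last : ∃ w ∈ W, levelProj Γ x m w ≠ 0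
  exists_eigenvector : ∃ u ∈ W, u ≠ 0 ∧ adjOp Γ u = (θ t : ℂ) • u
  eigenvector_eq_zero : ∀ i < t, ∀ u ∈ W, adjOp Γ u = (θ i : ℂ) • u → u = 0
  -- The occupied levels form the interval from r to m, so d = m - r and r cancels from r + t - D +
  -- d.
  displacement_eq : displacement Γ D θ x W = (t : ℤ) + m - D

theorem exists_levelProj_ne_zero (hD : ∀ y, Γ.dist x y ≤ D) (hW : W ≠ ⊥) :
    ∃ i ≤ D, ∃ w ∈ W, levelProj Γ x i w ≠ 0 := by
  obtain ⟨w, hw, hw0⟩ := (Submodule.ne_bot_iff _).1 hW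
  by_contra! h
  refine hw0 ?_
  rw [← sum_levelProj hD w]
  exact Finset.sum_eq_zero fun i hi => h i (Nat.lt_succ_iff.1 (Finset.mem_range.1 hi)) w hw

/-- The levels occurring in an irreducible module form an interval. -/
theorem IsDistReg.exists_levelProj_ne_zero_of_mem_Icc (h : IsDistReg Γ D a b c) (hD : 1 ≤ D)
    (hW : IsIrredTModule Γ D x W) {r i m : ℕ} (hri : r ≤ i) (him : i ≤ m)
    (hr : ∃ w ∈ W, levelProj Γ x r w ≠ 0) (hm : ∃ w ∈ W, levelProj Γ x m w ≠ 0) :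
    ∃ w ∈ W, levelProj Γ x i w ≠ 0 := by
  classical
  by_contra! hi
  obtain ⟨hA, hE⟩ := (h.isTModule_iff hD).1 hW.1
  obtain ⟨w, hw, hw0⟩ := hr
  have hri' : r < i := lt_of_le_of_ne hri fun e => hw0 (by rw [e]; exact hi w hw)
  -- A changes the level by at most one, so with level `i` unoccupied it cannot carry vectors
  -- across; the part of `W` below level `i` would be a nonzero proper submodule.
  have hT : IsTModule Γ D x (W ⊓ low Γ x i) := by
    refine (h.isTModule_iff hD).2 ⟨fun v hv => ⟨hA v hv.1, ?_⟩, fun j v hv => ⟨hE j v hv.1, ?_⟩⟩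
    · exact mem_low_of_levelProj_eq_zero (adjOp_mem_low h.connected hv.2) (hi _ (hA v hv.1))
    · intro y hy
      rw [levelProj_apply, hv.2 y hy, ite_self]
  rcases hW.2.2 _ hT inf_le_left with h1 | h1
  · have h2 : levelProj Γ x r w ∈ W ⊓ low Γ x i := ⟨hE r w hw, levelProj_mem_low hri' w⟩
    rw [h1] at h2
    exact hw0 ((mem_bot ℂ).1 h2)
  · obtain ⟨u, hu, hu0⟩ := hm
    refine hu0 (levelProj_eq_zero_of_mem_low (low_mono him ?_))
    rw [← h1] at hu
    exact hu.2

theorem IsDistReg.exists_hasEndpoints (h : IsDistReg Γ D a b c) (hD : 1 ≤ D)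
    (hW : IsIrredTModule Γ D x W) {G : ℕ → Submodule ℂ (EuclideanSpace ℂ X)} (h0 : G 0 = ⊥)
    (htop : G (D + 1) = ⊤) (hG : ∀ j, ∀ v ∈ G (j + 1), adjOp Γ v - (θ j : ℂ) • v ∈ G j) :
    ∃ r m t, HasEndpoints Γ D θ x W r m t := by
  classical
  obtain ⟨hA, hE⟩ := (h.isTModule_iff hD).1 hW.1
  have hex := exists_levelProj_ne_zero (h.dist_le x) hW.2.1
  have hex' : ∃ i, ∃ w ∈ W, levelProj Γ x i w ≠ 0 := hex.imp fun _ hi => hi.2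
  set r := Nat.find hex'
  have hr : ∃ w ∈ W, levelProj Γ x r w ≠ 0 := Nat.find_spec hex'
  set m := Nat.findGreatest (fun i => ∃ w ∈ W, levelProj Γ x i w ≠ 0) D
  have hm : ∃ w ∈ W, levelProj Γ x m w ≠ 0 := by
    obtain ⟨i, hi, hi'⟩ := hex
    exact Nat.findGreatest_spec (P := fun i => ∃ w ∈ W, levelProj Γ x i w ≠ 0) hi hi'
  have hmD : m ≤ D := Nat.findGreatest_le D
  have hlt : ∀ i, i < r → ∀ w ∈ W, levelProj Γ x i w = 0 := by
    intro i hi w hw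
    by_contra hne
    exact Nat.find_min hex' hi ⟨w, hw, hne⟩
  have hgt : ∀ i, m < i → ∀ w ∈ W, levelProj Γ x i w = 0 := by
    intro i hi w hw
    by_cases hiD : i ≤ D
    · by_contra hne
      exact Nat.findGreatest_is_greatest hi hiD ⟨w, hw, hne⟩
    · ext y
      rw [levelProj_apply, if_neg]
      · rfl
      · have := h.dist_le x y
        omega
  have hrm : r ≤ m := by
    by_contra hcon
    obtain ⟨w, hw, hne⟩ := hm
    exact hne (hlt m (by omega) w hw)
  have hsupp : support Γ D x W = Set.Icc r m := by
    ext i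
    rw [mem_support_iff, Set.mem_Icc]
    constructor
    · rintro ⟨-, w, hw, hne⟩
      constructor
      · by_contra hcon
        exact hne (hlt i (by omega) w hw)
      · by_contra hcon
        exact hne (hgt i (by omega) w hw)
    · rintro ⟨h1, h2⟩
      exact ⟨h2.trans hmD, h.exists_levelProj_ne_zero_of_mem_Icc hD hW h1 h2 hr hm⟩
  have hdual : (dualSupport Γ D θ W).Nonempty := by
    obtain ⟨w, hw, hw0⟩ := (Submodule.ne_bot_iff _).1 hW.2.1
    obtain ⟨i, hi, hu⟩ := exists_eigenvector_of_mem_flag (θ := fun j => (θ j : ℂ)) h0 hG hA (D + 1)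
      (htop ▸ mem_top) hw hw0
    exact ⟨i, (mem_dualSupport_iff hA).2 ⟨Nat.lt_succ_iff.1 hi, hu⟩⟩
  have ht := (mem_dualSupport_iff hA).1 (Nat.sInf_mem hdual)
  refine ⟨r, m, dualEndpoint Γ D θ W,
    { le := hrm
      le_diam := hmD
      dual_le_diam := ht.1
      le_low := ?_
      inf_low := ?_
      exists_first := hr
      exists_last := hm
      exists_eigenvector := ht.2
      eigenvector_eq_zero := ?_
      displacement_eq := ?_ }⟩
  · intro w hw y hy
    have := congrArg (fun v : EuclideanSpace ℂ X => v y) (hgt (Γ.dist x y) hy w hw)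
    simpa only [levelProj_apply, if_true, PiLp.zero_apply] using this
  · refine (Submodule.eq_bot_iff _).2 fun w hw => ?_
    ext y
    by_cases hy : r ≤ Γ.dist x y
    · exact hw.2 y hy
    · have := congrArg (fun v : EuclideanSpace ℂ X => v y) (hlt (Γ.dist x y) (by omega) w hw.1)
      simpa only [levelProj_apply, if_true, PiLp.zero_apply] using this
  · intro i hi u hu hAu
    by_contra hu0
    exact Nat.notMem_of_lt_sInf hi
      ((mem_dualSupport_iff hA).2 ⟨hi.le.trans ht.1, u, hu, hu0, hAu⟩)
  · have h1 : endpoint Γ D x W = r := by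
      rw [endpoint, hsupp]
      exact (isLeast_Icc hrm).csInf_eq
    have h2 : diameter Γ D x W = (m : ℤ) - r := by
      rw [diameter, hsupp, ← Finset.coe_Icc, Set.ncard_coe_finset, Nat.card_Icc]
      omega
    rw [displacement, h1, h2]
    ring

theorem levelProj_mem_orthogonal (hW : ∀ i, ∀ w ∈ W, levelProj Γ x i w ∈ W) (i : ℕ)
    {v : EuclideanSpace ℂ X} (hv : v ∈ Wᗮ) : levelProj Γ x i v ∈ Wᗮ := by
  rw [mem_orthogonal] at hv ⊢
  exact fun w hw => by rw [← inner_levelProj_left]; exact hv _ (hW i w hw)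

/-- Every module is spanned by its irreducible submodules. -/
theorem IsDistReg.le_sSup_irred (h : IsDistReg Γ D a b c) (hD : 1 ≤ D) (hW : IsTModule Γ D x W) :
    W ≤ sSup {M | IsIrredTModule Γ D x M ∧ M ≤ W} := by
  induction hn : finrank ℂ W using Nat.strong_induction_on generalizing W with
  | _ n ih =>
    by_cases hbot : W = ⊥
    · rw [hbot]
      exact bot_le
    by_cases hirr : ∀ M, IsTModule Γ D x M → M ≤ W → M = ⊥ ∨ M = W
    · exact le_sSup ⟨⟨hW, hbot, hirr⟩, le_rfl⟩
    push Not at hirr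
    obtain ⟨M, hM, hMW, hM0, hM1⟩ := hirr
    have hMlt : M < W := lt_of_le_of_ne hMW hM1
    have hN : IsTModule Γ D x (Mᗮ ⊓ W) := by
      rw [h.isTModule_iff hD] at hW hM ⊢
      exact ⟨fun w hw => ⟨adjOp_mem_orthogonal hM.1 hw.1, hW.1 w hw.2⟩,
        fun i w hw => ⟨levelProj_mem_orthogonal hM.2 i hw.1, hW.2 i w hw.2⟩⟩
    have hNlt : Mᗮ ⊓ W < W := by
      refine lt_of_le_of_ne inf_le_right fun e => hM0 ?_
      have h1 : M ≤ Mᗮ := hMW.trans (inf_eq_right.1 e)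
      rw [eq_bot_iff, ← inf_orthogonal_eq_bot M]
      exact le_inf le_rfl h1
    have h1 := ih _ (hn ▸ finrank_lt_finrank_of_lt hMlt) hM rfl
    have h2 := ih _ (hn ▸ finrank_lt_finrank_of_lt hNlt) hN rfl
    have h3 : W = M ⊔ Mᗮ ⊓ W := (sup_orthogonal_inf_of_hasOrthogonalProjection hMW).symm
    conv_lhs => rw [h3]
    exact sup_le (h1.trans (sSup_le_sSup fun _ hK => ⟨hK.1, hK.2.trans hMW⟩))
      (h2.trans (sSup_le_sSup fun _ hK => ⟨hK.1, hK.2.trans inf_le_right⟩))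

end Nucleus

/-! ### Two opposite flags in a module of displacement zero. -/

namespace Nucleus

variable {X : Type*} [Fintype X] [DecidableEq X]

/-- A flag on which the adjacency operator acts triangularly and the multiplication by
`q ^ (D - dist x y)` moves up by one step. -/
structure IsFlag (Γ : SimpleGraph X) (x : X) (D q : ℕ) (θ : ℕ → ℝ)
    (G : ℕ → Submodule ℂ (EuclideanSpace ℂ X)) : Prop where
  zero : G 0 = ⊥
  top : G (D + 1) = ⊤
  mono : Monotone G
  adj : ∀ j, ∀ v ∈ G (j + 1), adjOp Γ v - (θ j : ℂ) • v ∈ G j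
  weight : ∀ j, ∀ v ∈ G j, levelOp Γ x (fun i => (q : ℂ) ^ (D - i)) v ∈ G (j + 1)

/-- The sum of the intersections of the members of the two flags with indices summing to `n`. -/
def antidiag (Γ : SimpleGraph X) (x : X) (G : ℕ → Submodule ℂ (EuclideanSpace ℂ X))
    (W : Submodule ℂ (EuclideanSpace ℂ X)) (n : ℕ) : Submodule ℂ (EuclideanSpace ℂ X) :=
  ⨆ (p : ℕ × ℕ) (_ : p.1 + p.2 = n), W ⊓ low Γ x p.1 ⊓ G p.2

variable {Γ : SimpleGraph X} {x : X} {D q : ℕ} {a b c : ℕ → ℕ} {θ : ℕ → ℝ}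
  {W : Submodule ℂ (EuclideanSpace ℂ X)} {G : ℕ → Submodule ℂ (EuclideanSpace ℂ X)}

theorem le_antidiag {i j n : ℕ} (h : i + j = n) : W ⊓ low Γ x i ⊓ G j ≤ antidiag Γ x G W n :=
  le_iSup₂_of_le (i, j) h le_rfl

theorem antidiag_le {n : ℕ} {M : Submodule ℂ (EuclideanSpace ℂ X)}
    (h : ∀ i j, i + j = n → W ⊓ low Γ x i ⊓ G j ≤ M) : antidiag Γ x G W n ≤ M :=
  iSup₂_le fun p hp => h p.1 p.2 hp

theorem weight_injOn (hq : 2 ≤ q) :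
    Set.InjOn (fun i => (q : ℂ) ^ (D - i)) (Finset.range (D + 1)) := by
  intro i hi j hj hij
  rw [Finset.mem_coe, Finset.mem_range] at hi hj
  have h1 : q ^ (D - i) = q ^ (D - j) := by
    simp only at hij
    exact_mod_cast hij
  have := Nat.pow_right_injective hq h1
  omega

theorem levelOp_sub_mem_low {g : ℕ → ℂ} {i : ℕ} {v : EuclideanSpace ℂ X}
    (hv : v ∈ low Γ x (i + 1)) : levelOp Γ x g v - g i • v ∈ low Γ x i := by
  intro y hy
  rw [PiLp.sub_apply, levelOp_apply, PiLp.smul_apply, smul_eq_mul, ← sub_mul]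
  rcases hy.lt_or_eq with h | h
  · rw [hv y h, mul_zero]
  · rw [← h, sub_self, zero_mul]

/-- A - θ takes the summand at (i, j) to the one at (i + 1, j - 1), and the weight operator minus
its value on the outermost level takes it to (i - 1, j + 1); both preserve the sum of indices. The
level projections are polynomials in the weight operator. -/
theorem IsFlag.isTModule_antidiag (hG : IsFlag Γ x D q θ G) (h : IsDistReg Γ D a b c) (hD : 1 ≤ D)
    (hq : 2 ≤ q) (hW : IsTModule Γ D x W) (n : ℕ) : IsTModule Γ D x (antidiag Γ x G W n) := by
  rw [h.isTModule_iff hD] at hW ⊢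
  obtain ⟨hA, hE⟩ := hW
  constructor
  · suffices antidiag Γ x G W n ≤ (antidiag Γ x G W n).comap (adjOp Γ) from this
    refine antidiag_le fun i j hij w hw => ?_
    cases j with
    | zero =>
      rw [hG.zero, inf_bot_eq, mem_bot] at hw
      rw [hw]
      exact zero_mem _
    | succ j =>
      have h1 : adjOp Γ w - (θ j : ℂ) • w ∈ W ⊓ low Γ x (i + 1) ⊓ G j :=
        ⟨⟨W.sub_mem (hA w hw.1.1) (W.smul_mem _ hw.1.1),
          (low Γ x (i + 1)).sub_mem (adjOp_mem_low h.connected hw.1.2)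
            ((low Γ x (i + 1)).smul_mem _ (low_mono (Nat.le_succ i) hw.1.2))⟩, hG.adj j w hw.2⟩
      have h2 := add_mem (le_antidiag (n := n) (by omega) h1)
        (smul_mem _ (θ j : ℂ) (le_antidiag hij hw))
      rwa [sub_add_cancel] at h2
  · intro k w hw
    refine levelProj_mem_of_levelOp_mem (h.dist_le x) (weight_injOn hq) ?_ k hw
    suffices antidiag Γ x G W n ≤
      (antidiag Γ x G W n).comap (levelOp Γ x fun i => (q : ℂ) ^ (D - i)) from this
    refine antidiag_le fun i j hij w hw => ?_
    cases i with
    | zero =>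
      rw [low_zero, inf_bot_eq, bot_inf_eq, mem_bot] at hw
      rw [hw]
      exact zero_mem _
    | succ i =>
      set g : ℕ → ℂ := fun i => (q : ℂ) ^ (D - i)
      have h1 : levelOp Γ x g w - g i • w ∈ W ⊓ low Γ x i ⊓ G (j + 1) :=
        ⟨⟨W.sub_mem (levelOp_mem (h.dist_le x) g hE hw.1.1) (W.smul_mem _ hw.1.1),
          levelOp_sub_mem_low hw.1.2⟩,
          sub_mem (hG.weight j w hw.2) (smul_mem _ _ (hG.mono (Nat.le_succ j) hw.2))⟩
      have h2 := add_mem (le_antidiag (n := n) (by omega) h1)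
        (smul_mem _ (g i) (le_antidiag hij hw))
      rwa [sub_add_cancel] at h2

theorem IsFlag.inf_eq_bot (hG : IsFlag Γ x D q θ G) {r m t : ℕ}
    (hend : HasEndpoints Γ D θ x W r m t) (hA : ∀ w ∈ W, adjOp Γ w ∈ W) : W ⊓ G t = ⊥ := by
  refine (Submodule.eq_bot_iff _).2 fun w hw => ?_
  by_contra hw0
  obtain ⟨i, hi, u, hu, hu0, hAu⟩ := exists_eigenvector_of_mem_flag (θ := fun j => (θ j : ℂ))
    hG.zero hG.adj hA t hw.2 hw.1 hw0
  exact hu0 (hend.eigenvector_eq_zero i hi u hu hAu)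

/-- In an irreducible module of displacement zero the two flags are opposite. -/
theorem IsFlag.inf_low_inf_eq_bot (hG : IsFlag Γ x D q θ G) (h : IsDistReg Γ D a b c) (hD : 1 ≤ D)
    (hq : 2 ≤ q) (hW : IsIrredTModule Γ D x W) {r m t : ℕ}
    (hend : HasEndpoints Γ D θ x W r m t) (hmt : m + t = D) {i j : ℕ} (hij : i + j = D + 1) :
    W ⊓ low Γ x i ⊓ G j = ⊥ := by
  have hA := ((h.isTModule_iff hD).1 hW.1).1
  have hle : antidiag Γ x G W (D + 1) ≤ W :=
    antidiag_le fun i j _ => inf_le_left.trans inf_le_left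
  rcases hW.2.2 _ (hG.isTModule_antidiag h hD hq hW.1 (D + 1)) hle with h1 | h1
  · exact eq_bot_iff.2 (h1 ▸ le_antidiag hij)
  · exfalso
    -- If the antidiagonal sum were all of `W`, the last level would be empty: summands with `i ≤ m`
    -- lie in `low Γ x m`, and the others have `j ≤ t`, where `W ⊓ G t = ⊥`.
    have h2 : W ≤ low Γ x m := by
      rw [← h1]
      refine antidiag_le fun i j hij => ?_
      by_cases hi : i ≤ m
      · exact inf_le_left.trans (inf_le_right.trans (low_mono hi))
      · have h3 : W ⊓ low Γ x i ⊓ G j ≤ W ⊓ G t :=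
          inf_le_inf inf_le_left (hG.mono (by omega))
        rw [hG.inf_eq_bot hend hA] at h3
        exact h3.trans bot_le
    obtain ⟨w, hw, hw0⟩ := hend.exists_last
    exact hw0 (levelProj_eq_zero_of_mem_low (h2 hw))

/-- The eigenvector for θ_t lies in the summand at (m + 1, t + 1) of the antidiagonal D + 2, which
is therefore all of `W`. Its summands with `i ≤ r` vanish, and the others have `j ≤ D + 1 - r`. -/
theorem IsFlag.le_of_endpoints (hG : IsFlag Γ x D q θ G) (h : IsDistReg Γ D a b c) (hD : 1 ≤ D)
    (hq : 2 ≤ q) (hθ : ∀ i j, i < j → j ≤ D → θ i ≠ θ j) (hW : IsIrredTModule Γ D x W) {r m t : ℕ}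
    (hend : HasEndpoints Γ D θ x W r m t) (hmt : m + t = D) : W ≤ G (D + 1 - r) := by
  have hle : antidiag Γ x G W (D + 2) ≤ W :=
    antidiag_le fun i j _ => inf_le_left.trans inf_le_left
  obtain ⟨u, hu, hu0, hAu⟩ := hend.exists_eigenvector
  have hu1 : u ∈ W ⊓ low Γ x (m + 1) ⊓ G (t + 1) :=
    ⟨⟨hu, hend.le_low hu⟩, mem_flag_of_eigenvector (θ := fun j => (θ j : ℂ)) hG.adj
      hend.dual_le_diam (fun i j hij hj e => hθ i j hij hj (Complex.ofReal_injective e))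
      (hG.top ▸ mem_top) hAu⟩
  have hu2 : u ∈ antidiag Γ x G W (D + 2) := le_antidiag (by omega) hu1
  rcases hW.2.2 _ (hG.isTModule_antidiag h hD hq hW.1 (D + 2)) hle with h1 | h1
  · rw [h1] at hu2
    exact absurd ((mem_bot ℂ).1 hu2) hu0
  · rw [← h1]
    refine antidiag_le fun i j hij => ?_
    by_cases hi : i ≤ r
    · have h3 : W ⊓ low Γ x i ⊓ G j ≤ W ⊓ low Γ x r :=
        inf_le_left.trans (inf_le_inf le_rfl (low_mono hi))
      rw [hend.inf_low] at h3
      exact h3.trans bot_le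
    · exact inf_le_right.trans (hG.mono (by omega))

/-- The image of a vector under a product of shifted adjacency operators. -/
noncomputable def shiftProd (Γ : SimpleGraph X) (φ : ℕ → ℂ) (v : EuclideanSpace ℂ X) :
    ℕ → EuclideanSpace ℂ X
  | 0 => v
  | n + 1 => adjOp Γ (shiftProd Γ φ v n) - φ n • shiftProd Γ φ v n

theorem shiftProd_mem {φ : ℕ → ℂ} {v : EuclideanSpace ℂ X} (hA : ∀ w ∈ W, adjOp Γ w ∈ W)
    (hv : v ∈ W) (n : ℕ) : shiftProd Γ φ v n ∈ W := by
  induction n with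
  | zero => exact hv
  | succ n ih => exact W.sub_mem (hA _ ih) (W.smul_mem _ ih)

/-- The shifts are the diagonal entries met while descending from G_(D+1-r), so each factor goes
down one step. -/
theorem IsFlag.shiftProd_mem_flag (hG : IsFlag Γ x D q θ G) {v : EuclideanSpace ℂ X} {r n : ℕ}
    (hv : v ∈ G (D + 1 - r)) (hn : r + n ≤ D + 1) :
    shiftProd Γ (fun i => (θ (D - r - i) : ℂ)) v n ∈ G (D + 1 - r - n) := by
  induction n with
  | zero => exact hv
  | succ n ih =>
    have h1 := ih (by omega)
    rw [show D + 1 - r - n = (D - r - n) + 1 by omega] at h1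
    have h2 := hG.adj _ _ h1
    rw [show D + 1 - r - (n + 1) = D - r - n by omega]
    exact h2

theorem shiftProd_sub_pow_mem {φ : ℕ → ℂ} (v : EuclideanSpace ℂ X) (n : ℕ) :
    shiftProd Γ φ v n - (adjOp Γ ^ n) v ∈ span ℂ {w | ∃ i < n, w = (adjOp Γ ^ i) v} := by
  set Z : ℕ → Submodule ℂ (EuclideanSpace ℂ X) :=
    fun n => span ℂ {w | ∃ i < n, w = (adjOp Γ ^ i) v}
  have hmono : ∀ n, Z n ≤ Z (n + 1) := fun n =>
    span_mono fun w ⟨i, hi, hw⟩ => ⟨i, hi.trans (Nat.lt_succ_self n), hw⟩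
  have hA : ∀ n, Z n ≤ (Z (n + 1)).comap (adjOp Γ) := by
    intro n
    refine span_le.2 ?_
    rintro _ ⟨i, hi, rfl⟩
    exact subset_span ⟨i + 1, by omega, by rw [pow_succ', Module.End.mul_apply]⟩
  induction n with
  | zero =>
    rw [pow_zero, Module.End.one_apply, shiftProd, sub_self]
    exact zero_mem _
  | succ n ih =>
    have h1 : shiftProd Γ φ v (n + 1) - (adjOp Γ ^ (n + 1)) v =
        adjOp Γ (shiftProd Γ φ v n - (adjOp Γ ^ n) v) -
          φ n • ((shiftProd Γ φ v n - (adjOp Γ ^ n) v) + (adjOp Γ ^ n) v) := by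
      rw [pow_succ', Module.End.mul_apply, map_sub, sub_add_cancel, shiftProd]
      abel
    rw [h1]
    exact sub_mem (hA n ih) (smul_mem _ _
      (add_mem (hmono n ih) (subset_span ⟨n, Nat.lt_succ_self n, rfl⟩)))

theorem levelProj_raiseOp_pow {r : ℕ} {v : EuclideanSpace ℂ X} (hv : levelProj Γ x r v = v)
    (n : ℕ) : levelProj Γ x (r + n) ((raiseOp Γ x ^ n) v) = (raiseOp Γ x ^ n) v := by
  induction n with
  | zero => exact hv
  | succ n ih =>
    rw [pow_succ', Module.End.mul_apply]
    exact levelProj_raiseOp ih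

/-- The two leading terms of a product of shifted adjacency operators. -/
theorem exists_shiftProd_eq (hΓ : Γ.Connected) {φ κ : ℕ → ℂ} {v : EuclideanSpace ℂ X} {r : ℕ}
    (hv : levelProj Γ x r v = v)
    (hκ : ∀ n, flatOp Γ x ((raiseOp Γ x ^ n) v) = κ n • (raiseOp Γ x ^ n) v) (n : ℕ) :
    ∃ w ∈ low Γ x (r + n), shiftProd Γ φ v (n + 1) = (raiseOp Γ x ^ (n + 1)) v +
      (∑ h ∈ Finset.range (n + 1), (κ h - φ h)) • (raiseOp Γ x ^ n) v + w := by
  have hlow : ∀ n, (raiseOp Γ x ^ n) v ∈ low Γ x (r + n + 1) := fun n => by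
    rw [← levelProj_raiseOp_pow hv n]
    exact levelProj_mem_low (Nat.lt_succ_self _) _
  -- On R^n v the operator A is R plus the scalar κ_n, up to lower levels.
  have hlowering : ∀ n, adjOp Γ ((raiseOp Γ x ^ n) v) - (raiseOp Γ x ^ (n + 1)) v -
      κ n • (raiseOp Γ x ^ n) v ∈ low Γ x (r + n) := fun n => by
    have := adjOp_sub_mem_low hΓ (hlow n)
    rwa [hκ, ← Module.End.mul_apply (raiseOp Γ x), ← pow_succ'] at this
  induction n with
  | zero =>
    refine ⟨_, hlowering 0, ?_⟩
    rw [Finset.sum_range_one, shiftProd, shiftProd, pow_zero, Module.End.one_apply, sub_smul]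
    abel
  | succ n ih =>
    obtain ⟨w, hw, he⟩ := ih
    set C := ∑ h ∈ Finset.range (n + 1), (κ h - φ h)
    refine ⟨(adjOp Γ ((raiseOp Γ x ^ (n + 1)) v) - (raiseOp Γ x ^ (n + 1 + 1)) v -
      κ (n + 1) • (raiseOp Γ x ^ (n + 1)) v) + C • (adjOp Γ ((raiseOp Γ x ^ n) v) -
        (raiseOp Γ x ^ (n + 1)) v - κ n • (raiseOp Γ x ^ n) v) +
        (C * (κ n - φ (n + 1))) • (raiseOp Γ x ^ n) v + (adjOp Γ w - φ (n + 1) • w), ?_, ?_⟩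
    · have h1 : low Γ x (r + n) ≤ low Γ x (r + (n + 1)) := low_mono (by omega)
      exact add_mem (add_mem (add_mem (hlowering (n + 1)) (smul_mem _ _ (h1 (hlowering n))))
        (smul_mem _ _ (hlow n))) (sub_mem (adjOp_mem_low hΓ hw) (smul_mem _ _ (h1 hw)))
    · rw [shiftProd, he, Finset.sum_range_succ]
      simp only [map_add, map_smul]
      module

end Nucleus

/-! ### The Laplacian vanishes on modules of displacement zero. -/

namespace Nucleus

variable {X : Type*} [Fintype X] [DecidableEq X]

variable {Γ : SimpleGraph X} {x : X} {D q : ℕ} {a b c : ℕ → ℕ} {θ : ℕ → ℝ}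
  {W : Submodule ℂ (EuclideanSpace ℂ X)} {G : ℕ → Submodule ℂ (EuclideanSpace ℂ X)}

theorem flatOp_mem (hD : ∀ y, Γ.dist x y ≤ D) (hA : ∀ w ∈ W, adjOp Γ w ∈ W)
    (hE : ∀ i, ∀ w ∈ W, levelProj Γ x i w ∈ W) {w : EuclideanSpace ℂ X} (hw : w ∈ W) :
    flatOp Γ x w ∈ W := by
  rw [flatOp_eq_sum hD]
  exact W.sum_mem fun i _ => hE i _ (hA _ (hE i w hw))

theorem raiseOp_mem (hD : ∀ y, Γ.dist x y ≤ D) (hA : ∀ w ∈ W, adjOp Γ w ∈ W)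
    (hE : ∀ i, ∀ w ∈ W, levelProj Γ x i w ∈ W) {w : EuclideanSpace ℂ X} (hw : w ∈ W) :
    raiseOp Γ x w ∈ W := by
  rw [raiseOp_eq_sum hD]
  exact W.sum_mem fun i _ => hE (i + 1) _ (hA _ (hE i w hw))

theorem laplacianOp_mem (hD : ∀ y, Γ.dist x y ≤ D) (hA : ∀ w ∈ W, adjOp Γ w ∈ W)
    (hE : ∀ i, ∀ w ∈ W, levelProj Γ x i w ∈ W) {w : EuclideanSpace ℂ X} (hw : w ∈ W) :
    laplacianOp Γ x q a w ∈ W := by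
  have h : laplacianOp Γ x q a w = levelOp Γ x (fun i => (q : ℂ)⁻¹ ^ i)
      (levelOp Γ x (fun i => (a i : ℂ)) w - flatOp Γ x w) := by
    ext y
    rw [laplacianOp_apply, levelOp_apply, PiLp.sub_apply, levelOp_apply]
  rw [h]
  exact levelOp_mem hD _ hE (W.sub_mem (levelOp_mem hD _ hE hw) (flatOp_mem hD hA hE hw))

/-- The Laplacian of the subconstituents acts as a scalar on every irreducible module. -/
theorem IsDistReg.exists_laplacianOp_eq_smul (h : IsDistReg Γ D a b c) (hD : 1 ≤ D)
    (hcomm : ∀ v, laplacianOp Γ x q a (adjOp Γ v) = adjOp Γ (laplacianOp Γ x q a v))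
    (hW : IsIrredTModule Γ D x W) : ∃ μ : ℂ, ∀ w ∈ W, laplacianOp Γ x q a w = μ • w := by
  obtain ⟨hA, hE⟩ := (h.isTModule_iff hD).1 hW.1
  have hinv : ∀ w ∈ W, laplacianOp Γ x q a w ∈ W := fun w hw =>
    laplacianOp_mem (h.dist_le x) hA hE hw
  have : Nontrivial W := Submodule.nontrivial_iff_ne_bot.2 hW.2.1
  obtain ⟨μ, hμ⟩ := Module.End.exists_eigenvalue ((laplacianOp Γ x q a).restrict hinv)
  obtain ⟨u, hu⟩ := hμ.exists_hasEigenvector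
  have hu1 : laplacianOp Γ x q a u = μ • (u : EuclideanSpace ℂ X) :=
    congrArg Subtype.val hu.apply_eq_smul
  -- Schur's argument: the Laplacian commutes with A and with the level projections, so its
  -- eigenspaces cut out submodules.
  have hT : IsTModule Γ D x (W ⊓ End.eigenspace (laplacianOp Γ x q a) μ) := by
    refine (h.isTModule_iff hD).2 ⟨fun w hw => ⟨hA w hw.1, ?_⟩, fun i w hw => ⟨hE i w hw.1, ?_⟩⟩
    · rw [SetLike.mem_coe, End.mem_eigenspace_iff, hcomm, End.mem_eigenspace_iff.1 hw.2, map_smul]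
    · rw [SetLike.mem_coe, End.mem_eigenspace_iff, laplacianOp_levelProj,
        End.mem_eigenspace_iff.1 hw.2, map_smul]
  refine ⟨μ, fun w hw => ?_⟩
  rcases hW.2.2 _ hT inf_le_left with h1 | h1
  · have h2 : (u : EuclideanSpace ℂ X) ∈ W ⊓ End.eigenspace (laplacianOp Γ x q a) μ :=
      ⟨u.2, End.mem_eigenspace_iff.2 hu1⟩
    rw [h1, mem_bot] at h2
    exact absurd (Subtype.ext h2) hu.2
  · rw [← h1] at hw
    exact End.mem_eigenspace_iff.1 hw.2

theorem flatOp_eq_of_laplacianOp (hq : q ≠ 0) {μ : ℂ} {i : ℕ} {v : EuclideanSpace ℂ X}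
    (hμ : laplacianOp Γ x q a v = μ • v) (hv : levelProj Γ x i v = v) :
    flatOp Γ x v = ((a i : ℂ) - q ^ i * μ) • v := by
  classical
  have hq' : (q : ℂ) ≠ 0 := Nat.cast_ne_zero.2 hq
  ext y
  rw [PiLp.smul_apply, smul_eq_mul]
  by_cases hy : Γ.dist x y = i
  · have := congrArg (fun w : EuclideanSpace ℂ X => w y) hμ
    simp only [laplacianOp_apply, PiLp.smul_apply, smul_eq_mul, hy] at this
    have h2 : (a i : ℂ) * v y - flatOp Γ x v y = q ^ i * (μ * v y) := by
      rw [← this, inv_pow, mul_inv_cancel_left₀ (pow_ne_zero _ hq')]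
    linear_combination -h2
  · have h1 : ∀ w : EuclideanSpace ℂ X, levelProj Γ x i w y = 0 := fun w => by
      rw [levelProj_apply, if_neg hy]
    rw [← hv, flatOp_levelProj, h1, h1, mul_zero]

/-- Two vertices at distance r from x are at distance at most 2r from each other. -/
theorem inner_distMatrix_eq_zero (hΓ : Γ.Connected) {r i : ℕ} (hi : 2 * r < i)
    {v : EuclideanSpace ℂ X} (hv : levelProj Γ x r v = v) :
    inner ℂ v (Matrix.toEuclideanLin (distMatrix Γ i) v) = 0 := by
  classical
  have h0 : ∀ y, Γ.dist x y ≠ r → v y = 0 := fun y hy => by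
    rw [← hv, levelProj_apply, if_neg hy]
  rw [PiLp.inner_apply]
  refine Finset.sum_eq_zero fun y _ => ?_
  by_cases hy : Γ.dist x y = r
  · have : Matrix.toEuclideanLin (distMatrix Γ i) v y = 0 := by
      rw [toEuclideanLin_apply_apply]
      refine Finset.sum_eq_zero fun z _ => ?_
      by_cases hz : Γ.dist x z = r
      · have h1 := hΓ.dist_triangle (u := y) (v := x) (w := z)
        rw [SimpleGraph.dist_comm (u := y) (v := x)] at h1
        rw [distMatrix, Matrix.of_apply, if_neg (by omega), zero_mul]
      · rw [h0 z hz, mul_zero]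
    rw [this, inner_zero_right]
  · rw [h0 y hy, inner_zero_left]

theorem IsDistReg.adjOp_pow_distMatrix_comm (h : IsDistReg Γ D a b c) (i n : ℕ)
    (v : EuclideanSpace ℂ X) : (adjOp Γ ^ n) (Matrix.toEuclideanLin (distMatrix Γ i) v) =
      Matrix.toEuclideanLin (distMatrix Γ i) ((adjOp Γ ^ n) v) := by
  have h1 : distMatrix Γ 1 * distMatrix Γ i = distMatrix Γ i * distMatrix Γ 1 := by
    have h2 : distMatrix Γ 1 ∈ Subalgebra.centralizer ℂ
        (Algebra.adjoin ℂ {distMatrix Γ 1} : Set (Matrix X X ℂ)) := by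
      rw [Subalgebra.mem_centralizer_iff]
      intro B hB
      exact (Algebra.commute_of_mem_adjoin_self (hB : B ∈ Algebra.adjoin ℂ {distMatrix Γ 1})).symm.eq
    exact ((Subalgebra.mem_centralizer_iff ℂ).1 h2 _ (h.distMatrix_mem_adjoin i)).symm
  induction n with
  | zero => rfl
  | succ n ih =>
    rw [pow_succ', Module.End.mul_apply, Module.End.mul_apply, ih, adjOp, ← toEuclideanLin_mul, h1,
      toEuclideanLin_mul]

/-- A vector of level `r` is not killed by a monic polynomial of degree at most `D - 2 r` in the
adjacency operator. -/
theorem IsDistReg.eq_zero_of_shiftProd_eq_zero (h : IsDistReg Γ D a b c) {φ : ℕ → ℂ}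
    {r k : ℕ} (hk : 2 * r + k ≤ D) {v : EuclideanSpace ℂ X} (hv : levelProj Γ x r v = v)
    (h0 : shiftProd Γ φ v k = 0) : v = 0 := by
  -- The cyclic space of `v` under A: the monic relation of degree `k` makes the first `k` powers
  -- span an invariant subspace.
  set Z : Submodule ℂ (EuclideanSpace ℂ X) := span ℂ {w | ∃ i < k, w = (adjOp Γ ^ i) v}
  have hk1 : (adjOp Γ ^ k) v ∈ Z := by
    have := shiftProd_sub_pow_mem (Γ := Γ) (φ := φ) v k
    rw [h0, zero_sub] at this
    exact (neg_mem_iff).1 this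
  have hZ : ∀ w ∈ Z, adjOp Γ w ∈ Z := by
    suffices Z ≤ Z.comap (adjOp Γ) from this
    refine span_le.2 ?_
    rintro _ ⟨i, hi, rfl⟩
    rw [SetLike.mem_coe, mem_comap, ← Module.End.mul_apply, ← pow_succ']
    rcases (Nat.succ_le_of_lt hi).lt_or_eq with h1 | h1
    · exact subset_span ⟨i + 1, h1, rfl⟩
    · rw [show i + 1 = k from h1]
      exact hk1
  have hinv : ∀ w ∈ Z, Matrix.toEuclideanLin (distMatrix Γ D) w ∈ Z := fun w hw =>
    h.mem_of_adjOp_mem hZ D hw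
  have hvZ : v ∈ Z := by
    rcases Nat.eq_zero_or_pos k with hk0 | hk0
    · rw [hk0] at h0
      rw [show v = 0 from h0]
      exact zero_mem _
    · exact subset_span ⟨0, hk0, rfl⟩
  have hinj : Function.Injective ((Matrix.toEuclideanLin (distMatrix Γ D)).restrict hinv) := by
    rw [← LinearMap.ker_eq_bot, LinearMap.ker_eq_bot']
    exact fun u hu => Subtype.ext (h.eq_zero_of_distMatrix (congrArg Subtype.val hu))
  -- A_D is injective, so it maps `Z` onto itself and v = A_D z with z in `Z`. For n < k the vector
  -- A_D A^n v involves only A_i v with i > 2r, hence A_D z is orthogonal to `v`.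
  obtain ⟨z, hz⟩ := (LinearMap.injective_iff_surjective.1 hinj) ⟨v, hvZ⟩
  have hz' : Matrix.toEuclideanLin (distMatrix Γ D) z = v := congrArg Subtype.val hz
  have key : Z ≤ (LinearMap.ker ((innerₛₗ ℂ v).comp
      (Matrix.toEuclideanLin (distMatrix Γ D)))) := by
    refine span_le.2 ?_
    rintro _ ⟨n, hn, rfl⟩
    rw [SetLike.mem_coe, LinearMap.mem_ker, LinearMap.comp_apply, ← h.adjOp_pow_distMatrix_comm]
    have h1 : span ℂ {w | ∃ i, D ≤ i + n ∧ w = Matrix.toEuclideanLin (distMatrix Γ i) v} ≤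
        LinearMap.ker (innerₛₗ ℂ v) := by
      refine span_le.2 ?_
      rintro _ ⟨i, hi, rfl⟩
      exact inner_distMatrix_eq_zero h.connected (by omega) hv
    exact h1 (h.adjOp_pow_distMatrix_mem v n)
  have h2 : inner ℂ v (Matrix.toEuclideanLin (distMatrix Γ D) z) = 0 := key z.2
  rw [hz'] at h2
  exact inner_self_eq_zero.1 h2

/-- With the right side reversed, [D - r - i] is compared with [r + k - 1 - i]. -/
theorem sum_qInt_reflect_le (q : ℕ) {r k : ℕ} (hk : D < 2 * r + k) :
    ∑ i ∈ Finset.range k, qInt q (D - r - i) ≤ ∑ i ∈ Finset.range k, qInt q (r + i) := by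
  rw [← Finset.sum_range_reflect (fun i => qInt q (r + i))]
  exact Finset.sum_le_sum fun i hi => qInt_mono q (by have := Finset.mem_range.1 hi; omega)

/-- The Laplacian of the subconstituents vanishes on the irreducible modules of displacement
zero. -/
theorem IsFlag.laplacianOp_eq_zero (hG : IsFlag Γ x D q θ G) (h : IsDistReg Γ D a b c)
    (hD : 1 ≤ D) (hq : 2 ≤ q) (hθ : ∀ i j, i < j → j ≤ D → θ i ≠ θ j)
    (hθa : ∀ i ≤ D, (a i : ℝ) - θ (D - i) = qInt q (D - i) - qInt q i)
    (hcomm : ∀ v, laplacianOp Γ x q a (adjOp Γ v) = adjOp Γ (laplacianOp Γ x q a v))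
    (hW : IsIrredTModule Γ D x W) (hdisp : displacement Γ D θ x W = 0)
    {w : EuclideanSpace ℂ X} (hw : w ∈ W) : laplacianOp Γ x q a w = 0 := by
  classical
  obtain ⟨hA, hE⟩ := (h.isTModule_iff hD).1 hW.1
  obtain ⟨r, m, t, hend⟩ := h.exists_hasEndpoints hD hW hG.zero hG.top hG.adj
  have hmt : m + t = D := by
    have := hend.displacement_eq
    omega
  obtain ⟨μ, hμ⟩ := h.exists_laplacianOp_eq_smul hD hcomm hW
  suffices hμ0 : μ = 0 by rw [hμ w hw, hμ0, zero_smul]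
  have hq0 : q ≠ 0 := by omega
  obtain ⟨u, hu, hu0⟩ := hend.exists_first
  set v := levelProj Γ x r u
  have hvW : v ∈ W := hE r u hu
  have hv : levelProj Γ x r v = v := levelProj_levelProj r u
  have hpowW : ∀ n, (raiseOp Γ x ^ n) v ∈ W := by
    intro n
    induction n with
    | zero => exact hvW
    | succ n ih =>
      rw [pow_succ', Module.End.mul_apply]
      exact raiseOp_mem (h.dist_le x) hA hE ih
  have hzero : ∀ n, D < r + n → (raiseOp Γ x ^ n) v = 0 := by
    intro n hn
    rw [← levelProj_raiseOp_pow hv n]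
    ext y
    rw [levelProj_apply, if_neg]
    · rfl
    · have := h.dist_le x y
      omega
  have hex : ∃ n, (raiseOp Γ x ^ n) v = 0 := ⟨D + 1, hzero _ (by omega)⟩
  -- `k` is the last exponent for which the raising operator does not kill `v`.
  obtain ⟨k, hk, hk0⟩ : ∃ k, (raiseOp Γ x ^ (k + 1)) v = 0 ∧ (raiseOp Γ x ^ k) v ≠ 0 := by
    have h1 := Nat.find_spec hex
    have h2 : Nat.find hex ≠ 0 := fun e => by
      rw [e] at h1
      exact hu0 h1
    obtain ⟨k, hk⟩ := Nat.exists_eq_succ_of_ne_zero h2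
    refine ⟨k, ?_, Nat.find_min hex (by omega)⟩
    rwa [hk] at h1
  have hkD : r + k ≤ D := by
    by_contra hcon
    exact hk0 (hzero k (by omega))
  set φ : ℕ → ℂ := fun i => (θ (D - r - i) : ℂ)
  obtain ⟨z, hz, he⟩ := exists_shiftProd_eq (φ := φ)
    (κ := fun n => (a (r + n) : ℂ) - (q : ℂ) ^ (r + n) * μ) h.connected hv
    (fun n => flatOp_eq_of_laplacianOp hq0 (hμ _ (hpowW n)) (levelProj_raiseOp_pow hv n)) k
  set C := ∑ i ∈ Finset.range (k + 1), ((a (r + i) : ℂ) - (q : ℂ) ^ (r + i) * μ - φ i)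
  rw [hk, zero_add] at he
  -- Because R^(k+1) v = 0, the product stays in `low Γ x (r + k + 1)`, while its k + 1 factors
  -- bring it down to G_(D-r-k). These indices sum to D + 1, where the flags are opposite.
  have hshift : shiftProd Γ φ v (k + 1) = 0 := by
    have h1 : shiftProd Γ φ v (k + 1) ∈ W ⊓ low Γ x (r + (k + 1)) ⊓ G (D + 1 - r - (k + 1)) := by
      refine ⟨⟨shiftProd_mem hA hvW _, ?_⟩, hG.shiftProd_mem_flag
        (hG.le_of_endpoints h hD hq hθ hW hend hmt hvW) (by omega)⟩
      rw [he]
      refine add_mem (smul_mem _ _ ?_) (low_mono (by omega) hz)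
      rw [← levelProj_raiseOp_pow hv k]
      exact levelProj_mem_low (by omega) _
    rw [hG.inf_low_inf_eq_bot h hD hq hW hend hmt (by omega)] at h1
    exact (mem_bot ℂ).1 h1
  have hC : C = 0 := by
    have h1 := congrArg (levelProj Γ x (r + k)) he
    rw [hshift, map_zero, map_add, map_smul, levelProj_raiseOp_pow hv,
      levelProj_eq_zero_of_mem_low hz, add_zero] at h1
    exact (smul_eq_zero.1 h1.symm).resolve_right hk0
  -- The product is a monic polynomial of degree k + 1 in A that kills the nonzero vector `v` of
  -- level r.
  have hlong : D < 2 * r + (k + 1) := by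
    by_contra hcon
    exact hu0 (h.eq_zero_of_shiftProd_eq_zero (by omega) hv hshift)
  have hterm : ∀ i ∈ Finset.range (k + 1), (a (r + i) : ℂ) - (q : ℂ) ^ (r + i) * μ - φ i =
      (((qInt q (D - r - i) : ℝ) - (qInt q (r + i) : ℝ) : ℝ) : ℂ) - ((q : ℝ) ^ (r + i) : ℝ) * μ := by
    intro i hi
    have h1 := hθa (r + i) (by have := Finset.mem_range.1 hi; omega)
    rw [← Nat.sub_sub] at h1
    rw [← h1]
    push_cast
    ring
  -- The vanishing coefficient of R^k v reads μ Σ q^(r+i) = Σ ([D-r-i] - [r+i]). The right side is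
  -- real and at most 0 by `hlong`, the factor of μ is positive, and the real part of μ is
  -- nonnegative by the energy identity; so μ = 0.
  have hC' : (((∑ i ∈ Finset.range (k + 1),
      ((qInt q (D - r - i) : ℝ) - (qInt q (r + i) : ℝ)) : ℝ)) : ℂ) =
      ((∑ i ∈ Finset.range (k + 1), (q : ℝ) ^ (r + i) : ℝ) : ℂ) * μ := by
    rw [← sub_eq_zero, ← hC, Complex.ofReal_sum, Complex.ofReal_sum, Finset.sum_mul,
      ← Finset.sum_sub_distrib]
    exact (Finset.sum_congr rfl hterm).symm
  have hpos : 0 < ∑ i ∈ Finset.range (k + 1), (q : ℝ) ^ (r + i) :=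
    Finset.sum_pos (fun i _ => by positivity) ⟨0, Finset.mem_range.2 (Nat.succ_pos k)⟩
  have hneg : ∑ i ∈ Finset.range (k + 1),
      ((qInt q (D - r - i) : ℝ) - (qInt q (r + i) : ℝ)) ≤ 0 := by
    rw [Finset.sum_sub_distrib, sub_nonpos]
    exact_mod_cast sum_qInt_reflect_le q hlong
  have hre := h.re_nonneg_of_laplacianOp hq0 hu0 (hμ v hvW)
  have h1 := congrArg Complex.re hC'
  have h2 := congrArg Complex.im hC'
  rw [Complex.ofReal_re, Complex.re_ofReal_mul] at h1
  rw [Complex.ofReal_im, Complex.im_ofReal_mul] at h2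
  apply Complex.ext
  · rw [Complex.zero_re]
    nlinarith
  · rw [Complex.zero_im]
    exact (mul_eq_zero.1 h2.symm).resolve_left hpos.ne'

end Nucleus

/-! ### The kernel of the Laplacian is contained in the nucleus. -/

namespace Nucleus

variable {X : Type*} [Fintype X] [DecidableEq X]

variable {Γ : SimpleGraph X} {x : X} {D q : ℕ} {a b c : ℕ → ℕ} {θ : ℕ → ℝ}
  {W S : Submodule ℂ (EuclideanSpace ℂ X)} {G B : ℕ → Submodule ℂ (EuclideanSpace ℂ X)}

/-- A flag of the subspace `S` on which the adjacency operator acts triangularly, whose members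
contain no vectors supported near `x`, together with the fact that vectors of `S` supported on
one level are detected by a flag `G` of the whole space. -/
structure IsSubflag (Γ : SimpleGraph X) (x : X) (D : ℕ) (θ : ℕ → ℝ)
    (G B : ℕ → Submodule ℂ (EuclideanSpace ℂ X)) (S : Submodule ℂ (EuclideanSpace ℂ X)) :
    Prop where
  le : S ≤ B (D + 1)
  adj : ∀ j, ∀ v ∈ B (j + 1), adjOp Γ v - (θ j : ℂ) • v ∈ B j
  inf_low : ∀ t ≤ D, B (t + 1) ⊓ low Γ x (D - t) = ⊥
  eq_zero : ∀ m ≤ D, ∀ w ∈ S, levelProj Γ x m w = w →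
    (∀ g ∈ G (D + 1 - m), inner ℂ w g = 0) → w = 0

/-- The irreducible modules contained in `S` have displacement zero. -/
theorem IsSubflag.displacement_eq_zero (hB : IsSubflag Γ x D θ G B S) (hG : IsFlag Γ x D q θ G)
    (h : IsDistReg Γ D a b c) (hD : 1 ≤ D) (hθ : ∀ i j, i < j → j ≤ D → θ i ≠ θ j)
    (hW : IsIrredTModule Γ D x W) (hWS : W ≤ S) : displacement Γ D θ x W = 0 := by
  obtain ⟨hA, hE⟩ := (h.isTModule_iff hD).1 hW.1
  obtain ⟨r, m, t, hend⟩ := h.exists_hasEndpoints hD hW hG.zero hG.top hG.adj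
  -- An eigenvector for θ_t lies in B_(t+1) and is supported on levels at most m; if m < D - t, it
  -- would lie in an intersection known to be zero.
  have h1 : D ≤ m + t := by
    by_contra hcon
    obtain ⟨u, hu, hu0, hAu⟩ := hend.exists_eigenvector
    have hu1 : u ∈ B (t + 1) := mem_flag_of_eigenvector (θ := fun j => (θ j : ℂ)) hB.adj
      hend.dual_le_diam (fun i j hij hj e => hθ i j hij hj (Complex.ofReal_injective e))
      (hB.le (hWS hu)) hAu
    have hu2 : u ∈ B (t + 1) ⊓ low Γ x (D - t) := ⟨hu1, low_mono (by omega) (hend.le_low hu)⟩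
    rw [hB.inf_low t hend.dual_le_diam] at hu2
    exact hu0 ((mem_bot ℂ).1 hu2)
  -- `W` is orthogonal to G_t. If D + 1 - m ≤ t, its vectors on the last level are orthogonal to
  -- G_(D+1-m), and these are detected by that space.
  have h2 : m + t ≤ D := by
    by_contra hcon
    obtain ⟨w, hw, hw0⟩ := hend.exists_last
    refine hw0 (hB.eq_zero m hend.le_diam _ (hWS (hE m w hw)) (levelProj_levelProj m w) ?_)
    intro g hg
    exact inner_eq_zero_of_mem_flag (inner_adjOp_left Γ) hG.zero hG.adj hA hend.eigenvector_eq_zero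
      (hE m w hw) (hG.mono (by omega) hg)
  rw [hend.displacement_eq]
  omega

/-- The kernel is itself a module, because the Laplacian commutes with A and the level projections,
so it is spanned by irreducible submodules, all of displacement zero. -/
theorem IsSubflag.nucleus_eq (hB : IsSubflag Γ x D θ G B (LinearMap.ker (laplacianOp Γ x q a)))
    (hG : IsFlag Γ x D q θ G) (h : IsDistReg Γ D a b c) (hD : 1 ≤ D) (hq : 2 ≤ q)
    (hθ : ∀ i j, i < j → j ≤ D → θ i ≠ θ j)
    (hθa : ∀ i ≤ D, (a i : ℝ) - θ (D - i) = qInt q (D - i) - qInt q i)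
    (hcomm : ∀ v, laplacianOp Γ x q a (adjOp Γ v) = adjOp Γ (laplacianOp Γ x q a v)) :
    nucleus Γ D θ x = LinearMap.ker (laplacianOp Γ x q a) := by
  refine le_antisymm (sSup_le fun W hW w hw => LinearMap.mem_ker.2
    (hG.laplacianOp_eq_zero h hD hq hθ hθa hcomm hW.1 hW.2 hw)) ?_
  have hT : IsTModule Γ D x (LinearMap.ker (laplacianOp Γ x q a)) := by
    refine (h.isTModule_iff hD).2 ⟨fun w hw => ?_, fun i w hw => ?_⟩
    · rw [LinearMap.mem_ker, hcomm, LinearMap.mem_ker.1 hw, map_zero]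
    · rw [LinearMap.mem_ker, laplacianOp_levelProj, LinearMap.mem_ker.1 hw, map_zero]
  refine (h.le_sSup_irred hD hT).trans (sSup_le_sSup fun W hW => ⟨hW.1, ?_⟩)
  exact hB.displacement_eq_zero hG h hD hθ hW.1 hW.2

end Nucleus

/-! ### Characteristic vectors of subspaces and the eigenvalue flag. -/

namespace PolarSpace

open Nucleus

variable {F U : Type*} [Field F] [AddCommGroup U] [Module F U] {P : PolarSpace F U} {D s : ℕ}

/-- The eigenvalues of a dual polar graph in terms of `q`-integers. -/
noncomputable def eigval (q s D j : ℕ) : ℝ := (s : ℝ) * qInt q (D - j) - qInt q j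

theorem eigval_lt {q i j : ℕ} (hq : 0 < q) (hij : i < j) : eigval q s D j < eigval q s D i := by
  have h1 : (qInt q i : ℝ) < qInt q j := by exact_mod_cast qInt_strictMono hq hij
  have h2 : (qInt q (D - j) : ℝ) ≤ qInt q (D - i) := by
    exact_mod_cast qInt_mono q (by omega : D - j ≤ D - i)
  have h3 : (s : ℝ) * qInt q (D - j) ≤ s * qInt q (D - i) :=
    mul_le_mul_of_nonneg_left h2 (Nat.cast_nonneg s)
  rw [eigval, eigval]
  linarith

open scoped Classical in
/-- The characteristic vector of the set of vertices containing a subspace. -/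
noncomputable def incVec (P : PolarSpace F U) (K : Submodule F U) : EuclideanSpace ℂ P.Vertex :=
  WithLp.toLp 2 fun y => if K ≤ y.1 then 1 else 0

open scoped Classical in
theorem incVec_apply (K : Submodule F U) (y : P.Vertex) :
    P.incVec K y = if K ≤ y.1 then 1 else 0 := rfl

/-- The span of the vectors of the subspaces of dimension less than `j` in a given family. -/
noncomputable def incSpan (P : PolarSpace F U) (p : Submodule F U → Prop) (j : ℕ) :
    Submodule ℂ (EuclideanSpace ℂ P.Vertex) :=
  span ℂ {v | ∃ K, p K ∧ finrank F K < j ∧ v = P.incVec K}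

theorem incVec_mem {p : Submodule F U → Prop} {j : ℕ} {K : Submodule F U} (hp : p K)
    (hK : finrank F K < j) : P.incVec K ∈ P.incSpan p j :=
  subset_span ⟨K, hp, hK, rfl⟩

theorem incSpan_zero (p : Submodule F U → Prop) : P.incSpan p 0 = ⊥ := by
  rw [incSpan, span_eq_bot]
  rintro _ ⟨K, -, hK, -⟩
  exact absurd hK (Nat.not_lt_zero _)

theorem incSpan_mono (p : Submodule F U → Prop) : Monotone (P.incSpan p) :=
  fun _ _ h => span_mono fun _ ⟨K, hp, hK, hv⟩ => ⟨K, hp, hK.trans_le h, hv⟩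

theorem incVec_eq_zero {K : Submodule F U} (hK : ¬ P.Iso K) : P.incVec K = 0 := by
  ext y
  rw [incVec_apply, if_neg fun h => hK (y.2.1.mono h)]
  rfl

variable [Finite F] [Finite U] [FiniteDimensional F U] [Fintype P.Vertex] [DecidableEq P.Vertex]

/-- The remainder is the sum of the vectors of the hyperplanes of `K`. Requiring only that `p` be
hereditary covers both the family of all subspaces and the family of subspaces of x. -/
theorem HasOrder.adjOp_incVec_sub_mem (h : P.HasOrder D s) {p : Submodule F U → Prop}
    (hp : ∀ K M, M ≤ K → p K → p M) {K : Submodule F U} (hK : p K) :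
    adjOp (P.graph D) (P.incVec K) - (eigval (Nat.card F) s D (finrank F K) : ℂ) • P.incVec K ∈
      P.incSpan p (finrank F K) := by
  classical
  by_cases hiso : P.Iso K
  · have : Finite (Submodule F U) := Finite.of_injective _ SetLike.coe_injective
    have : Fintype (Submodule F U) := Fintype.ofFinite _
    have key : adjOp (P.graph D) (P.incVec K) -
        (eigval (Nat.card F) s D (finrank F K) : ℂ) • P.incVec K =
        ∑ M ∈ Finset.univ.filter (fun M => M ≤ K ∧ finrank F M + 1 = finrank F K), P.incVec M := by
      ext y
      rw [PiLp.sub_apply, PiLp.smul_apply, WithLp.ofLp_sum, Finset.sum_apply, adjOp_apply,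
        smul_eq_mul]
      have h1 : ∑ z, (if (P.graph D).Adj y z then P.incVec K z else 0) =
          (Nat.card {w : P.Vertex // (P.graph D).Adj y w ∧ K ≤ w.1} : ℂ) := by
        rw [Nat.card_eq_fintype_card, Fintype.card_subtype, Finset.card_filter, Nat.cast_sum]
        refine Finset.sum_congr rfl fun z _ => ?_
        rw [incVec_apply, ← ite_and, Nat.cast_ite, Nat.cast_one, Nat.cast_zero]
      have h2 : ∑ M ∈ Finset.univ.filter (fun M => M ≤ K ∧ finrank F M + 1 = finrank F K),
          P.incVec M y = (Nat.card {M : Submodule F U //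
            M ≤ K ∧ finrank F M + 1 = finrank F K ∧ M ≤ y.1} : ℂ) := by
        rw [Nat.card_eq_fintype_card, Fintype.card_subtype, Finset.card_filter, Nat.cast_sum,
          Finset.sum_filter]
        refine Finset.sum_congr rfl fun M _ => ?_
        rw [incVec_apply, ← ite_and, Nat.cast_ite, Nat.cast_one, Nat.cast_zero]
        exact if_congr and_assoc rfl rfl
      have h3 := congrArg (Nat.cast : ℕ → ℂ) (h.card_adj_add hiso y)
      rw [h1, h2, incVec_apply, eigval]
      push_cast at h3 ⊢
      linear_combination h3
    rw [key]
    refine sum_mem fun M hM => ?_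
    obtain ⟨-, hM1, hM2⟩ := Finset.mem_filter.1 hM
    exact incVec_mem (hp K M hM1 hK) (by omega)
  · rw [incVec_eq_zero hiso, map_zero, smul_zero, sub_zero]
    exact zero_mem _

theorem HasOrder.adjOp_sub_mem_incSpan (h : P.HasOrder D s) {p : Submodule F U → Prop}
    (hp : ∀ K M, M ≤ K → p K → p M) (j : ℕ) {v : EuclideanSpace ℂ P.Vertex}
    (hv : v ∈ P.incSpan p (j + 1)) :
    adjOp (P.graph D) v - (eigval (Nat.card F) s D j : ℂ) • v ∈ P.incSpan p j := by
  suffices P.incSpan p (j + 1) ≤ (P.incSpan p j).comap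
    (adjOp (P.graph D) - (eigval (Nat.card F) s D j : ℂ) • LinearMap.id) from this hv
  refine span_le.2 ?_
  rintro _ ⟨K, hK, hKj, rfl⟩
  have h1 := h.adjOp_incVec_sub_mem hp hK
  change adjOp (P.graph D) (P.incVec K) - (eigval (Nat.card F) s D j : ℂ) • P.incVec K ∈
    P.incSpan p j
  rcases (Nat.lt_succ_iff.1 hKj).lt_or_eq with h2 | h2
  · have h3 := add_mem (incSpan_mono p h2.le h1) (smul_mem (P.incSpan p j)
      ((eigval (Nat.card F) s D (finrank F K) : ℂ) - (eigval (Nat.card F) s D j : ℂ))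
      (incVec_mem hK h2))
    convert h3 using 1
    module
  · rwa [h2] at h1

theorem HasOrder.sub_dist (h : P.HasOrder D s) (x y : P.Vertex) :
    D - (P.graph D).dist x y = finrank F (x.1 ⊓ y.1 : Submodule F U) := by
  have := h.dist_add_finrank x y
  omega

/-- The weight q^(D-∂(x,y)) is the number of vectors w of x lying in y, and such a w together with
`K` lies in y exactly when `K ⊔ span F {w}` does. Adjoining w raises the dimension by at most one,
which gives the upward step of the flag. -/
theorem HasOrder.levelOp_incVec (h : P.HasOrder D s) (x : P.Vertex) (K : Submodule F U)
    [Fintype x.1] :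
    levelOp (P.graph D) x (fun i => (Nat.card F : ℂ) ^ (D - i)) (P.incVec K) =
      ∑ w : x.1, P.incVec (K ⊔ span F {(w : U)}) := by
  classical
  ext y
  rw [levelOp_apply, WithLp.ofLp_sum, Finset.sum_apply, incVec_apply, h.sub_dist]
  simp only [incVec_apply, sup_le_iff, span_singleton_le_iff_mem, ite_and]
  split_ifs with hK
  · rw [mul_one, Finset.sum_boole, ← Nat.cast_pow, ← Module.natCard_eq_pow_finrank,
      ← Fintype.card_subtype, ← Nat.card_eq_fintype_card]
    congr 1
    exact Nat.card_congr
      { toFun := fun u => ⟨⟨u.1, u.2.1⟩, u.2.2⟩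
        invFun := fun u => ⟨u.1.1, u.1.2, u.2⟩
        left_inv := fun _ => rfl
        right_inv := fun _ => rfl }
  · simp

theorem incVec_vertex (y z : P.Vertex) : P.incVec y.1 z = if z = y then 1 else 0 := by
  rw [incVec_apply]
  by_cases hzy : z = y
  · rw [if_pos hzy, if_pos (by rw [hzy])]
  · rw [if_neg hzy, if_neg fun hle => hzy (Subtype.ext (y.2.eq_of_le z.2.1 hle).symm)]

/-- The vectors of the subspaces of dimension less than `j` form a flag. -/
theorem HasOrder.isFlag (h : P.HasOrder D s) (x : P.Vertex) :
    IsFlag (P.graph D) x D (Nat.card F) (eigval (Nat.card F) s D)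
      (P.incSpan fun _ => True) where
  zero := incSpan_zero _
  top := by
    rw [eq_top_iff]
    intro v _
    have : v = ∑ y, v y • P.incVec y.1 := by
      ext z
      rw [WithLp.ofLp_sum, Finset.sum_apply]
      simp only [PiLp.smul_apply, incVec_vertex, smul_eq_mul, mul_ite, mul_one, mul_zero]
      simp
    rw [this]
    exact sum_mem fun y _ => smul_mem _ _
      (incVec_mem trivial (by rw [h.finrank_eq]; exact Nat.lt_succ_self D))
  mono := incSpan_mono _
  adj j v hv := h.adjOp_sub_mem_incSpan (fun _ _ _ _ => trivial) j hv
  weight j v hv := by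
    suffices P.incSpan (fun _ => True) j ≤ (P.incSpan (fun _ => True) (j + 1)).comap
      (levelOp (P.graph D) x (fun i => (Nat.card F : ℂ) ^ (D - i))) from this hv
    refine span_le.2 ?_
    rintro _ ⟨K, -, hK, rfl⟩
    have : Fintype x.1 := Fintype.ofFinite _
    rw [SetLike.mem_coe, mem_comap, h.levelOp_incVec]
    refine sum_mem fun w _ => incVec_mem trivial ?_
    have h1 := Submodule.finrank_add_le_finrank_add_finrank K (span F {(w : U)})
    have h2 : finrank F (span F {(w : U)}) ≤ 1 := finrank_span_le_card _ |>.trans (by simp)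
    omega

/-- The dual polar graph of a polar space is distance-regular. -/
theorem HasOrder.isDistReg (h : P.HasOrder D s) (hs : 1 ≤ s) [Nonempty P.Vertex] :
    IsDistReg (P.graph D) D (fun i => qInt (Nat.card F) i * (s - 1))
      (fun i => (qInt (Nat.card F) D - qInt (Nat.card F) i) * s) (qInt (Nat.card F)) where
  connected := h.connected
  dist_le y z := by
    have := h.dist_add_finrank y z
    omega
  card_closer x z := h.card_closer x z
  card_level x z := h.card_level x z
  card_farther x z := by
    have := h.card_farther hs x z
    rw [Nat.sub_mul]
    omega
  c_ne_zero i := by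
    rw [qInt_succ]
    exact Nat.succ_ne_zero _
  b_ne_zero i hi := by
    have h1 := qInt_strictMono (Nat.card_pos : 0 < Nat.card F) hi
    have h2 : 0 < qInt (Nat.card F) D - qInt (Nat.card F) i := Nat.sub_pos_of_lt h1
    exact (Nat.mul_pos h2 hs).ne'

end PolarSpace

/-! ### The flag of the kernel, and the nucleus of a dual polar graph. -/

namespace PolarSpace

open Nucleus

variable {F U : Type*} [Field F] [AddCommGroup U] [Module F U] {P : PolarSpace F U} {D s : ℕ}

open scoped Classical in
/-- The characteristic vector of the set of vertices meeting `x` in a given subspace. -/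
noncomputable def meetVec (x : P.Vertex) (K : Submodule F U) : EuclideanSpace ℂ P.Vertex :=
  WithLp.toLp 2 fun y => if y.1 ⊓ x.1 = K then 1 else 0

open scoped Classical in
theorem meetVec_apply (x : P.Vertex) (K : Submodule F U) (y : P.Vertex) :
    meetVec x K y = if y.1 ⊓ x.1 = K then 1 else 0 := rfl

variable [Finite F] [Finite U] [FiniteDimensional F U] [Fintype P.Vertex] [DecidableEq P.Vertex]

/-- Möbius inversion from the top: among vertices containing `K`, remove those that meet `x` in
something larger. -/
theorem HasOrder.meetVec_mem_incSpan (h : P.HasOrder D s) {x : P.Vertex} {K : Submodule F U}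
    (hK : K ≤ x.1) : meetVec x K ∈ P.incSpan (· ≤ x.1) (D + 1) := by
  classical
  have : Finite (Submodule F U) := Finite.of_injective _ SetLike.coe_injective
  have : Fintype (Submodule F U) := Fintype.ofFinite _
  induction K using WellFoundedGT.induction with
  | _ K ih =>
    have key : meetVec x K = P.incVec K -
        ∑ M ∈ Finset.univ.filter (fun M => K < M ∧ M ≤ x.1), meetVec x M := by
      ext y
      rw [PiLp.sub_apply, WithLp.ofLp_sum, Finset.sum_apply, incVec_apply, meetVec_apply]
      simp only [meetVec_apply, Finset.sum_ite_eq, Finset.mem_filter, Finset.mem_univ, true_and]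
      by_cases h1 : y.1 ⊓ x.1 = K
      · rw [if_pos h1, if_pos (h1 ▸ inf_le_left), if_neg fun e => e.1.ne h1.symm, sub_zero]
      · by_cases h2 : K ≤ y.1
        · rw [if_neg h1, if_pos h2, if_pos ⟨lt_of_le_of_ne (le_inf h2 hK) (Ne.symm h1),
            inf_le_right⟩, sub_self]
        · rw [if_neg h1, if_neg h2, if_neg fun e => h2 (e.1.le.trans inf_le_left), sub_zero]
    rw [key]
    refine sub_mem (incVec_mem hK ?_) (sum_mem fun M hM => ?_)
    · rw [← h.finrank_eq x]
      exact Nat.lt_succ_of_le (Submodule.finrank_mono hK)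
    · obtain ⟨-, h1, h2⟩ := Finset.mem_filter.1 hM
      exact ih M h1 h2

/-- Evaluating a combination at a vertex `y` with `y ⊓ x = K` sees only coefficients of subspaces of
`K`. This vertex has distance D - dim K ≥ D - t, so the value is zero, and induction upwards along
inclusion kills every coefficient. -/
theorem HasOrder.incSpan_inf_low (h : P.HasOrder D s) (hs : 1 ≤ s) (x : P.Vertex) {t : ℕ}
    (ht : t ≤ D) : P.incSpan (· ≤ x.1) (t + 1) ⊓ low (P.graph D) x (D - t) = ⊥ := by
  classical
  refine (Submodule.eq_bot_iff _).2 fun v hv => ?_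
  have hset : {v | ∃ K : Submodule F U, K ≤ x.1 ∧ finrank F K < t + 1 ∧ v = P.incVec K} =
      P.incVec '' {K | K ≤ x.1 ∧ finrank F K < t + 1} := by
    ext v
    constructor
    · rintro ⟨K, h1, h2, rfl⟩
      exact ⟨K, ⟨h1, h2⟩, rfl⟩
    · rintro ⟨K, ⟨h1, h2⟩, rfl⟩
      exact ⟨K, h1, h2, rfl⟩
  have hv1 := hv.1
  rw [SetLike.mem_coe, incSpan, hset, Finsupp.mem_span_image_iff_linearCombination] at hv1
  obtain ⟨c, hc, rfl⟩ := hv1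
  rw [Finsupp.mem_supported'] at hc
  suffices hc0 : c = 0 by rw [hc0, map_zero]
  ext K
  have : Finite (Submodule F U) := Finite.of_injective _ SetLike.coe_injective
  induction K using WellFoundedLT.induction with
  | _ K ih =>
    by_cases hK : K ≤ x.1 ∧ finrank F K < t + 1
    · obtain ⟨y, hy⟩ := h.exists_inf_eq_of_le hs hK.1
      have h1 := hv.2 y (by
        have := h.dist_add_finrank x y
        rw [inf_comm, hy] at this
        omega)
      rw [Finsupp.linearCombination_apply, Finsupp.sum, WithLp.ofLp_sum, Finset.sum_apply] at h1
      rw [Finset.sum_eq_single K] at h1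
      · rwa [PiLp.smul_apply, incVec_apply, if_pos (hy ▸ inf_le_left), smul_eq_mul, mul_one] at h1
      · intro M _ hMK
        rw [PiLp.smul_apply, incVec_apply]
        by_cases hM : M ≤ x.1 ∧ finrank F M < t + 1
        · split_ifs with hMy
          · rw [ih M (lt_of_le_of_ne (hy ▸ le_inf hMy hM.1) hMK), Finsupp.zero_apply, zero_smul]
          · rw [smul_zero]
        · rw [hc M hM, zero_smul]
      · intro hK
        rw [Finsupp.notMem_support_iff.1 hK, zero_smul]
        rfl
    · exact hc K hK

/-- On level `m` the vertices containing `y ⊓ x` are exactly those that meet `x` in it. Pairing `w`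
with that characteristic vector therefore gives a nonzero multiple of the conjugate of `w y`. -/
theorem HasOrder.eq_zero_of_inner_incVec (h : P.HasOrder D s) {x : P.Vertex}
    {w : EuclideanSpace ℂ P.Vertex} (hw : ∀ y z : P.Vertex, y.1 ⊓ x.1 = z.1 ⊓ x.1 → w y = w z)
    {m : ℕ} (hm : levelProj (P.graph D) x m w = w)
    (hinner : ∀ g ∈ P.incSpan (fun _ => True) (D + 1 - m), inner ℂ w g = 0) : w = 0 := by
  classical
  ext y
  by_cases hy : (P.graph D).dist x y = m
  · have h1 := h.dist_add_finrank x y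
    rw [inf_comm] at h1
    have h2 := hinner (P.incVec (y.1 ⊓ x.1)) (incVec_mem trivial (by omega))
    rw [PiLp.inner_apply] at h2
    have h3 : ∀ z, inner ℂ (w z) (P.incVec (y.1 ⊓ x.1) z) =
        (if z.1 ⊓ x.1 = y.1 ⊓ x.1 then 1 else 0) * star (w y) := by
      intro z
      rw [incVec_apply]
      by_cases hz : z.1 ⊓ x.1 = y.1 ⊓ x.1
      · rw [if_pos hz, if_pos (hz ▸ inf_le_left), hw z y hz]
        simp
      · rw [if_neg hz, zero_mul]
        split_ifs with hle
        · have hzm : (P.graph D).dist x z ≠ m := by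
            intro hd
            have h4 := h.dist_add_finrank x z
            rw [inf_comm] at h4
            exact hz (Submodule.eq_of_le_of_finrank_eq (le_inf hle inf_le_right) (by omega)).symm
          rw [← hm, levelProj_apply, if_neg hzm, inner_zero_left]
        · exact inner_zero_right _
    simp only [h3, ← Finset.sum_mul, Finset.sum_boole] at h2
    rcases mul_eq_zero.1 h2 with h4 | h4
    · rw [Nat.cast_eq_zero, Finset.card_eq_zero] at h4
      exact absurd rfl ((Finset.filter_eq_empty_iff.1 h4) (Finset.mem_univ y))
    · exact star_eq_zero.1 h4
  · rw [← hm, levelProj_apply, if_neg hy]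
    rfl

/-- The vectors of the subspaces of `x` form a flag of the kernel of the Laplacian. -/
theorem HasOrder.isSubflag (h : P.HasOrder D s) (hs : 2 ≤ s) (x : P.Vertex) :
    IsSubflag (P.graph D) x D (eigval (Nat.card F) s D) (P.incSpan fun _ => True)
      (P.incSpan (· ≤ x.1)) (LinearMap.ker (laplacianOp (P.graph D) x (Nat.card F)
        (fun i => qInt (Nat.card F) i * (s - 1)))) := by
  classical
  have : Nonempty P.Vertex := ⟨x⟩
  have hS : ∀ v ∈ LinearMap.ker (laplacianOp (P.graph D) x (Nat.card F)
      (fun i => qInt (Nat.card F) i * (s - 1))),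
      ∀ y z : P.Vertex, y.1 ⊓ x.1 = z.1 ⊓ x.1 → v y = v z := by
    intro v hv y z hyz
    exact ((h.isDistReg (by omega)).laplacianOp_eq_zero_iff Nat.card_pos.ne').1
      (LinearMap.mem_ker.1 hv) y z ((h.sim_iff hs).2 hyz)
  refine
    { le := fun v hv => ?_
      adj := fun j v hv => h.adjOp_sub_mem_incSpan (fun K M hMK hK => hMK.trans hK) j hv
      inf_low := fun t ht => h.incSpan_inf_low (by omega) x ht
      eq_zero := fun m _ w hw hm hinner => h.eq_zero_of_inner_incVec (hS w hw) hm hinner }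
  have : Finite (Submodule F U) := Finite.of_injective _ SetLike.coe_injective
  have : Fintype (Submodule F U) := Fintype.ofFinite _
  choose Y hY using fun K : {K // K ≤ x.1} => h.exists_inf_eq_of_le (by omega : 1 ≤ s) K.2
  -- `v` is constant on the fibres of `y ↦ y ⊓ x`, and `Y K` is a representative of the fibre of
  -- `K`.
  have key : v = ∑ K : {K // K ≤ x.1}, v (Y K) • meetVec x K.1 := by
    ext y
    rw [WithLp.ofLp_sum, Finset.sum_apply, Finset.sum_eq_single ⟨y.1 ⊓ x.1, inf_le_right⟩]
    · rw [PiLp.smul_apply, meetVec_apply, if_pos rfl, smul_eq_mul, mul_one]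
      exact hS v hv _ _ (hY ⟨y.1 ⊓ x.1, inf_le_right⟩).symm
    · intro K _ hK
      rw [PiLp.smul_apply, meetVec_apply, if_neg fun e => hK (Subtype.ext e.symm), smul_zero]
    · exact fun hn => absurd (Finset.mem_univ _) hn
  rw [key]
  exact sum_mem fun K _ => smul_mem _ _ (h.meetVec_mem_incSpan K.2)

/-- The nucleus of a dual polar graph that is not bipartite consists of the vectors that are
constant on the connected components of the subconstituents. -/
theorem HasOrder.mem_nucleus_iff (h : P.HasOrder D s) (hs : 2 ≤ s) (hD : 1 ≤ D) (x : P.Vertex)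
    {v : EuclideanSpace ℂ P.Vertex} :
    v ∈ Nucleus.nucleus (P.graph D) D (eigval (Nat.card F) s D) x ↔
      ∀ y z, sim (P.graph D) x y z → v y = v z := by
  have : Nonempty P.Vertex := ⟨x⟩
  have hreg := h.isDistReg (by omega : 1 ≤ s)
  have hq : 2 ≤ Nat.card F := Finite.one_lt_card
  have hFR := flatMatrix_mul_raiseMatrix (x := x) (q := Nat.card F) (σ := s - 1)
    fun y z hd _ => h.card_common_level hd
  rw [(h.isSubflag hs x).nucleus_eq (h.isFlag x) hreg hD hq, LinearMap.mem_ker,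
    hreg.laplacianOp_eq_zero_iff (by omega)]
  · exact fun i j hij _ => (eigval_lt (by omega) hij).ne'
  · intro i hi
    rw [eigval, Nat.sub_sub_self hi, Nat.cast_mul, Nat.cast_sub (by omega)]
    push_cast
    ring
  · exact fun v => laplacianOp_adjOp h.connected (by omega)
      (fun i => by rw [qInt_succ]; ring) hFR v

end PolarSpace

/-! ### Equivalence classes, the basis of characteristic vectors and the conclusion. -/

namespace Nucleus

section Classes

variable {X : Type*} {Γ : SimpleGraph X} {x : X} {D : ℕ}

theorem setOf_sim_eq {y : X} {i : ℕ} (hy : y ∈ subconstituent Γ x i) :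
    {z | sim Γ x z y} = Subtype.val ''
      ((Γ.induce (subconstituent Γ x i)).connectedComponentMk ⟨y, hy⟩).supp := by
  ext z
  constructor
  · rintro ⟨j, hz, hy', hr⟩
    obtain rfl : j = i := hy'.symm.trans hy
    exact ⟨⟨z, hz⟩, SimpleGraph.ConnectedComponent.eq.2 hr, rfl⟩
  · rintro ⟨⟨z, hz⟩, hr, rfl⟩
    exact ⟨i, hz, hy, SimpleGraph.ConnectedComponent.eq.1 hr⟩

/-- The classes inside a subconstituent are its connected components. -/
theorem classes_subset_eq_components (i : ℕ) :
    {C ∈ (sim Γ x).classes | C ⊆ subconstituent Γ x i} = components Γ x i := by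
  ext C
  constructor
  · rintro ⟨⟨y, rfl⟩, hC⟩
    have hy : y ∈ subconstituent Γ x i := hC ((sim Γ x).refl y)
    exact ⟨_, setOf_sim_eq hy⟩
  · rintro ⟨c, rfl⟩
    induction c using SimpleGraph.ConnectedComponent.ind with
    | _ y =>
      refine ⟨⟨y.1, (setOf_sim_eq y.2).symm⟩, ?_⟩
      rintro _ ⟨z, -, rfl⟩
      exact z.2

theorem classes_eq_components (hD : ∀ y, Γ.dist x y ≤ D) :
    (sim Γ x).classes = {C | ∃ i ≤ D, C ∈ components Γ x i} := by
  ext C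
  constructor
  · rintro ⟨y, rfl⟩
    exact ⟨Γ.dist x y, hD y, _, setOf_sim_eq (i := Γ.dist x y) rfl⟩
  · rintro ⟨i, -, hC⟩
    rw [← classes_subset_eq_components] at hC
    exact hC.1

end Classes

variable {X : Type*} [Fintype X] [DecidableEq X] {Γ : SimpleGraph X} {x : X} {D : ℕ}

/-- A subspace consisting of the vectors that are constant on the classes of an equivalence
relation has an orthogonal basis of characteristic vectors. -/
theorem exists_basis_charVec (r : Setoid X) {N : Submodule ℂ (EuclideanSpace ℂ X)}
    (hN : ∀ v, v ∈ N ↔ ∀ y z, r y z → v y = v z) :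
    ∃ b : Basis (Quotient r) ℂ N,
      (∀ c, (b c : EuclideanSpace ℂ X) = charVec {y | Quotient.mk r y = c}) ∧
      Pairwise fun c c' => inner ℂ (b c) (b c') = 0 := by
  classical
  let e : N ≃ₗ[ℂ] (Quotient r → ℂ) :=
    { toFun := fun v c => v.1 c.out
      map_add' := fun _ _ => rfl
      map_smul' := fun _ _ => rfl
      invFun := fun g => ⟨WithLp.toLp 2 fun y => g (Quotient.mk r y), (hN _).2 fun y z hyz =>
        congrArg g (Quotient.sound hyz)⟩
      left_inv := fun v => Subtype.ext (by
        ext y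
        exact (hN v.1).1 v.2 _ _ (Quotient.mk_out y))
      right_inv := fun g => by
        ext c
        exact congrArg g (Quotient.out_eq c) }
  have hb : ∀ c, ((Basis.ofEquivFun e c : N) : EuclideanSpace ℂ X) =
      charVec {y | Quotient.mk r y = c} := by
    intro c
    rw [Basis.coe_ofEquivFun]
    ext y
    change (Pi.single c (1 : ℂ) : Quotient r → ℂ) (Quotient.mk r y) =
      Set.indicator {y | Quotient.mk r y = c} 1 y
    rw [Pi.single_apply, Set.indicator_apply]
    rfl
  refine ⟨Basis.ofEquivFun e, hb, fun c c' hcc => ?_⟩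
  beta_reduce
  rw [Submodule.coe_inner, hb, hb, PiLp.inner_apply]
  refine Finset.sum_eq_zero fun y _ => ?_
  change inner ℂ (Set.indicator {y | Quotient.mk r y = c} (1 : X → ℂ) y)
    (Set.indicator {y | Quotient.mk r y = c'} (1 : X → ℂ) y) = 0
  by_cases hy : Quotient.mk r y = c
  · rw [Set.indicator_of_notMem (s := {y | Quotient.mk r y = c'}) fun e => hcc (hy.symm.trans e),
      inner_zero_right]
  · rw [Set.indicator_of_notMem (s := {y | Quotient.mk r y = c}) hy, inner_zero_left]

/-- Needed because the closed formula for the eigenvalues and `eigval`, which contains a truncated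
subtraction, are compared only for indices up to `D`. -/
theorem nucleus_congr {θ θ' : ℕ → ℝ} (h : ∀ i ≤ D, θ i = θ' i) :
    nucleus Γ D θ x = nucleus Γ D θ' x := by
  have h1 : ∀ W, dualSupport Γ D θ W = dualSupport Γ D θ' W := fun W => by
    ext i
    exact and_congr_right fun hi => by rw [h i hi]
  simp only [nucleus, displacement, dualEndpoint, h1]

end Nucleus

namespace PolarSpace

open Nucleus

variable {F U : Type*} [Field F] [AddCommGroup U] [Module F U] {P : PolarSpace F U} {D s : ℕ}

theorem qInt_cast_mul {q : ℕ} (n : ℕ) : (qInt q n : ℝ) * ((q : ℝ) - 1) = (q : ℝ) ^ n - 1 := by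
  rw [← geom_sum_mul, qInt]
  push_cast
  rfl

theorem eigenvalue_eq_eigval (τ : DualPolarType) {q i : ℕ} (hq : 2 ≤ q)
    (hs : (s : ℝ) = (q : ℝ) ^ (τ.e + 1)) (hi : i ≤ D) :
    τ.eigenvalue q D i = eigval q s D i := by
  have hq0 : (0 : ℝ) < q := by exact_mod_cast (by omega : 0 < q)
  have hq1 : (q : ℝ) - 1 ≠ 0 := by
    have : (1 : ℝ) < q := by exact_mod_cast (by omega : 1 < q)
    linarith
  have h1 : (q : ℝ) ^ ((D : ℝ) + τ.e + 1 - (i : ℝ)) = s * (q : ℝ) ^ (D - i) := by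
    rw [hs, ← Real.rpow_natCast, ← Real.rpow_add hq0, Nat.cast_sub hi]
    congr 1
    ring
  have h2 : (q : ℝ) ^ D = (q : ℝ) ^ i * (q : ℝ) ^ (D - i) := by
    rw [← pow_add, Nat.add_sub_cancel' hi]
  have h3 := qInt_cast_mul (q := q) i
  have h4 := qInt_cast_mul (q := q) (D - i)
  rw [DualPolarType.eigenvalue, h1, ← hs, eigval, ← mul_div_assoc, ← sub_div, div_eq_iff hq1, h2]
  linear_combination -(s : ℝ) * h4 + h3

variable [Finite F] [Finite U] [FiniteDimensional F U]

/-- A dual polar graph with two vertices on each line is bipartite. -/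
theorem HasOrder.isBipartite (h : P.HasOrder D 1) (x : P.Vertex) : (P.graph D).IsBipartite := by
  -- Colour by the parity of the distance to `x`: adjacent vertices with equal parity would be on
  -- the same level, but the valency inside a level is a multiple of s - 1 = 0.
  refine ⟨SimpleGraph.Coloring.mk
    (fun y => (⟨(P.graph D).dist x y % 2, Nat.mod_lt _ two_pos⟩ : Fin 2)) ?_⟩
  intro y z hyz he
  have he' : (P.graph D).dist x y % 2 = (P.graph D).dist x z % 2 := congrArg Fin.val he
  have h1 := h.dist_le_succ x hyz
  have h2 := h.dist_le_succ x hyz.symm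
  have h3 := h.card_level x y
  rw [Nat.sub_self, mul_zero] at h3
  have : Finite (Submodule F U) := Finite.of_injective _ SetLike.coe_injective
  have : Nonempty {w // (P.graph D).Adj y w ∧ (P.graph D).dist x w = (P.graph D).dist x y} :=
    ⟨z, hyz, by omega⟩
  exact Nat.card_pos.ne' h3

end PolarSpace

namespace PolarForm

open Nucleus

variable {F U : Type*} [Field F] [Finite F] [AddCommGroup U] [Module F U] [Finite U]

/-- The nucleus consists of the vectors that are constant on the connected components of the
subconstituents, and these are within distance `D` of the base vertex. -/
theorem mem_nucleus_iff (Φ : PolarForm F U) {τ : DualPolarType} {D : ℕ} (hD : 1 ≤ D)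
    (hΦ : Φ.IsOfType τ D) (hnb : ¬ (Φ.dualPolarGraph D).IsBipartite) (x : Φ.Vertex) :
    (∀ y, (Φ.dualPolarGraph D).dist x y ≤ D) ∧ ∀ v, v ∈ Φ.nucleus τ D x ↔
      ∀ y z, sim (Φ.dualPolarGraph D) x y z → v y = v z := by
  have : FiniteDimensional F U := inferInstance
  obtain ⟨P, s, hI, h, hs, hs'⟩ := exists_polarSpace hΦ
  have hq : 2 ≤ Nat.card F := Finite.one_lt_card
  -- The vertex type depends on the isotropy predicate, so the claim is stated for an arbitrary
  -- predicate and instances, in order that its equality with `P.Iso` can be substituted.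
  have key : ∀ (I : Submodule F U → Prop) (_ : I = P.Iso)
      [Fintype {W : Submodule F U // Maximal I W}] [DecidableEq {W : Submodule F U // Maximal I W}]
      (_ : ¬ (polarGraph I D).IsBipartite) (x : {W : Submodule F U // Maximal I W}),
      (∀ y, (polarGraph I D).dist x y ≤ D) ∧
      ∀ v, v ∈ Nucleus.nucleus (polarGraph I D) D (τ.eigenvalue (Nat.card F) D) x ↔
        ∀ y z, sim (polarGraph I D) x y z → v y = v z := by
    rintro _ rfl _ _ hnb x
    have : Nonempty P.Vertex := ⟨x⟩
    have hs2 : 2 ≤ s := by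
      by_contra hcon
      obtain rfl : s = 1 := by omega
      exact hnb (h.isBipartite x)
    refine ⟨(h.isDistReg hs).dist_le x, fun v => ?_⟩
    rw [nucleus_congr fun i hi => PolarSpace.eigenvalue_eq_eigval τ hq hs' hi]
    exact h.mem_nucleus_iff hs2 hD x
  exact key Φ.IsIsotropic hI hnb x

end PolarForm

theorem theorem10p5 {F U : Type*} [Field F] [Finite F] [AddCommGroup U] [Module F U] [Finite U]
    (Φ : PolarForm F U) (τ : DualPolarType) (D : ℕ) (hD : 1 ≤ D) (hΦ : Φ.IsOfType τ D)
    (hnb : ¬ (Φ.dualPolarGraph D).IsBipartite) (x : Φ.Vertex) :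
    (∃ b : Module.Basis (Quotient (Nucleus.sim (Φ.dualPolarGraph D) x)) ℂ (Φ.nucleus τ D x),
      (∀ c, (b c : EuclideanSpace ℂ Φ.Vertex) =
        Nucleus.charVec {y | Quotient.mk (Nucleus.sim (Φ.dualPolarGraph D) x) y = c}) ∧
      Pairwise fun c c' => inner ℂ (b c) (b c') = 0) ∧
    (∀ i ≤ D,
      {C ∈ (Nucleus.sim (Φ.dualPolarGraph D) x).classes |
        C ⊆ Nucleus.subconstituent (Φ.dualPolarGraph D) x i} =
      Nucleus.components (Φ.dualPolarGraph D) x i) ∧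
    (Nucleus.sim (Φ.dualPolarGraph D) x).classes =
      {C | ∃ i ≤ D, C ∈ Nucleus.components (Φ.dualPolarGraph D) x i} := by
  obtain ⟨h1, h2⟩ := Φ.mem_nucleus_iff hD hΦ hnb x
  exact ⟨Nucleus.exists_basis_charVec _ h2, fun i _ => Nucleus.classes_subset_eq_components i,
    Nucleus.classes_eq_components h1⟩
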